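/- Let $N\ge 1$ and let $\Omega\subset\mathbb R^N$ be a bounded domain whose boundary $\Gamma=\partial\Omega$ is of class $C^2$ (locally $\Omega$ is the set where a $C^2$ function with non-vanishing differential is negative). Let $\nu$ be the outer unit normal to $\Gamma$ and $dS$ the $(N-1)$-dimensional Hausdorff measure. Let $\Omega_\varepsilon$, $0<\varepsilon<\varepsilon_0$, be uniformly bounded open sets such that every compact subset of $\Omega$ is contained in $\Omega_\varepsilon$, and every compact subset of $\mathbb R^N\setminus\overline\Omega$ is disjoint from $\Omega_\varepsilon$, for all small $\varepsilon$. Suppose that there are $\varphi_\varepsilon\in W^{1,\infty}(\Gamma,\mathbb R)$ such that $x\mapsto \Psi_\varepsilon(x)=x+\varphi_\varepsilon(x)\nu(x)$ is a bijection from $\Gamma$ onto $\Gamma_\varepsilon=\partial\Omega_\varepsilon$, with $\|\varphi_\varepsilon\|_{L^\infty(\Gamma)}=O(\varepsilon)$ and $\|D\varphi_\varepsilon\|_{L^\infty(\Gamma)}=O(1)$ as $\varepsilon\to0$. Let $\tilde\nu_\varepsilon(x)$ be the outer unit normal to $\Gamma_\varepsilon$ at $\Psi_\varepsilon(x)$,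 and let $\gamma_\varepsilon$ be the surface element on $\Gamma$ determined by $\int_{\Gamma_\varepsilon} g\,dS=\int_\Gamma g(\Psi_\varepsilon(x))\gamma_\varepsilon(x)\,dS(x)$ for all integrable $g$. Put $$\hat D\varphi_\varepsilon(x)=\nu(x)-\sum_{i=1}^{N-1}\langle D\varphi_\varepsilon(x),\tau_i(x)\rangle\,\tau_i(x),$$ where $(\tau_i(x))_i$ is an orthonormal basis of $T_x\Gamma$, and suppose that $\hat D\varphi_\varepsilon$ generates a Young measure $(\mu_x)_{x\in\Gamma}$ as $\varepsilon\to0$: the $\mu_x$ are positive measures on $\mathbb R^N$ with $\mu_x(\mathbb R^N)\le1$, depending measurably on $x$, and for every $F\in C_0(\mathbb R^N)$ the functions $F(\hat D\varphi_\varepsilon)$ converge weak-* in $L^\infty(\Gamma)$ to $x\mapsto\int F\,d\mu_x$. Let $1<p<\infty$ and $1<q<p^*$, where $p^*=\frac{(N-1)p}{N-p}$ if $p<N$ and $p^*=\infty$ if $p\ge N$. Let $V$ be a finite-dimensional real normed space, let $m\ge0$ be an integer with $m<q$, and let $$w(x,n,u)=\sum_{i=0}^m a_i(n)[u,\dots,u]\qquad(x\in\Gamma,\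 n\in\mathbb S^{N-1},\ u\in V),$$ where $a_i(n)$ is a real-valued $i$-linear form on $V$ that depends continuously on $n\in\mathbb S^{N-1}$. Let $$w_h(x,u)=\int_{\nu(x)+T_x\Gamma}w\Big(x,\frac{v}{|v|},u\Big)|v|\,d\mu_x(v)$$ be the homogenised surface energy. Then: 1. For each $i\le m$, $a_i(\tilde\nu_\varepsilon)\gamma_\varepsilon$ converges weak-* in $L^\infty(\Gamma)$, as $\varepsilon\to0$, to $$A_i(x)=\int_{\nu(x)+T_x\Gamma}a_i\Big(\frac{v}{|v|}\Big)|v|\,d\mu_x(v).$$ 2. For almost every $x\in\Gamma$ and all $u\in V$, $w_h(x,u)=\sum_{i=0}^m A_i(x)[u,\dots,u]$. 3. $w_h$ is the limit of the surface energies: for every $u\in L^q(\Gamma,V)$, the functions $w_h(\cdot,u)$ and, for all small $\varepsilon$, $w(\cdot,\tilde\nu_\varepsilon,u)\gamma_\varepsilon$ are integrable on $\Gamma$, and $\int_\Gamma w(x,\tilde\nu_\varepsilon(x),u(x))\gamma_\varepsilon(x)\,dS(x)\to\int_\Gamma w_h(x,u(x))\,dS(x)$ as $\varepsilon\to0$.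 -/

import Mathlib

open MeasureTheory Filter Topology Set
open scoped InnerProductSpace ZeroAtInfty

noncomputable section

/-- Surface measure on a subset `S` of `ℝ^N`: the `(N-1)`-dimensional Hausdorff measure
(normalised so as to agree with Lebesgue measure on hyperplanes), restricted to `S`. -/
def surfaceMeasure {N : ℕ} (S : Set (EuclideanSpace ℝ (Fin N))) :
    Measure (EuclideanSpace ℝ (Fin N)) :=
  (μHE[N - 1]).restrict S

/-- `Ω` is a bounded domain whose boundary is of class `C²`: near each boundary point,
`Ω` is the set where a `C²` function with non-vanishing differential is negative. -/
structure IsC2Domain {N : ℕ} (Ω : Set (EuclideanSpace ℝ (Fin N))) : Prop where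
  isOpen : IsOpen Ω
  isConnected : IsConnected Ω
  isBounded : Bornology.IsBounded Ω
  boundary : ∀ x ∈ frontier Ω, ∃ ρ : EuclideanSpace ℝ (Fin N) → ℝ,
    ContDiffAt ℝ 2 ρ x ∧ fderiv ℝ ρ x ≠ 0 ∧ ∀ᶠ z in 𝓝 x, (z ∈ Ω ↔ ρ z < 0)

/-- `n` is the outer unit normal to `U` at the point `y`: outside every cone
`|⟨z - y, n⟩| ≤ δ |z - y|` around the hyperplane `y + n^⊥`, and close to `y`, the set `U` coincides
with the half space `⟨z - y, n⟩ < 0`. -/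
def IsOuterNormalAt {N : ℕ} (U : Set (EuclideanSpace ℝ (Fin N)))
    (y n : EuclideanSpace ℝ (Fin N)) : Prop :=
  ‖n‖ = 1 ∧ ∀ δ : ℝ, 0 < δ → ∀ᶠ z in 𝓝 y,
    (⟪z - y, n⟫_ℝ < -(δ * ‖z - y‖) → z ∈ U) ∧ (δ * ‖z - y‖ < ⟪z - y, n⟫_ℝ → z ∉ U)

/-- The outer unit normal is unique where it exists. -/
theorem IsOuterNormalAt.unique {N : ℕ} {U : Set (EuclideanSpace ℝ (Fin N))}
    {y n n' : EuclideanSpace ℝ (Fin N)} (h : IsOuterNormalAt U y n)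
    (h' : IsOuterNormalAt U y n') : n = n' := by
  by_contra hne
  have h1 : ⟪n' - n, n⟫_ℝ < 0 := by
    have := inner_lt_one_iff_real_of_norm_eq_one h'.1 h.1 |>.2 (Ne.symm hne)
    rw [inner_sub_left, real_inner_self_eq_norm_sq, h.1]; linarith
  have h2 : 0 < ⟪n' - n, n'⟫_ℝ := by
    have := inner_lt_one_iff_real_of_norm_eq_one h.1 h'.1 |>.2 hne
    rw [inner_sub_left, real_inner_self_eq_norm_sq, h'.1]; linarith
  set d := n' - n with hd
  have hd0 : 0 < ‖d‖ := by
    rw [norm_pos_iff]; rintro h0; rw [h0] at h1; simp at h1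
  obtain ⟨δ, hδ, hδ1, hδ2⟩ : ∃ δ : ℝ, 0 < δ ∧ ⟪d, n⟫_ℝ < -(δ * ‖d‖) ∧ δ * ‖d‖ < ⟪d, n'⟫_ℝ := by
    refine ⟨min (-⟪d, n⟫_ℝ) ⟪d, n'⟫_ℝ / (2 * ‖d‖), by
      have : 0 < min (-⟪d, n⟫_ℝ) ⟪d, n'⟫_ℝ := lt_min (by linarith) h2
      positivity, ?_, ?_⟩
    all_goals
      have e : min (-⟪d, n⟫_ℝ) ⟪d, n'⟫_ℝ / (2 * ‖d‖) * ‖d‖ = min (-⟪d, n⟫_ℝ) ⟪d, n'⟫_ℝ / 2 := by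
        field_simp
      rw [e]
      have m1 := min_le_left (-⟪d, n⟫_ℝ) ⟪d, n'⟫_ℝ
      have m2 := min_le_right (-⟪d, n⟫_ℝ) ⟪d, n'⟫_ℝ
      linarith
  have hc : Tendsto (fun t : ℝ => y + t • d) (𝓝[>] 0) (𝓝 y) := by
    have : Continuous (fun t : ℝ => y + t • d) := by fun_prop
    have := this.tendsto 0
    simp only [zero_smul, add_zero] at this
    exact this.mono_left nhdsWithin_le_nhds
  have e1 := hc.eventually (h.2 δ hδ)
  have e2 := hc.eventually (h'.2 δ hδ)
  obtain ⟨t, ⟨ht1, ht2⟩, ht⟩ := ((e1.and e2).and self_mem_nhdsWithin).exists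
  have ht : 0 < t := ht
  simp only [add_sub_cancel_left, inner_smul_left, norm_smul, Real.norm_eq_abs, abs_of_pos ht,
    RCLike.conj_to_real] at ht1 ht2
  exact ht2.2 (by nlinarith) (ht1.1 (by nlinarith))

open Classical in
/-- The outer unit normal to `U` at `y` (with value `0` where there is none). -/
def outerNormal {N : ℕ} (U : Set (EuclideanSpace ℝ (Fin N)))
    (y : EuclideanSpace ℝ (Fin N)) : EuclideanSpace ℝ (Fin N) :=
  if h : ∃ n, IsOuterNormalAt U y n then h.choose else 0

/-- The tangent space `T_x Γ` of `Γ = ∂Ω`, as the orthogonal complement of the normal. -/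
def tangentPlane {N : ℕ} (Ω : Set (EuclideanSpace ℝ (Fin N)))
    (x : EuclideanSpace ℝ (Fin N)) : Submodule ℝ (EuclideanSpace ℝ (Fin N)) :=
  (ℝ ∙ outerNormal Ω x)ᗮ

/-- The tangential gradient `∑ᵢ ⟨Dψ(x), τᵢ⟩ τᵢ` on `Γ = ∂Ω` (for an orthonormal basis `τᵢ` of
`T_x Γ`): the orthogonal projection onto `T_x Γ` of the vector that represents a derivative of `ψ`
along `Γ`. Two derivatives along `Γ` agree on `T_x Γ`, so the projection does not depend on
which of them is used. -/
def tangentialGradient {N : ℕ} (Ω : Set (EuclideanSpace ℝ (Fin N)))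
    (ψ : EuclideanSpace ℝ (Fin N) → ℝ) (x : EuclideanSpace ℝ (Fin N)) :
    EuclideanSpace ℝ (Fin N) :=
  (tangentPlane Ω x).starProjection
    ((InnerProductSpace.toDual ℝ (EuclideanSpace ℝ (Fin N))).symm
      (fderivWithin ℝ ψ (frontier Ω) x))

/-- The vector field `D̂ψ(x) = ν(x) - ∑ᵢ ⟨Dψ(x), τᵢ⟩ τᵢ` on `Γ = ∂Ω`. -/
def pseudoDerivative {N : ℕ} (Ω : Set (EuclideanSpace ℝ (Fin N)))
    (ψ : EuclideanSpace ℝ (Fin N) → ℝ) (x : EuclideanSpace ℝ (Fin N)) :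
    EuclideanSpace ℝ (Fin N) :=
  outerNormal Ω x - tangentialGradient Ω ψ x

/-- The normal graph map `x ↦ x + ψ(x) ν(x)` over `Γ = ∂Ω`. -/
def graphMap {N : ℕ} (Ω : Set (EuclideanSpace ℝ (Fin N)))
    (ψ : EuclideanSpace ℝ (Fin N) → ℝ) (x : EuclideanSpace ℝ (Fin N)) :
    EuclideanSpace ℝ (Fin N) :=
  x + ψ x • outerNormal Ω x

/-- The sets `Ωε`, `0 < ε < ε₀`, are uniformly bounded and open, approach `Ω` from inside and from
outside as `ε → 0`, and `∂Ωε` is the normal graph over `Γ = ∂Ω` of a function `φ ε` in `W^{1,∞}(Γ)`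
(that is, a Lipschitz function on `Γ`), with `‖φ ε‖_∞ = O(ε)` and `‖D(φ ε)‖_∞ = O(1)`. -/
structure IsRugosePerturbation {N : ℕ} (Ω : Set (EuclideanSpace ℝ (Fin N)))
    (Ωε : ℝ → Set (EuclideanSpace ℝ (Fin N))) (φ : ℝ → EuclideanSpace ℝ (Fin N) → ℝ)
    (ε₀ : ℝ) : Prop where
  isOpen : ∀ ε ∈ Ioo 0 ε₀, IsOpen (Ωε ε)
  bounded : ∃ R : ℝ, ∀ ε ∈ Ioo 0 ε₀, Ωε ε ⊆ Metric.ball 0 R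
  inner_approx : ∀ K : Set (EuclideanSpace ℝ (Fin N)), IsCompact K → K ⊆ Ω →
    ∀ᶠ ε in 𝓝[>] (0 : ℝ), K ⊆ Ωε ε
  outer_approx : ∀ K : Set (EuclideanSpace ℝ (Fin N)), IsCompact K → K ⊆ (closure Ω)ᶜ →
    ∀ᶠ ε in 𝓝[>] (0 : ℝ), Disjoint K (Ωε ε)
  lipschitz : ∀ ε ∈ Ioo 0 ε₀, ∃ L, LipschitzOnWith L (φ ε) (frontier Ω)
  bijOn : ∀ ε ∈ Ioo 0 ε₀, BijOn (graphMap Ω (φ ε)) (frontier Ω) (frontier (Ωε ε))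
  bound : ∃ C : ℝ, ∀ᶠ ε in 𝓝[>] (0 : ℝ), ∀ x ∈ frontier Ω, |φ ε x| ≤ C * ε
  bound_deriv : ∃ C : ℝ, ∀ᶠ ε in 𝓝[>] (0 : ℝ), ∀ᵐ x ∂(surfaceMeasure (frontier Ω)),
    ‖tangentialGradient Ω (φ ε) x‖ ≤ C

/-- The surface element of a bijection `Ψ : S → T` between hypersurfaces: the density, with respect
to the surface measure of `S`, of the surface measure of `T` transported to `S` by `Ψ⁻¹`. -/
def surfaceElement {N : ℕ} (Ψ : EuclideanSpace ℝ (Fin N) → EuclideanSpace ℝ (Fin N))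
    (S T : Set (EuclideanSpace ℝ (Fin N))) (x : EuclideanSpace ℝ (Fin N)) : ℝ :=
  (((surfaceMeasure T).map (Function.invFunOn Ψ S)).rnDeriv (surfaceMeasure S) x).toReal

/-- The surface element is the density in the change of variables formula
`∫_T g dS = ∫_S g (Ψ x) γ(x) dS(x)`. -/
theorem integral_eq_integral_surfaceElement {N : ℕ}
    {Ψ : EuclideanSpace ℝ (Fin N) → EuclideanSpace ℝ (Fin N)}
    {S T : Set (EuclideanSpace ℝ (Fin N))} {L : NNReal} (hS : IsCompact S)
    (hΨ : LipschitzOnWith L Ψ S) (hb : BijOn Ψ S T) (hfin : surfaceMeasure S univ ≠ ⊤)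
    {g : EuclideanSpace ℝ (Fin N) → ℝ} (hg : Measurable g) :
    ∫ y, g y ∂(surfaceMeasure T) =
      ∫ x, g (Ψ x) * surfaceElement Ψ S T x ∂(surfaceMeasure S) := by
  classical
  have hTc : IsCompact T := hb.image_eq ▸ hS.image_of_continuousOn hΨ.continuousOn
  have himg : ∀ A ⊆ S, (μHE[N - 1] : Measure (EuclideanSpace ℝ (Fin N))) A = 0 →
      (μHE[N - 1] : Measure (EuclideanSpace ℝ (Fin N))) (Ψ '' A) = 0 := by
    intro A hA h0
    rw [Measure.euclideanHausdorffMeasure_def] at h0 ⊢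
    simp only [Measure.smul_apply, smul_eq_zero] at h0 ⊢
    refine h0.imp id fun h0 => ?_
    have := (hΨ.mono hA).hausdorffMeasure_image_le (d := ((N - 1 : ℕ) : ℝ)) (by positivity)
    rw [h0, mul_zero] at this
    exact le_antisymm this zero_le
  have hfinT : surfaceMeasure T univ ≠ ⊤ := by
    rw [surfaceMeasure, Measure.restrict_apply_univ] at hfin ⊢
    rw [← hb.image_eq]
    rw [Measure.euclideanHausdorffMeasure_def] at hfin ⊢
    have h1 := hΨ.hausdorffMeasure_image_le (d := ((N - 1 : ℕ) : ℝ)) (by positivity)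
    rw [Measure.smul_apply, ENNReal.smul_def, smul_eq_mul] at hfin ⊢
    refine ne_top_of_le_ne_top ?_ (mul_le_mul_right h1 _)
    rw [mul_left_comm]
    exact ENNReal.mul_ne_top (ENNReal.rpow_ne_top_of_nonneg (by positivity) (by simp)) hfin
  have : IsFiniteMeasure (surfaceMeasure S) := ⟨hfin.lt_top⟩
  have : IsFiniteMeasure (surfaceMeasure T) := ⟨hfinT.lt_top⟩
  have hmT : MeasurableSet T := hTc.measurableSet
  have hmaps : MapsTo (Function.invFunOn Ψ S) T S := hb.surjOn.mapsTo_invFunOn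
  have hright : ∀ y ∈ T, Ψ (Function.invFunOn Ψ S y) = y := hb.surjOn.rightInvOn_invFunOn
  have hleft : ∀ x ∈ S, Function.invFunOn Ψ S (Ψ x) = x := hb.injOn.leftInvOn_invFunOn
  have hcont : ContinuousOn (Function.invFunOn Ψ S) T := by
    rw [continuousOn_iff_isClosed]
    intro C hC
    refine ⟨Ψ '' (S ∩ C), ((hS.inter_right hC).image_of_continuousOn
      (hΨ.continuousOn.mono inter_subset_left)).isClosed, ?_⟩
    ext y
    constructor
    · rintro ⟨hy, hyT⟩
      exact ⟨⟨_, ⟨hmaps hyT, hy⟩, hright y hyT⟩, hyT⟩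
    · rintro ⟨⟨x, ⟨hxS, hxC⟩, rfl⟩, hyT⟩
      exact ⟨by simpa [hleft x hxS] using hxC, hyT⟩
  have hinv : AEMeasurable (Function.invFunOn Ψ S) (surfaceMeasure T) :=
    hcont.aemeasurable hmT
  set κ := (surfaceMeasure T).map (Function.invFunOn Ψ S) with hκ
  have hκfin : IsFiniteMeasure κ := Measure.isFiniteMeasure_map _ _
  have hac : κ ≪ surfaceMeasure S := by
    refine Measure.AbsolutelyContinuous.mk fun A hA h0 => ?_
    rw [hκ, Measure.map_apply_of_aemeasurable hinv hA, surfaceMeasure,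
      Measure.restrict_apply' hmT]
    rw [surfaceMeasure, Measure.restrict_apply hA] at h0
    refine measure_mono_null ?_ (himg (A ∩ S) inter_subset_right h0)
    rintro y ⟨hyA, hyT⟩
    exact ⟨_, ⟨hyA, hmaps hyT⟩, hright y hyT⟩
  have hleb : κ.HaveLebesgueDecomposition (surfaceMeasure S) :=
    Measure.haveLebesgueDecomposition_of_sigmaFinite κ (surfaceMeasure S)
  have hmS : MeasurableSet S := hS.measurableSet
  have hΨm : AEMeasurable Ψ κ := by
    have h1 : AEMeasurable Ψ (surfaceMeasure S) := hΨ.continuousOn.aemeasurable hmS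
    exact h1.mono_ac hac
  calc ∫ y, g y ∂(surfaceMeasure T)
      = ∫ y, g (Ψ (Function.invFunOn Ψ S y)) ∂(surfaceMeasure T) := by
        refine integral_congr_ae ?_
        rw [surfaceMeasure]
        filter_upwards [ae_restrict_mem hmT] with y hy
        rw [hright y hy]
    _ = ∫ x, g (Ψ x) ∂κ := by
        rw [hκ, integral_map hinv]
        exact (hg.comp_aemeasurable hΨm).aestronglyMeasurable
    _ = ∫ x, g (Ψ x) * surfaceElement Ψ S T x ∂(surfaceMeasure S) := by
        rw [← integral_rnDeriv_smul (f := fun x => g (Ψ x)) hac]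
        refine integral_congr_ae (Eventually.of_forall fun x => ?_)
        simp only [smul_eq_mul, surfaceElement]
        rw [mul_comm]

/-- The field `f ε` generates, as `ε → 0⁺`, the Young measure `(μ x)` with respect to `σ`: the
`μ x` are positive measures of mass at most one that depend measurably on `x`, and for each
`F ∈ C₀`, `F (f ε)` converges weak-* in `L^∞(σ)` to `x ↦ ∫ F dμ_x`. -/
structure GeneratesYoungMeasure {N : ℕ} (σ : Measure (EuclideanSpace ℝ (Fin N)))
    (f : ℝ → EuclideanSpace ℝ (Fin N) → EuclideanSpace ℝ (Fin N))
    (μ : EuclideanSpace ℝ (Fin N) → Measure (EuclideanSpace ℝ (Fin N))) : Prop where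
  aemeasurable : AEMeasurable μ σ
  mass_le_one : ∀ᵐ x ∂σ, μ x univ ≤ 1
  tendsto : ∀ (F : C₀(EuclideanSpace ℝ (Fin N), ℝ)) (g : EuclideanSpace ℝ (Fin N) → ℝ),
    Integrable g σ →
    Tendsto (fun ε => ∫ x, g x * F (f ε x) ∂σ) (𝓝[>] (0 : ℝ))
      (𝓝 (∫ x, g x * ∫ v, F v ∂(μ x) ∂σ))

/-- Weak-* convergence in `L^∞(σ)` of `f ε` to `f₀`, as `ε → 0⁺`. -/
def TendstoWeakStarLinfty {X W : Type*} [MeasurableSpace X] [NormedAddCommGroup W]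
    [NormedSpace ℝ W] (σ : Measure X) (f : ℝ → X → W) (f₀ : X → W) : Prop :=
  (∀ᶠ ε in 𝓝[>] (0 : ℝ), MemLp (f ε) ⊤ σ) ∧ MemLp f₀ ⊤ σ ∧
    ∀ g : X → ℝ, Integrable g σ →
      Tendsto (fun ε => ∫ x, g x • f ε x ∂σ) (𝓝[>] (0 : ℝ)) (𝓝 (∫ x, g x • f₀ x ∂σ))

/-- The average `∫_{ν(x) + T_xΓ} b(v / |v|) |v| dμ_x(v)` of a function `b` on the unit sphere. -/
def homogenisedValue {N : ℕ} {W : Type*} [NormedAddCommGroup W] [NormedSpace ℝ W]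
    (Ω : Set (EuclideanSpace ℝ (Fin N)))
    (μ : EuclideanSpace ℝ (Fin N) → Measure (EuclideanSpace ℝ (Fin N)))
    (b : EuclideanSpace ℝ (Fin N) → W) (x : EuclideanSpace ℝ (Fin N)) : W :=
  ∫ v in {v | v - outerNormal Ω x ∈ tangentPlane Ω x}, ‖v‖ • b (‖v‖⁻¹ • v) ∂(μ x)

/-- The homogenised surface energy
`w_h(x, u) = ∫_{ν(x) + T_xΓ} w(x, v / |v|, u) |v| dμ_x(v)`. -/
def homogenisedEnergy {N : ℕ} {V : Type*} (Ω : Set (EuclideanSpace ℝ (Fin N)))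
    (μ : EuclideanSpace ℝ (Fin N) → Measure (EuclideanSpace ℝ (Fin N)))
    (w : EuclideanSpace ℝ (Fin N) → EuclideanSpace ℝ (Fin N) → V → ℝ)
    (x : EuclideanSpace ℝ (Fin N)) (u : V) : ℝ :=
  homogenisedValue Ω μ (fun n => w x n u) x

end

/-! Extend each coefficient from the sphere by positive homogeneity, `H_i v = ‖v‖ a_i(v / ‖v‖)`.
This is continuous on all of `ℝ^N`, also at `0`. Since `γ_ε ≥ 0` and the normal `ν̃_ε` has norm one,
`γ_ε a_i(ν̃_ε) = H_i(γ_ε ν̃_ε)`, so everything reduces to the vector field `γ_ε ν̃_ε`. The central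
fact (`IsRugosePerturbation.exists_asymptotics`) is that this field differs from `D̂φ_ε` by an error
tending to zero uniformly almost everywhere. As `D̂φ_ε` is bounded and `H_i` is uniformly continuous
on balls, `H_i(γ_ε ν̃_ε)` has the same weak-* limit as `H_i(D̂φ_ε)`, namely `∫ H_i dμ_x`. The Young
measure inherits from `D̂φ_ε` that it lives in a ball and on the plane `ν(x) + T_xΓ`; the ball
allows test functions that do not vanish at infinity, and the plane yields the domain of integration
in `A_i`.

The asymptotics have two halves. For the direction, in a tube around `Γ` with nearest point
projection `P` and signed distance `t`, the set `Ω_ε` is `{t < φ_ε ∘ P}`, so its normal is the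
normalised gradient of `t - φ_ε ∘ P`. On `Γ` itself `Dt` is `ν` and `DP` is the tangential
projection, so this gradient tends to `ν - ∇_Γ φ_ε = D̂φ_ε`, however oscillating the slopes are,
because only `|φ_ε|` has to be small. For the length, `Γ` is cut, up to a null set, into countably
many pieces on which it is almost flat and `φ_ε` almost affine. There the graph map is close to a
linear tilt `v ↦ v + ⟨l, v⟩ n`, whose Jacobian on the plane orthogonal to `n` is `√(1 + |l|²)`, and
`√(1 + |∇_Γ φ_ε|²) = |D̂φ_ε|`.

The statements on energies follow by finite-dimensional linear algebra: `A ↦ A[u(x), …, u(x)]` is a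
linear functional whose coefficients are integrable because `u ∈ L^q` and the degree is below `q`,
so it is an admissible test for the convergence of the coefficients. -/

noncomputable section

/-! ### Comparison of Hausdorff measures -/

/-- If distances of `f`-values are controlled by distances of `g`-values on `A`, then the Hausdorff
measures of the images compare accordingly. -/
theorem euclideanHausdorffMeasure_image_le_of_dist_le {α X Y : Type*} [MetricSpace X]
    [MeasurableSpace X] [BorelSpace X] [MetricSpace Y] [MeasurableSpace Y] [BorelSpace Y]
    [Nonempty α] {f : α → X} {g : α → Y} {A : Set α} {K : NNReal} (d : ℕ)
    (h : ∀ x ∈ A, ∀ y ∈ A, dist (f x) (f y) ≤ K * dist (g x) (g y)) :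
    (μHE[d] : Measure X) (f '' A) ≤ (K : ENNReal) ^ d * (μHE[d] : Measure Y) (g '' A) := by
  have hinv : ∀ y ∈ g '' A, Function.invFunOn g A y ∈ A ∧ g (Function.invFunOn g A y) = y :=
    fun y hy => ⟨Function.invFunOn_mem hy, Function.invFunOn_eq hy⟩
  have hL : LipschitzOnWith K (f ∘ Function.invFunOn g A) (g '' A) := by
    refine LipschitzOnWith.of_dist_le_mul fun y hy z hz => ?_
    have := h _ (hinv y hy).1 _ (hinv z hz).1
    rwa [(hinv y hy).2, (hinv z hz).2] at this
  -- Equal `g`-values force equal `f`-values, so `f` factors through `g` on `A` without any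
  -- injectivity.
  have himg : f '' A ⊆ (f ∘ Function.invFunOn g A) '' (g '' A) := by
    rintro _ ⟨x, hx, rfl⟩
    refine ⟨g x, mem_image_of_mem g hx, ?_⟩
    obtain ⟨h1, h2⟩ := hinv (g x) (mem_image_of_mem g hx)
    have := h _ h1 x hx
    rw [h2, dist_self, mul_zero] at this
    exact dist_le_zero.1 this
  refine (measure_mono himg).trans ?_
  have := hL.hausdorffMeasure_image_le (d := (d : ℝ)) (by positivity)
  rw [ENNReal.rpow_natCast] at this
  -- The normalising factor depends only on `d`, so it is the same in both spaces.
  simp only [Measure.euclideanHausdorffMeasure_def, Measure.smul_apply, ENNReal.smul_def,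
    smul_eq_mul]
  calc _ ≤ _ := mul_le_mul_right this _
    _ = _ := by ring

/-! ### Jacobian of maps close to a tilt -/

section Tilt

variable {E : Type*} [NormedAddCommGroup E] [InnerProductSpace ℝ E]

/-- The linear map `v ↦ v + ⟨l, v⟩ n`. -/
def tiltMap (n l : E) : E →L[ℝ] E :=
  ContinuousLinearMap.id ℝ E + (innerSL ℝ l).smulRight n

@[simp]
theorem tiltMap_apply (n l v : E) : tiltMap n l v = v + ⟪l, v⟫_ℝ • n := rfl

/-- Reverse triangle inequality for `v - ⟪n, v⟫ n`. It bounds distances in an almost flat set by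
those of the projections, so that such a set can be measured in its tangent plane. -/
theorem norm_sub_le_norm_orthogonalProjection {n v : E} {η : ℝ} (hn : ‖n‖ = 1)
    (h : |⟪v, n⟫_ℝ| ≤ η * ‖v‖) : (1 - η) * ‖v‖ ≤ ‖(ℝ ∙ n)ᗮ.orthogonalProjectionOnto v‖ := by
  have h1 : ((ℝ ∙ n)ᗮ.orthogonalProjectionOnto v : E) = v - ⟪n, v⟫_ℝ • n := by
    have := Submodule.starProjection_orthogonal_val (K := ℝ ∙ n) v
    rw [Submodule.starProjection_apply] at this
    rw [this, Submodule.starProjection_unit_singleton ℝ hn]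
  have h2 : ‖(ℝ ∙ n)ᗮ.orthogonalProjectionOnto v‖ = ‖v - ⟪n, v⟫_ℝ • n‖ := by rw [← h1]; rfl
  rw [h2]
  have h3 := norm_sub_norm_le v (⟪n, v⟫_ℝ • n)
  rw [norm_smul, hn, mul_one, Real.norm_eq_abs, real_inner_comm] at h3
  rw [real_inner_comm]
  linarith

variable [FiniteDimensional ℝ E]

/-- Because `n` is a unit vector orthogonal to the plane, adjoint times map is `v ↦ v + ⟪l, v⟫ l`
there, a rank-one perturbation of the identity with determinant `1 + ‖l‖²`. -/
theorem normDet_tiltMap_domRestrict {n l : E} (hn : ‖n‖ = 1) (hl : l ∈ (ℝ ∙ n)ᗮ) :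
    ((tiltMap n l : E →ₗ[ℝ] E).domRestrict (ℝ ∙ n)ᗮ).normDet = √(1 + ‖l‖ ^ 2) := by
  set T := (ℝ ∙ n)ᗮ
  set f := (tiltMap n l : E →ₗ[ℝ] E).domRestrict T
  have hT : ∀ v : T, ⟪n, (v : E)⟫_ℝ = 0 := fun v =>
    (Submodule.mem_orthogonal_singleton_iff_inner_right).1 v.2
  have hadj : f.adjoint ∘ₗ f = LinearMap.transvection
      ((innerSL ℝ (⟨l, hl⟩ : T) : T →L[ℝ] ℝ) : T →ₗ[ℝ] ℝ) ⟨l, hl⟩ := by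
    ext1 v
    refine ext_inner_right ℝ fun w => ?_
    rw [LinearMap.comp_apply, LinearMap.adjoint_inner_left]
    have h1 : ∀ v : T, f v = v + ⟪l, (v : E)⟫_ℝ • n := fun v => rfl
    rw [h1, h1]
    simp only [LinearMap.transvection.apply, inner_add_left, inner_add_right, inner_smul_left,
      inner_smul_right, hT, real_inner_comm n, real_inner_self_eq_norm_sq, hn, Submodule.coe_inner]
    simp [mul_comm]
  have h2 := f.normDet_sq
  rw [hadj, LinearMap.transvection.det] at h2
  have h3 : f.normDet ^ 2 = 1 + ‖l‖ ^ 2 := by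
    have : (innerSL ℝ (⟨l, hl⟩ : T)) ⟨l, hl⟩ = ‖l‖ ^ 2 := by
      rw [innerSL_apply_apply, real_inner_self_eq_norm_sq]; rfl
    simpa [this] using h2
  rw [← h3, Real.sqrt_sq f.normDet_nonneg]

theorem euclideanHausdorffMeasure_image_tiltMap [MeasurableSpace E] [BorelSpace E] {d : ℕ}
    (hd : Module.finrank ℝ E = d + 1) {n l : E}
    (hn : ‖n‖ = 1) (hl : l ∈ (ℝ ∙ n)ᗮ) (B : Set (ℝ ∙ n)ᗮ) :
    (μHE[d] : Measure E) ((fun v : (ℝ ∙ n)ᗮ => tiltMap n l v) '' B) =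
      ENNReal.ofReal √(1 + ‖l‖ ^ 2) * (μHE[d] : Measure (ℝ ∙ n)ᗮ) B := by
  have : Fact (Module.finrank ℝ E = d + 1) := ⟨hd⟩
  have hr : Module.finrank ℝ (ℝ ∙ n)ᗮ = d :=
    Submodule.finrank_orthogonal_span_singleton (by rintro rfl; simp at hn)
  have := LinearMap.euclideanHausdorffMeasure_image
    ((tiltMap n l : E →ₗ[ℝ] E).domRestrict (ℝ ∙ n)ᗮ) B
  rw [normDet_tiltMap_domRestrict hn hl, hr] at this
  exact this

/-- A map that is close to `v ↦ v + ⟨l, v⟩ n` on an almost flat set `A` with normal `n` multiplies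
the `d`-dimensional measure by almost `√(1 + ‖l‖²)`. -/
theorem euclideanHausdorffMeasure_image_near_tiltMap [MeasurableSpace E] [BorelSpace E] {d : ℕ}
    (hd : Module.finrank ℝ E = d + 1)
    {n l : E} (hn : ‖n‖ = 1) (hl : l ∈ (ℝ ∙ n)ᗮ) {A : Set E} {f : E → E} {η : ℝ} (hη : 0 ≤ η)
    (hη' : η ≤ 1 / 8) (hA : ∀ x ∈ A, ∀ y ∈ A, |⟪x - y, n⟫_ℝ| ≤ η * ‖x - y‖)
    (hf : ∀ x ∈ A, ∀ y ∈ A, ‖f x - f y - tiltMap n l (x - y)‖ ≤ η * ‖x - y‖) :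
    (μHE[d] : Measure E) (f '' A) ≤ ENNReal.ofReal ((1 + 8 * η) ^ (2 * d) * √(1 + ‖l‖ ^ 2)) *
      (μHE[d] : Measure E) A ∧
    ENNReal.ofReal √(1 + ‖l‖ ^ 2) * (μHE[d] : Measure E) A ≤
      ENNReal.ofReal ((1 + 8 * η) ^ (2 * d)) * (μHE[d] : Measure E) (f '' A) := by
  set P : E → (ℝ ∙ n)ᗮ := fun x => (ℝ ∙ n)ᗮ.orthogonalProjectionOnto x with hP
  -- The comparison map: project to the plane, then tilt. The tilt scales measure by an exactly
  -- known factor.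
  set g : E → E := fun x => tiltMap n l (P x) with hg
  set K : NNReal := Real.toNNReal (1 + 8 * η) with hK
  have hKr : (K : ℝ) = 1 + 8 * η := Real.coe_toNNReal _ (by positivity)
  have hK1 : (1 : ENNReal) ≤ (K : ENNReal) := by
    rw [ENNReal.one_le_coe_iff, ← NNReal.coe_le_coe, hKr]; simp [hη]
  have hKo : ENNReal.ofReal ((1 + 8 * η) ^ (2 * d)) = (K : ENNReal) ^ (2 * d) := by
    rw [ENNReal.ofReal_pow (by positivity)]; rfl
  have hPsub : ∀ x y, P x - P y = (ℝ ∙ n)ᗮ.orthogonalProjectionOnto (x - y) := fun x y => by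
    simp [hP]
  have hPc : ∀ v : E, ((ℝ ∙ n)ᗮ.orthogonalProjectionOnto v : E) = v - ⟪n, v⟫_ℝ • n := fun v => by
    have := Submodule.starProjection_orthogonal_val (K := ℝ ∙ n) v
    rw [Submodule.starProjection_apply] at this
    rw [this, Submodule.starProjection_unit_singleton ℝ hn]
  have hln : ⟪l, n⟫_ℝ = 0 := (Submodule.mem_orthogonal_singleton_iff_inner_left).1 hl
  have hgsub : ∀ x y, g x - g y = tiltMap n l (x - y) - ⟪n, x - y⟫_ℝ • n := fun x y => by
    rw [hg]
    simp only
    rw [← map_sub, ← Submodule.coe_sub, hPsub, hPc]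
    simp only [tiltMap_apply, inner_sub_right, inner_smul_right, hln]
    module
  have hPle : ∀ x y, ‖P x - P y‖ ≤ ‖x - y‖ := fun x y => by
    rw [hPsub]; exact Submodule.norm_orthogonalProjectionOnto_apply_le _ _
  have hPge : ∀ x ∈ A, ∀ y ∈ A, (1 - η) * ‖x - y‖ ≤ ‖P x - P y‖ := fun x hx y hy => by
    rw [hPsub]; exact norm_sub_le_norm_orthogonalProjection hn (hA x hx y hy)
  -- The tilt adds a component orthogonal to the plane, so by Pythagoras it never shortens.
  have hgP : ∀ x y, ‖P x - P y‖ ≤ ‖g x - g y‖ := fun x y => by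
    have e : g x - g y = ((P x - P y : (ℝ ∙ n)ᗮ) : E) + ⟪l, ((P x - P y : (ℝ ∙ n)ᗮ) : E)⟫_ℝ • n := by
      rw [hg]
      simp only
      rw [← map_sub, ← Submodule.coe_sub]; rfl
    have hz : ⟪((P x - P y : (ℝ ∙ n)ᗮ) : E), n⟫_ℝ = 0 :=
      (Submodule.mem_orthogonal_singleton_iff_inner_left).1 (P x - P y).2
    have := norm_add_sq_eq_norm_sq_add_norm_sq_real
      (x := ((P x - P y : (ℝ ∙ n)ᗮ) : E)) (y := ⟪l, ((P x - P y : (ℝ ∙ n)ᗮ) : E)⟫_ℝ • n)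
      (by rw [inner_smul_right, hz, mul_zero])
    rw [← e] at this
    change ‖((P x - P y : (ℝ ∙ n)ᗮ) : E)‖ ≤ _
    nlinarith [norm_nonneg (g x - g y), norm_nonneg ((P x - P y : (ℝ ∙ n)ᗮ) : E),
      norm_nonneg (⟪l, ((P x - P y : (ℝ ∙ n)ᗮ) : E)⟫_ℝ • n)]
  -- The two errors add up to `2η‖x - y‖`, and `‖x - y‖ ≤ 2‖g x - g y‖`; hence the factor `4η`.
  have hfg : ∀ x ∈ A, ∀ y ∈ A, ‖(f x - f y) - (g x - g y)‖ ≤ 4 * η * ‖g x - g y‖ := by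
    intro x hx y hy
    have e : (f x - f y) - (g x - g y) =
        (f x - f y - tiltMap n l (x - y)) + ⟪n, x - y⟫_ℝ • n := by rw [hgsub]; abel
    have h1 : ‖(f x - f y) - (g x - g y)‖ ≤ η * ‖x - y‖ + η * ‖x - y‖ := by
      rw [e]
      refine (norm_add_le _ _).trans (add_le_add (hf x hx y hy) ?_)
      rw [norm_smul, hn, mul_one, real_inner_comm]
      exact hA x hx y hy
    have h2 := hPge x hx y hy
    have h3 := hgP x y
    have h4 : ‖x - y‖ ≤ 2 * ‖g x - g y‖ := by nlinarith [norm_nonneg (x - y)]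
    nlinarith
  have hfle : ∀ x ∈ A, ∀ y ∈ A, dist (f x) (f y) ≤ K * dist (g x) (g y) := by
    intro x hx y hy
    rw [dist_eq_norm, dist_eq_norm]
    have h1 := hfg x hx y hy
    have h2 := norm_le_norm_add_norm_sub' (f x - f y) (g x - g y)
    rw [hKr]
    nlinarith [norm_nonneg (g x - g y)]
  have hgle : ∀ x ∈ A, ∀ y ∈ A, dist (g x) (g y) ≤ K * dist (f x) (f y) := by
    intro x hx y hy
    rw [dist_eq_norm, dist_eq_norm]
    have h1 := hfg x hx y hy
    have h2 := norm_le_norm_add_norm_sub (f x - f y) (g x - g y)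
    rw [hKr]
    have h3 : (1 - 4 * η) * ‖g x - g y‖ ≤ ‖f x - f y‖ := by linarith
    -- The product is `1 + 4η - 32η²`, so this is where `η ≤ 1 / 8` is needed.
    have h4 : 1 ≤ (1 + 8 * η) * (1 - 4 * η) := by nlinarith
    calc ‖g x - g y‖ ≤ (1 + 8 * η) * (1 - 4 * η) * ‖g x - g y‖ :=
          le_mul_of_one_le_left (norm_nonneg _) h4
      _ = (1 + 8 * η) * ((1 - 4 * η) * ‖g x - g y‖) := by ring
      _ ≤ _ := by gcongr
  have hxP : ∀ x ∈ A, ∀ y ∈ A, dist x y ≤ K * dist (P x) (P y) := by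
    intro x hx y hy
    rw [dist_eq_norm, dist_eq_norm]
    have h3 := hPge x hx y hy
    rw [hKr]
    have h4 : 1 ≤ (1 + 8 * η) * (1 - η) := by nlinarith
    calc ‖x - y‖ ≤ (1 + 8 * η) * (1 - η) * ‖x - y‖ :=
          le_mul_of_one_le_left (norm_nonneg _) h4
      _ = (1 + 8 * η) * ((1 - η) * ‖x - y‖) := by ring
      _ ≤ _ := by gcongr
  -- The lower bound costs `K ^ d` twice, for `A` against its projection and for `g` against `f`.
  -- The upper bound costs it once and is weakened to match.
  have m1 := euclideanHausdorffMeasure_image_le_of_dist_le d hfle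
  have m2 := euclideanHausdorffMeasure_image_le_of_dist_le d hgle
  have m3 := euclideanHausdorffMeasure_image_le_of_dist_le (f := id) d hxP
  have m4 := euclideanHausdorffMeasure_image_le_of_dist_le (f := P) (g := id) (A := A) (K := 1) d
    (fun x _ y _ => by rw [dist_eq_norm, dist_eq_norm]; simpa using hPle x y)
  have m5 := euclideanHausdorffMeasure_image_tiltMap hd hn hl (P '' A)
  rw [image_image] at m5
  change (μHE[d] : Measure E) (g '' A) = _ at m5
  rw [image_id] at m3 m4
  rw [ENNReal.coe_one, one_pow, one_mul] at m4
  rw [ENNReal.ofReal_mul (by positivity), hKo]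
  constructor
  · calc _ ≤ (K : ENNReal) ^ d * (μHE[d] : Measure E) (g '' A) := m1
      _ ≤ (K : ENNReal) ^ (2 * d) * (ENNReal.ofReal √(1 + ‖l‖ ^ 2) * (μHE[d] : Measure E) A) := by
        rw [m5]
        gcongr
        omega
      _ = _ := by ring
  · calc _ ≤ ENNReal.ofReal √(1 + ‖l‖ ^ 2) *
          ((K : ENNReal) ^ d * (μHE[d] : Measure (ℝ ∙ n)ᗮ) (P '' A)) := by gcongr
      _ = (K : ENNReal) ^ d * (μHE[d] : Measure E) (g '' A) := by rw [m5]; ring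
      _ ≤ (K : ENNReal) ^ d * ((K : ENNReal) ^ d * (μHE[d] : Measure E) (f '' A)) := by gcongr
      _ = _ := by ring

end Tilt

/-! ### Outer normals of `C²` domains -/

section Normal

variable {N : ℕ}

theorem IsOuterNormalAt.outerNormal_eq {U : Set (EuclideanSpace ℝ (Fin N))}
    {y n : EuclideanSpace ℝ (Fin N)} (h : IsOuterNormalAt U y n) : outerNormal U y = n := by
  have h' : ∃ n, IsOuterNormalAt U y n := ⟨n, h⟩
  rw [outerNormal, dif_pos h']
  exact h'.choose_spec.unique h

/-- A sublevel set of a function with non-zero derivative has the normalised gradient as outer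
normal. -/
theorem IsOuterNormalAt.of_hasFDerivAt {U : Set (EuclideanSpace ℝ (Fin N))}
    {y g : EuclideanSpace ℝ (Fin N)} {F : EuclideanSpace ℝ (Fin N) → ℝ}
    (hF : HasFDerivAt F (innerSL ℝ g) y) (h0 : F y = 0) (hg : g ≠ 0)
    (hU : ∀ᶠ z in 𝓝 y, z ∈ U ↔ F z < 0) : IsOuterNormalAt U y (‖g‖⁻¹ • g) := by
  have hg' : 0 < ‖g‖ := norm_pos_iff.2 hg
  refine ⟨by rw [norm_smul, norm_inv, norm_norm, inv_mul_cancel₀ hg'.ne'], fun δ hδ => ?_⟩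
  have hb := hF.isLittleO.def (c := δ * ‖g‖) (by positivity)
  filter_upwards [hb, hU] with z hz hzU
  rw [h0, sub_zero, innerSL_apply_apply, Real.norm_eq_abs, abs_le] at hz
  rw [inner_smul_right, real_inner_comm]
  have e : ‖g‖⁻¹ * ⟪g, z - y⟫_ℝ * ‖g‖ = ⟪g, z - y⟫_ℝ := by field_simp
  constructor
  · intro h
    rw [hzU]
    nlinarith [mul_lt_mul_of_pos_right h hg']
  · intro h
    rw [hzU, not_lt]
    nlinarith [mul_lt_mul_of_pos_right h hg']

/-- The points `y - t n` with small `t > 0` lie in the inner cone, hence in `U`. -/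
theorem IsOuterNormalAt.mem_closure {U : Set (EuclideanSpace ℝ (Fin N))}
    {y n : EuclideanSpace ℝ (Fin N)} (h : IsOuterNormalAt U y n) : y ∈ closure U := by
  have hc : Tendsto (fun t : ℝ => y - t • n) (𝓝[>] 0) (𝓝 y) := by
    have : Continuous (fun t : ℝ => y - t • n) := by fun_prop
    have := this.tendsto 0
    simp only [zero_smul, sub_zero] at this
    exact this.mono_left nhdsWithin_le_nhds
  refine mem_closure_of_tendsto hc ?_
  filter_upwards [hc.eventually (h.2 (1 / 2) (by norm_num)), self_mem_nhdsWithin] with t ht ht0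
  have ht0 : 0 < t := ht0
  refine ht.1 ?_
  simp only [sub_sub_cancel_left, inner_neg_left, inner_smul_left, real_inner_self_eq_norm_sq,
    h.1, norm_neg, norm_smul, Real.norm_eq_abs, abs_of_pos ht0, RCLike.conj_to_real]
  linarith

/-- Near a boundary point, the outer normal to a `C²` domain extends to a `C¹` map. -/
theorem IsC2Domain.exists_normal_extension {Ω : Set (EuclideanSpace ℝ (Fin N))}
    (hΩ : IsC2Domain Ω) {x₀ : EuclideanSpace ℝ (Fin N)} (hx₀ : x₀ ∈ frontier Ω) :
    ∃ (ρ : EuclideanSpace ℝ (Fin N) → ℝ)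
      (n : EuclideanSpace ℝ (Fin N) → EuclideanSpace ℝ (Fin N)) (c : ℝ),
      ContDiffAt ℝ 1 ρ x₀ ∧ ContDiffAt ℝ 1 n x₀ ∧ 0 < c ∧
      fderiv ℝ ρ x₀ = c • innerSL ℝ (n x₀) ∧
      ∀ᶠ x in 𝓝 x₀, (x ∈ Ω ↔ ρ x < 0) ∧ (0 < ρ x → x ∉ closure Ω) ∧
        (x ∈ frontier Ω ↔ ρ x = 0) ∧ (x ∈ frontier Ω → IsOuterNormalAt Ω x (n x)) := by
  obtain ⟨ρ, hρ, hd, hU⟩ := hΩ.boundary x₀ hx₀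
  set G : EuclideanSpace ℝ (Fin N) → EuclideanSpace ℝ (Fin N) := fun x =>
    (InnerProductSpace.toDual ℝ (EuclideanSpace ℝ (Fin N))).symm (fderiv ℝ ρ x) with hG
  have hGc : ContDiffAt ℝ 1 G x₀ := by
    have h1 : ContDiffAt ℝ 1 (fderiv ℝ ρ) x₀ := hρ.fderiv_right (by norm_num)
    exact (InnerProductSpace.toDual ℝ
      (EuclideanSpace ℝ (Fin N))).symm.contDiff.contDiffAt.comp x₀ h1
  have hG0 : G x₀ ≠ 0 := by simpa [hG] using hd
  have hGi : ∀ x, fderiv ℝ ρ x = innerSL ℝ (G x) := fun x => by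
    ext v
    rw [innerSL_apply_apply, hG]
    simp
  have hnc : ContDiffAt ℝ 1 (fun x => ‖G x‖⁻¹ • G x) x₀ :=
    ((hGc.norm ℝ hG0).inv (norm_ne_zero_iff.2 hG0)).smul hGc
  refine ⟨ρ, fun x => ‖G x‖⁻¹ • G x, ‖G x₀‖, hρ.of_le (by norm_num), hnc,
    norm_pos_iff.2 hG0, ?_, ?_⟩
  · rw [hGi, map_smul, smul_smul, mul_inv_cancel₀ (norm_ne_zero_iff.2 hG0), one_smul]
  · have e1 := (hρ.of_le (by norm_num : (1 : WithTop ℕ∞) ≤ 2)).eventually (by simp)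
    have e2 := hGc.continuousAt.eventually_ne hG0
    filter_upwards [e1, e2, hU.eventually_nhds] with x hx1 hx2 hx3
    have hcont := hx1.continuousAt
    have hN : ρ x = 0 → IsOuterNormalAt Ω x (‖G x‖⁻¹ • G x) := fun h0 =>
      IsOuterNormalAt.of_hasFDerivAt
        (hGi x ▸ (hx1.differentiableAt (by norm_num)).hasFDerivAt) h0 hx2 hx3
    have hpos : 0 < ρ x → x ∉ closure Ω := fun hp hcl => by
      rw [mem_closure_iff_frequently] at hcl
      obtain ⟨z, hz, hz1, hz2⟩ :=
        (hcl.and_eventually ((hcont.eventually (lt_mem_nhds hp)).and hx3)).exists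
      have := hz2.1 hz
      linarith
    have hfr : x ∈ frontier Ω ↔ ρ x = 0 := by
      rw [hΩ.isOpen.frontier_eq]
      constructor
      · rintro ⟨h1, h2⟩
        rw [hx3.self_of_nhds] at h2
        by_contra hne
        exact hpos (lt_of_le_of_ne (not_lt.1 h2) (Ne.symm hne)) h1
      · intro h0
        refine ⟨(hN h0).mem_closure, fun h => ?_⟩
        rw [hx3.self_of_nhds, h0] at h
        exact lt_irrefl _ h
    exact ⟨hx3.self_of_nhds, hpos, hfr, fun h => hN (hfr.1 h)⟩

variable {Ω : Set (EuclideanSpace ℝ (Fin N))}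

theorem IsC2Domain.isOuterNormalAt (hΩ : IsC2Domain Ω) {x : EuclideanSpace ℝ (Fin N)}
    (hx : x ∈ frontier Ω) :
    IsOuterNormalAt Ω x (outerNormal Ω x) := by
  obtain ⟨ρ, n, c, -, -, -, -, h⟩ := hΩ.exists_normal_extension hx
  have := h.self_of_nhds.2.2.2 hx
  rwa [this.outerNormal_eq]

theorem IsC2Domain.norm_outerNormal (hΩ : IsC2Domain Ω) {x : EuclideanSpace ℝ (Fin N)}
    (hx : x ∈ frontier Ω) :
    ‖outerNormal Ω x‖ = 1 := (hΩ.isOuterNormalAt hx).1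

theorem IsC2Domain.isCompact_frontier (hΩ : IsC2Domain Ω) : IsCompact (frontier Ω) :=
  Metric.isCompact_of_isClosed_isBounded isClosed_frontier
    (hΩ.isBounded.closure.subset frontier_subset_closure)

/-- Locally the normal is the restriction of a `C¹` map, since the gradient of a `C²` function is
`C¹`; compactness makes the constant global. -/
theorem IsC2Domain.exists_lipschitzOnWith_outerNormal (hΩ : IsC2Domain Ω) :
    ∃ L, LipschitzOnWith L (outerNormal Ω) (frontier Ω) := by
  refine LocallyLipschitzOn.exists_lipschitzOnWith_of_compact hΩ.isCompact_frontier ?_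
  intro x hx
  obtain ⟨ρ, n, c, -, hn, -, -, h⟩ := hΩ.exists_normal_extension hx
  obtain ⟨K, t, ht, hK⟩ := hn.exists_lipschitzOnWith
  refine ⟨K, (t ∩ {x | x ∈ frontier Ω → IsOuterNormalAt Ω x (n x)}) ∩ frontier Ω,
    inter_mem (mem_nhdsWithin_of_mem_nhds (inter_mem ht (h.mono fun _ h => h.2.2.2)))
      self_mem_nhdsWithin, ?_⟩
  rintro y ⟨⟨hyt, hy⟩, hyΓ⟩ z ⟨⟨hzt, hz⟩, hzΓ⟩
  rw [(hy hyΓ).outerNormal_eq, (hz hzΓ).outerNormal_eq]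
  exact hK hyt hzt

/-- Small pieces of the boundary are almost flat. -/
theorem IsC2Domain.exists_flat (hΩ : IsC2Domain Ω) {x₀ : EuclideanSpace ℝ (Fin N)}
    (hx₀ : x₀ ∈ frontier Ω) {θ : ℝ}
    (hθ : 0 < θ) : ∃ r > 0, ∀ x ∈ frontier Ω ∩ Metric.ball x₀ r,
      ∀ y ∈ frontier Ω ∩ Metric.ball x₀ r, |⟪x - y, outerNormal Ω x₀⟫_ℝ| ≤ θ * ‖x - y‖ := by
  obtain ⟨ρ, n, c, hρ, -, hc, hd, h⟩ := hΩ.exists_normal_extension hx₀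
  have hn : outerNormal Ω x₀ = n x₀ := (h.self_of_nhds.2.2.2 hx₀).outerNormal_eq
  -- Strict differentiability lets both points vary. As `ρ` vanishes at both, only the term `c ⟪n
  -- x₀, x - y⟫` remains, and it must be small.
  have hs := (hρ.hasStrictFDerivAt (by norm_num)).isLittleO.def (c := c * θ) (by positivity)
  have h0 : ∀ᶠ q : _ × _ in 𝓝 (x₀, x₀), (q.1 ∈ frontier Ω ↔ ρ q.1 = 0) ∧
      (q.2 ∈ frontier Ω ↔ ρ q.2 = 0) := by
    rw [nhds_prod_eq]
    exact (h.mono fun _ h => h.2.2.1).prod_mk (h.mono fun _ h => h.2.2.1)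
  obtain ⟨r, hr, hball⟩ := Metric.eventually_nhds_iff_ball.1 (hs.and h0)
  refine ⟨r, hr, fun x hx y hy => ?_⟩
  obtain ⟨h1, h2, h3⟩ := hball (x, y) (by rw [← ball_prod_same]; exact ⟨hx.2, hy.2⟩)
  simp only at h1 h2 h3
  rw [h2.1 hx.1, h3.1 hy.1, hd, hn.symm, _root_.smul_apply, innerSL_apply_apply,
    smul_eq_mul, sub_zero, zero_sub, norm_neg, Real.norm_eq_abs, abs_mul, abs_of_pos hc,
    mul_assoc, real_inner_comm] at h1
  exact le_of_mul_le_mul_left h1 hc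

/-- Points on the outer side of the normal lie outside, those on the inner side inside. -/
theorem IsC2Domain.eventually_side (hΩ : IsC2Domain Ω) {x₀ : EuclideanSpace ℝ (Fin N)}
    (hx₀ : x₀ ∈ frontier Ω) :
    ∀ᶠ q : EuclideanSpace ℝ (Fin N) × ℝ in 𝓝 (x₀, 0), q.1 ∈ frontier Ω →
      (0 < q.2 → q.1 + q.2 • outerNormal Ω q.1 ∉ closure Ω) ∧
      (q.2 < 0 → q.1 + q.2 • outerNormal Ω q.1 ∈ Ω) := by
  obtain ⟨ρ, n, c, hρ, hn, hc, hd, h⟩ := hΩ.exists_normal_extension hx₀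
  have hn0 : ‖n x₀‖ = 1 := (h.self_of_nhds.2.2.2 hx₀).1
  -- From a boundary point `x` to `x + s n(x)`, the linear term `c s ⟪n x₀, n x⟫` exceeds `c |s| /
  -- 2` in modulus and beats the error `c |s| / 4`, so `ρ` takes the sign of `s`.
  have hs := (hρ.hasStrictFDerivAt (by norm_num)).isLittleO.def (c := c / 4) (by positivity)
  have hz : Tendsto (fun q : EuclideanSpace ℝ (Fin N) × ℝ => q.1 + q.2 • n q.1) (𝓝 (x₀, 0))
      (𝓝 x₀) := by
    have : ContinuousAt (fun q : EuclideanSpace ℝ (Fin N) × ℝ => q.1 + q.2 • n q.1) (x₀, 0) := by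
      have : ContinuousAt (fun q : EuclideanSpace ℝ (Fin N) × ℝ => n q.1) (x₀, 0) :=
        ContinuousAt.comp (f := Prod.fst) (g := n) hn.continuousAt continuousAt_fst
      fun_prop
    simpa [ContinuousAt] using this
  have hx : Tendsto (fun q : EuclideanSpace ℝ (Fin N) × ℝ => q.1) (𝓝 (x₀, 0)) (𝓝 x₀) :=
    continuousAt_fst
  have hin : ∀ᶠ x in 𝓝 x₀, (1 : ℝ) / 2 < ⟪n x₀, n x⟫_ℝ := by
    have : ContinuousAt (fun x => ⟪n x₀, n x⟫_ℝ) x₀ := continuousAt_const.inner hn.continuousAt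
    refine this.eventually (lt_mem_nhds ?_)
    simp only [real_inner_self_eq_norm_sq, hn0]; norm_num
  filter_upwards [(hz.prodMk_nhds hx).eventually hs, hz.eventually h, hx.eventually h,
    hx.eventually hin] with q h1 h2 h3 h4 hq
  have hNq := h3.2.2.2 hq
  rw [hNq.outerNormal_eq]
  rw [h3.2.2.1.1 hq, hd, add_sub_cancel_left, sub_zero, _root_.smul_apply,
    innerSL_apply_apply, inner_smul_right, smul_eq_mul, norm_smul, hNq.1, mul_one,
    Real.norm_eq_abs, Real.norm_eq_abs] at h1
  rw [abs_le] at h1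
  constructor
  · intro hp
    refine h2.2.1 ?_
    rw [abs_of_pos hp] at h1
    have := mul_lt_mul_of_pos_left h4 (mul_pos hc hp)
    nlinarith [mul_pos hc hp]
  · intro hp
    refine h2.1.2 ?_
    rw [abs_of_neg hp] at h1
    have := mul_lt_mul_of_pos_left h4 (mul_pos hc (neg_pos.2 hp))
    nlinarith [mul_pos hc (neg_pos.2 hp)]

end Normal

/-! ### Tubular neighbourhood -/

section Tube

variable {N : ℕ} {Ω : Set (EuclideanSpace ℝ (Fin N))}

/-- The invertible linear map `(h, s) ↦ (h + s n, c ⟨n, h⟩)`. -/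
def normalEquiv {E : Type*} [NormedAddCommGroup E] [InnerProductSpace ℝ E] (n : E) (hn : ‖n‖ = 1)
    (c : ℝ) (hc : c ≠ 0) : (E × ℝ) ≃L[ℝ] (E × ℝ) :=
  ContinuousLinearEquiv.equivOfInverse
    ((ContinuousLinearMap.fst ℝ E ℝ + (ContinuousLinearMap.snd ℝ E ℝ).smulRight n).prod
      (c • (innerSL ℝ n).comp (ContinuousLinearMap.fst ℝ E ℝ)))
    ((ContinuousLinearMap.fst ℝ E ℝ - ((innerSL ℝ n).comp (ContinuousLinearMap.fst ℝ E ℝ) -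
        c⁻¹ • ContinuousLinearMap.snd ℝ E ℝ).smulRight n).prod
      ((innerSL ℝ n).comp (ContinuousLinearMap.fst ℝ E ℝ) -
        c⁻¹ • ContinuousLinearMap.snd ℝ E ℝ))
    (by
      rintro ⟨h, s⟩
      have : ⟪n, h + s • n⟫_ℝ - c⁻¹ * (c * ⟪n, h⟫_ℝ) = s := by
        rw [inner_add_right, inner_smul_right, real_inner_self_eq_norm_sq, hn,
          inv_mul_cancel_left₀ hc]
        ring
      simp [this])
    (by
      rintro ⟨k, r⟩
      have : c * ⟪n, k - (⟪n, k⟫_ℝ - c⁻¹ * r) • n⟫_ℝ = r := by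
        rw [inner_sub_right, inner_smul_right, real_inner_self_eq_norm_sq, hn]
        field_simp
        ring
      simp [this])

/-- Local `C¹` nearest point projection and signed distance. -/
theorem IsC2Domain.exists_local_projection (hΩ : IsC2Domain Ω) {x₀ : EuclideanSpace ℝ (Fin N)}
    (hx₀ : x₀ ∈ frontier Ω) :
    ∃ (P : EuclideanSpace ℝ (Fin N) → EuclideanSpace ℝ (Fin N))
      (t : EuclideanSpace ℝ (Fin N) → ℝ),
      HasFDerivAt P (ContinuousLinearMap.id ℝ _ -
        (innerSL ℝ (outerNormal Ω x₀)).smulRight (outerNormal Ω x₀)) x₀ ∧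
      HasFDerivAt t (innerSL ℝ (outerNormal Ω x₀)) x₀ ∧
      (∀ᶠ z in 𝓝 x₀, ContDiffAt ℝ 1 P z ∧ ContDiffAt ℝ 1 t z ∧ P z ∈ frontier Ω ∧
        z = P z + t z • outerNormal Ω (P z)) ∧
      ∀ᶠ q : EuclideanSpace ℝ (Fin N) × ℝ in 𝓝 (x₀, 0), q.1 ∈ frontier Ω →
        P (q.1 + q.2 • outerNormal Ω q.1) = q.1 ∧ t (q.1 + q.2 • outerNormal Ω q.1) = q.2 := by
  obtain ⟨ρ, n, c, hρ, hn, hc, hd, h⟩ := hΩ.exists_normal_extension hx₀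
  have hnx : outerNormal Ω x₀ = n x₀ := (h.self_of_nhds.2.2.2 hx₀).outerNormal_eq
  have hn0 : ‖n x₀‖ = 1 := (h.self_of_nhds.2.2.2 hx₀).1
  rw [hnx]
  -- Carrying `ρ` along as a second component makes the map invertible without a chart of `Γ`:
  -- inverting it at `(z, 0)` returns a foot point with `ρ = 0`, that is, on `Γ`, and the signed
  -- distance.
  set J : EuclideanSpace ℝ (Fin N) × ℝ → EuclideanSpace ℝ (Fin N) × ℝ :=
    fun q => (q.1 + q.2 • n q.1, ρ q.1) with hJ
  have hJ0 : J (x₀, 0) = (x₀, 0) := by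
    simp [hJ, h.self_of_nhds.2.2.1.1 hx₀]
  have hn1 : ContDiffAt ℝ 1 (fun q : EuclideanSpace ℝ (Fin N) × ℝ => n q.1) (x₀, 0) :=
    ContDiffAt.comp (x₀, 0) (f := Prod.fst) (g := n) hn contDiffAt_fst
  have hρ1 : ContDiffAt ℝ 1 (fun q : EuclideanSpace ℝ (Fin N) × ℝ => ρ q.1) (x₀, 0) :=
    ContDiffAt.comp (x₀, 0) (f := Prod.fst) (g := ρ) hρ contDiffAt_fst
  have hJc : ContDiffAt ℝ 1 J (x₀, 0) :=
    (contDiffAt_fst.add (contDiffAt_snd.smul hn1)).prodMk hρ1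
  have hJd : HasFDerivAt J
      (normalEquiv (n x₀) hn0 c hc.ne' : (EuclideanSpace ℝ (Fin N) × ℝ) →L[ℝ] _) (x₀, 0) := by
    have d1 : HasFDerivAt (fun q : EuclideanSpace ℝ (Fin N) × ℝ => n q.1)
        ((fderiv ℝ n x₀).comp (ContinuousLinearMap.fst ℝ _ ℝ)) (x₀, 0) :=
      HasFDerivAt.comp (x₀, (0 : ℝ)) (f := Prod.fst) (g := n)
        (hn.differentiableAt (by norm_num)).hasFDerivAt hasFDerivAt_fst
    have d2 : HasFDerivAt (fun q : EuclideanSpace ℝ (Fin N) × ℝ => ρ q.1)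
        ((fderiv ℝ ρ x₀).comp (ContinuousLinearMap.fst ℝ _ ℝ)) (x₀, 0) :=
      HasFDerivAt.comp (x₀, (0 : ℝ)) (f := Prod.fst) (g := ρ)
        (hρ.differentiableAt (by norm_num)).hasFDerivAt hasFDerivAt_fst
    refine ((hasFDerivAt_fst.add (hasFDerivAt_snd.smul d1)).prodMk d2).congr_fderiv ?_
    rw [hd]
    ext <;> simp [normalEquiv]
  have hJs : HasStrictFDerivAt J
      (normalEquiv (n x₀) hn0 c hc.ne' : (EuclideanSpace ℝ (Fin N) × ℝ) →L[ℝ] _) (x₀, 0) :=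
    hJc.hasStrictFDerivAt' hJd (by norm_num)
  set G := hJs.localInverse J _ _ with hG
  have hGc : ContDiffAt ℝ 1 G (x₀, 0) := by
    have := hJc.to_localInverse hJd (by norm_num)
    rw [hJ0] at this
    exact this
  have hG0 : G (x₀, 0) = (x₀, 0) := by
    have := hJs.localInverse_apply_image
    rwa [hJ0] at this
  have hGd : HasFDerivAt G ((normalEquiv (n x₀) hn0 c hc.ne').symm :
      (EuclideanSpace ℝ (Fin N) × ℝ) →L[ℝ] _) (x₀, 0) := by
    have := hJs.to_localInverse.hasFDerivAt
    rwa [hJ0] at this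
  have hr := hJs.eventually_right_inverse
  rw [hJ0] at hr
  have hl := hJs.eventually_left_inverse
  set i : EuclideanSpace ℝ (Fin N) → EuclideanSpace ℝ (Fin N) × ℝ := fun z => (z, 0) with hi
  have hic : Tendsto i (𝓝 x₀) (𝓝 (x₀, 0)) := by
    have : Continuous i := by fun_prop
    exact this.tendsto x₀
  have hid : HasFDerivAt i (ContinuousLinearMap.inl ℝ _ ℝ) x₀ :=
    (ContinuousLinearMap.inl ℝ (EuclideanSpace ℝ (Fin N)) ℝ).hasFDerivAt
  have hGi : HasFDerivAt (fun z => G (i z)) _ x₀ := HasFDerivAt.comp x₀ (f := i) hGd hid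
  have hGit : Tendsto (fun z => G (i z)) (𝓝 x₀) (𝓝 (x₀, 0)) := by
    have := hGi.continuousAt
    simpa [ContinuousAt, hi, hG0] using this
  refine ⟨fun z => (G (i z)).1, fun z => (G (i z)).2, ?_, ?_, ?_, ?_⟩
  · refine hGi.fst.congr_fderiv ?_
    ext v
    simp [normalEquiv]
  · refine hGi.snd.congr_fderiv ?_
    ext v
    simp [normalEquiv]
  · have h1 : Tendsto (fun z => (G (i z)).1) (𝓝 x₀) (𝓝 x₀) :=
      (continuous_fst.tendsto (x₀, (0 : ℝ))).comp hGit
    filter_upwards [hic.eventually hr, hic.eventually (hGc.eventually (by simp)),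
      h1.eventually h] with z hz1 hz2 hz3
    have hGz : ContDiffAt ℝ 1 (fun z => G (i z)) z :=
      ContDiffAt.comp z (f := i) hz2 (contDiffAt_id.prodMk contDiffAt_const)
    change J (G (i z)) = i z at hz1
    have e1 := congrArg Prod.fst hz1
    have e2 := congrArg Prod.snd hz1
    simp only [hJ, hi] at e1 e2
    have hΓ : (G (i z)).1 ∈ frontier Ω := hz3.2.2.1.2 e2
    refine ⟨hGz.fst, hGz.snd, hΓ, ?_⟩
    rw [(hz3.2.2.2 hΓ).outerNormal_eq]
    exact e1.symm
  · have h1 : Tendsto (fun q : EuclideanSpace ℝ (Fin N) × ℝ => q.1) (𝓝 (x₀, 0)) (𝓝 x₀) :=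
      continuousAt_fst
    filter_upwards [hl, h1.eventually h] with q hq1 hq2 hqΓ
    have e : i (q.1 + q.2 • outerNormal Ω q.1) = J q := by
      rw [(hq2.2.2.2 hqΓ).outerNormal_eq, hi, hJ]
      simp [hq2.2.2.1.1 hqΓ]
    rw [e]
    change G (J q) = q at hq1
    rw [hq1]
    exact ⟨rfl, rfl⟩

/-- `P` and `t` are the nearest point projection and the signed distance in the tube of radius `δ`
around `Γ = ∂Ω`. -/
structure IsTube (Ω : Set (EuclideanSpace ℝ (Fin N))) (δ : ℝ)
    (P : EuclideanSpace ℝ (Fin N) → EuclideanSpace ℝ (Fin N))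
    (t : EuclideanSpace ℝ (Fin N) → ℝ) : Prop where
  pos : 0 < δ
  proj_apply : ∀ x ∈ frontier Ω, ∀ s : ℝ, |s| < δ → P (x + s • outerNormal Ω x) = x
  dist_apply : ∀ x ∈ frontier Ω, ∀ s : ℝ, |s| < δ → t (x + s • outerNormal Ω x) = s
  contDiffAt_proj : ∀ x ∈ frontier Ω, ∀ s : ℝ, |s| < δ →
    ContDiffAt ℝ 1 P (x + s • outerNormal Ω x)
  contDiffAt_dist : ∀ x ∈ frontier Ω, ∀ s : ℝ, |s| < δ →
    ContDiffAt ℝ 1 t (x + s • outerNormal Ω x)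
  eventually : ∀ x ∈ frontier Ω, ∀ s : ℝ, |s| < δ → ∀ᶠ z in 𝓝 (x + s • outerNormal Ω x),
    P z ∈ frontier Ω ∧ |t z| < δ ∧ z = P z + t z • outerNormal Ω (P z)
  hasFDerivAt_proj : ∀ x ∈ frontier Ω, HasFDerivAt P (ContinuousLinearMap.id ℝ _ -
    (innerSL ℝ (outerNormal Ω x)).smulRight (outerNormal Ω x)) x
  hasFDerivAt_dist : ∀ x ∈ frontier Ω, HasFDerivAt t (innerSL ℝ (outerNormal Ω x)) x
  outside : ∀ x ∈ frontier Ω, ∀ s : ℝ, 0 < s → s < δ → x + s • outerNormal Ω x ∉ closure Ω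
  inside : ∀ x ∈ frontier Ω, ∀ s : ℝ, 0 < s → s < δ → x - s • outerNormal Ω x ∈ Ω

/-- A Lebesgue number of the cover by local charts gives a uniform width. At half that width, the
normal coordinates are globally injective, so their inverse is well defined; near each point it
coincides with a local inverse and inherits its regularity. -/
theorem IsC2Domain.exists_isTube (hΩ : IsC2Domain Ω) : ∃ δ P t, IsTube Ω δ P t := by
  set ν := outerNormal Ω with hν
  have hloc : ∀ x₀ : frontier Ω, ∃ r > 0, ∃ (P : EuclideanSpace ℝ (Fin N) →
      EuclideanSpace ℝ (Fin N)) (t : EuclideanSpace ℝ (Fin N) → ℝ),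
      HasFDerivAt P (ContinuousLinearMap.id ℝ _ - (innerSL ℝ (ν x₀)).smulRight (ν x₀)) x₀ ∧
      HasFDerivAt t (innerSL ℝ (ν x₀)) x₀ ∧
      (∀ z ∈ Metric.ball (x₀ : EuclideanSpace ℝ (Fin N)) r, ContDiffAt ℝ 1 P z ∧
        ContDiffAt ℝ 1 t z ∧ P z ∈ frontier Ω ∧ z = P z + t z • ν (P z)) ∧
      ∀ x ∈ frontier Ω ∩ Metric.ball (x₀ : EuclideanSpace ℝ (Fin N)) r, ∀ s : ℝ, |s| < r →
        P (x + s • ν x) = x ∧ t (x + s • ν x) = s ∧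
        (0 < s → x + s • ν x ∉ closure Ω) ∧ (s < 0 → x + s • ν x ∈ Ω) := by
    rintro ⟨x₀, hx₀⟩
    obtain ⟨P, t, hP, ht, h1, h2⟩ := hΩ.exists_local_projection hx₀
    obtain ⟨r1, hr1, hb1⟩ := Metric.eventually_nhds_iff_ball.1 h1
    obtain ⟨r2, hr2, hb2⟩ := Metric.eventually_nhds_iff_ball.1 (h2.and (hΩ.eventually_side hx₀))
    refine ⟨min r1 r2, lt_min hr1 hr2, P, t, hP, ht,
      fun z hz => hb1 z (Metric.ball_subset_ball (min_le_left _ _) hz), ?_⟩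
    rintro x ⟨hx, hxb⟩ s hs
    have := hb2 (x, s) (by
      rw [← ball_prod_same]
      exact ⟨Metric.ball_subset_ball (min_le_right _ _) hxb,
        by simpa using hs.trans_le (min_le_right _ _)⟩)
    exact ⟨(this.1 hx).1, (this.1 hx).2, (this.2 hx).1, (this.2 hx).2⟩
  choose r hr P t hP ht hball hpt using hloc
  obtain ⟨δ₁, hδ₁, hleb⟩ := lebesgue_number_lemma_of_metric
    (s := frontier Ω ×ˢ ({0} : Set ℝ)) (hΩ.isCompact_frontier.prod isCompact_singleton)
    (c := fun x₀ : frontier Ω => Metric.ball ((x₀ : EuclideanSpace ℝ (Fin N)), (0 : ℝ)) (r x₀))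
    (fun _ => Metric.isOpen_ball)
    (by
      rintro ⟨x, s⟩ ⟨hx, hs⟩
      obtain rfl : s = 0 := hs
      exact mem_iUnion.2 ⟨⟨x, hx⟩, Metric.mem_ball_self (hr _)⟩)
  have hchart : ∀ x ∈ frontier Ω, ∃ x₀ : frontier Ω, ∀ y ∈ Metric.ball x δ₁, ∀ s : ℝ, |s| < δ₁ →
      y ∈ Metric.ball (x₀ : EuclideanSpace ℝ (Fin N)) (r x₀) ∧ |s| < r x₀ := by
    intro x hx
    obtain ⟨x₀, hx₀⟩ := hleb (x, 0) ⟨hx, rfl⟩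
    refine ⟨x₀, fun y hy s hs => ?_⟩
    have : (y, s) ∈ Metric.ball (x, (0 : ℝ)) δ₁ := by
      rw [← ball_prod_same]; exact ⟨hy, by simpa using hs⟩
    have := hx₀ this
    rw [← ball_prod_same] at this
    exact ⟨this.1, by simpa using this.2⟩
  have hmove : ∀ x ∈ frontier Ω, ∀ s : ℝ, dist (x + s • ν x) x = |s| := fun x hx s => by
    rw [dist_eq_norm, add_sub_cancel_left, norm_smul, hΩ.norm_outerNormal hx, mul_one,
      Real.norm_eq_abs]
  set S : Set (EuclideanSpace ℝ (Fin N) × ℝ) := frontier Ω ×ˢ {s | |s| < δ₁ / 2} with hS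
  set f : EuclideanSpace ℝ (Fin N) × ℝ → EuclideanSpace ℝ (Fin N) :=
    fun q => q.1 + q.2 • ν q.1 with hf
  have hinj : InjOn f S := by
    rintro ⟨x, s⟩ ⟨hx, hs⟩ ⟨y, s'⟩ ⟨hy, hs'⟩ he
    simp only [hf, mem_ofPred_eq] at he hs hs' hx hy
    obtain ⟨x₀, hx₀⟩ := hchart x hx
    -- Both foot points are closer than `δ₁ / 2` to the common image, so one chart contains both,
    -- and there injectivity is known.
    have hyx : y ∈ Metric.ball x δ₁ := by
      have h1 := hmove x hx s
      have h2 := hmove y hy s'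
      rw [← he] at h2
      have := dist_triangle_left y x (x + s • ν x)
      rw [Metric.mem_ball]; linarith
    obtain ⟨a1, a2⟩ := hx₀ x (Metric.mem_ball_self hδ₁) s (by linarith)
    obtain ⟨b1, b2⟩ := hx₀ y hyx s' (by linarith)
    obtain ⟨c1, c2, -⟩ := hpt x₀ x ⟨hx, a1⟩ s a2
    obtain ⟨d1, d2, -⟩ := hpt x₀ y ⟨hy, b1⟩ s' b2
    rw [he] at c1 c2
    rw [← c1, ← c2, d1, d2]
  set G := Function.invFunOn f S with hG
  have hGf : ∀ x ∈ frontier Ω, ∀ s : ℝ, |s| < δ₁ / 2 → G (x + s • ν x) = (x, s) :=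
    fun x hx s hs => hinj.leftInvOn_invFunOn (x := (x, s)) ⟨hx, hs⟩
  have hev : ∀ x₀ : frontier Ω, ∀ x ∈ frontier Ω ∩ Metric.ball (x₀ : EuclideanSpace ℝ (Fin N)) (r x₀),
      ∀ s : ℝ, |s| < δ₁ / 2 → |s| < r x₀ →
      x + s • ν x ∈ Metric.ball (x₀ : EuclideanSpace ℝ (Fin N)) (r x₀) →
      ∀ᶠ z in 𝓝 (x + s • ν x), P x₀ z ∈ frontier Ω ∧ |t x₀ z| < δ₁ / 2 ∧
        z = P x₀ z + t x₀ z • ν (P x₀ z) ∧ G z = (P x₀ z, t x₀ z) := by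
    intro x₀ x hx s hs hs' hmem
    have h1 := (hball x₀ _ hmem).2.1.continuousAt.abs
    have h2 : |t x₀ (x + s • ν x)| < δ₁ / 2 := by rwa [(hpt x₀ x hx s hs').2.1]
    filter_upwards [Metric.isOpen_ball.mem_nhds hmem, h1.eventually (gt_mem_nhds h2)] with z hz1 hz2
    obtain ⟨-, -, e1, e2⟩ := hball x₀ z hz1
    refine ⟨e1, hz2, e2, ?_⟩
    conv_lhs => rw [e2]
    exact hGf _ e1 _ hz2
  have hev' : ∀ x ∈ frontier Ω, ∀ s : ℝ, |s| < δ₁ / 2 → ∃ x₀ : frontier Ω,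
      x + s • ν x ∈ Metric.ball (x₀ : EuclideanSpace ℝ (Fin N)) (r x₀) ∧
      ∀ᶠ z in 𝓝 (x + s • ν x), P x₀ z ∈ frontier Ω ∧ |t x₀ z| < δ₁ / 2 ∧
        z = P x₀ z + t x₀ z • ν (P x₀ z) ∧ G z = (P x₀ z, t x₀ z) := by
    intro x hx s hs
    obtain ⟨x₀, hx₀⟩ := hchart x hx
    obtain ⟨a1, a2⟩ := hx₀ x (Metric.mem_ball_self hδ₁) s (by linarith)
    obtain ⟨b1, -⟩ := hx₀ (x + s • ν x)
      (by rw [Metric.mem_ball, hmove x hx]; linarith) s (by linarith)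
    exact ⟨x₀, b1, hev x₀ x ⟨hx, a1⟩ s hs a2 b1⟩
  -- The derivative formulas hold at the centre of a chart only, so at `x` the chart centred at `x`
  -- itself is used.
  have hcen : ∀ x (hx : x ∈ frontier Ω), ∀ᶠ z in 𝓝 x, G z = (P ⟨x, hx⟩ z, t ⟨x, hx⟩ z) := by
    intro x hx
    have hb : x ∈ Metric.ball x (r ⟨x, hx⟩) := Metric.mem_ball_self (hr _)
    have := hev ⟨x, hx⟩ x ⟨hx, hb⟩ 0 (by simpa using hδ₁) (by simpa using hr _) (by simpa using hr _)
    rw [zero_smul, add_zero] at this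
    exact this.mono fun z hz => hz.2.2.2
  refine ⟨δ₁ / 2, fun z => (G z).1, fun z => (G z).2, half_pos hδ₁,
    fun x hx s hs => by rw [hGf x hx s hs], fun x hx s hs => by rw [hGf x hx s hs],
    fun x hx s hs => ?_, fun x hx s hs => ?_, fun x hx s hs => ?_, fun x hx => ?_, fun x hx => ?_,
    fun x hx s hs hs' => ?_, fun x hx s hs hs' => ?_⟩
  · obtain ⟨x₀, hb, he⟩ := hev' x hx s hs
    exact (hball x₀ _ hb).1.congr_of_eventuallyEq (he.mono fun z hz => by simp only [hz.2.2.2])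
  · obtain ⟨x₀, hb, he⟩ := hev' x hx s hs
    exact (hball x₀ _ hb).2.1.congr_of_eventuallyEq (he.mono fun z hz => by simp only [hz.2.2.2])
  · obtain ⟨x₀, hb, he⟩ := hev' x hx s hs
    exact he.mono fun z hz => by rw [hz.2.2.2]; exact ⟨hz.1, hz.2.1, hz.2.2.1⟩
  · exact (hP ⟨x, hx⟩).congr_of_eventuallyEq ((hcen x hx).mono fun z hz => by simp only [hz])
  · exact (ht ⟨x, hx⟩).congr_of_eventuallyEq ((hcen x hx).mono fun z hz => by simp only [hz])
  · obtain ⟨x₀, hx₀⟩ := hchart x hx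
    obtain ⟨a1, a2⟩ := hx₀ x (Metric.mem_ball_self hδ₁) s (by rw [abs_of_pos hs]; linarith)
    exact (hpt x₀ x ⟨hx, a1⟩ s a2).2.2.1 hs
  · obtain ⟨x₀, hx₀⟩ := hchart x hx
    obtain ⟨a1, a2⟩ := hx₀ x (Metric.mem_ball_self hδ₁) (-s)
      (by rw [abs_neg, abs_of_pos hs]; linarith)
    have := (hpt x₀ x ⟨hx, a1⟩ (-s) a2).2.2.2 (by linarith)
    rwa [neg_smul, ← sub_eq_add_neg] at this

end Tube

/-! ### Normals of normal graphs -/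

section GraphNormal

variable {N : ℕ} {Ω : Set (EuclideanSpace ℝ (Fin N))} {δ : ℝ}
  {P : EuclideanSpace ℝ (Fin N) → EuclideanSpace ℝ (Fin N)}
  {t : EuclideanSpace ℝ (Fin N) → ℝ}

/-- If `∂U` is the normal graph of `φ` over `Γ`, then `U` is the region below the graph. -/
theorem IsTube.add_smul_mem_iff (hT : IsTube Ω δ P t)
    {U : Set (EuclideanSpace ℝ (Fin N))} (hU : IsOpen U) {φ : EuclideanSpace ℝ (Fin N) → ℝ}
    (hb : BijOn (graphMap Ω φ) (frontier Ω) (frontier U)) {s₁ : ℝ} (hs₁ : s₁ < δ)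
    (hφ : ∀ x ∈ frontier Ω, |φ x| < s₁)
    (hin : ∀ x ∈ frontier Ω, x - s₁ • outerNormal Ω x ∈ U)
    (hout : ∀ x ∈ frontier Ω, x + s₁ • outerNormal Ω x ∉ U)
    {x : EuclideanSpace ℝ (Fin N)} (hx : x ∈ frontier Ω) {s : ℝ} (hs : |s| < s₁) :
    x + s • outerNormal Ω x ∈ U ↔ s < φ x := by
  set g : ℝ → EuclideanSpace ℝ (Fin N) := fun r => x + r • outerNormal Ω x with hg
  have hgc : Continuous g := by fun_prop
  -- Uniqueness of tube coordinates: the normal line through `x` can meet the graph only above `x`.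
  have hfr : ∀ r, |r| ≤ s₁ → g r ∈ frontier U → r = φ x := by
    intro r hr hmem
    obtain ⟨x', hx', he⟩ := hb.surjOn hmem
    have hφ' := (hφ x' hx').trans hs₁
    have h1 := hT.proj_apply x' hx' _ hφ'
    have h2 := hT.dist_apply x' hx' _ hφ'
    rw [graphMap] at he
    rw [he] at h1 h2
    rw [hT.proj_apply x hx r (hr.trans_lt hs₁)] at h1
    rw [hT.dist_apply x hx r (hr.trans_lt hs₁)] at h2
    rw [h2, h1]
  -- A segment that misses the boundary lies wholly inside or wholly outside by connectedness; the
  -- ends at `± s₁` then decide which.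
  have hconn : ∀ a b : ℝ, (∀ r ∈ Icc a b, g r ∉ frontier U) →
      g '' Icc a b ⊆ U ∨ g '' Icc a b ⊆ (closure U)ᶜ := by
    intro a b h
    refine (isPreconnected_Icc.image g hgc.continuousOn).subset_or_subset hU
      isClosed_closure.isOpen_compl
      (disjoint_compl_right.mono_left subset_closure) ?_
    rintro _ ⟨r, hr, rfl⟩
    have := h r hr
    rw [hU.frontier_eq] at this
    by_cases hgr : g r ∈ U
    · exact Or.inl hgr
    · exact Or.inr fun hc => this ⟨hc, hgr⟩
  rw [abs_lt] at hs
  constructor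
  · intro hmem
    by_contra hle
    rw [not_lt] at hle
    rcases hle.eq_or_lt with heq | hlt
    · have : g s ∈ frontier U := by
        rw [← heq]; exact hb.mapsTo hx
      rw [hU.frontier_eq] at this
      exact this.2 hmem
    · rcases hconn s s₁ (fun r hr hf => by
        have := hfr r (abs_le.2 ⟨by linarith [hr.1], hr.2⟩) hf
        linarith [hr.1]) with h | h
      · exact hout x hx (h ⟨s₁, ⟨hs.2.le, le_rfl⟩, rfl⟩)
      · exact h ⟨s, ⟨le_rfl, hs.2.le⟩, rfl⟩ (subset_closure hmem)
  · intro hlt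
    rcases hconn (-s₁) s (fun r hr hf => by
        have := hfr r (abs_le.2 ⟨hr.1, by linarith [hr.2]⟩) hf
        linarith [hr.2]) with h | h
    · exact h ⟨s, ⟨hs.1.le, le_rfl⟩, rfl⟩
    · have h1 : g (-s₁) ∈ U := by
        have := hin x hx
        rwa [sub_eq_add_neg, ← neg_smul] at this
      exact absurd (subset_closure h1) (h ⟨-s₁, ⟨le_rfl, hs.1.le⟩, rfl⟩)

/-- The gradient at `y` of `z ↦ t z - φ (P z)`, where `l` represents the derivative of `φ` at
`P y`. -/
def graphGradient (P : EuclideanSpace ℝ (Fin N) → EuclideanSpace ℝ (Fin N))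
    (t : EuclideanSpace ℝ (Fin N) → ℝ) (y l : EuclideanSpace ℝ (Fin N)) :
    EuclideanSpace ℝ (Fin N) :=
  (InnerProductSpace.toDual ℝ (EuclideanSpace ℝ (Fin N))).symm
    (fderiv ℝ t y - (innerSL ℝ l).comp (fderiv ℝ P y))

theorem innerSL_graphGradient (y l : EuclideanSpace ℝ (Fin N)) :
    innerSL ℝ (graphGradient P t y l) = fderiv ℝ t y - (innerSL ℝ l).comp (fderiv ℝ P y) := by
  ext v
  rw [innerSL_apply_apply, graphGradient]
  exact InnerProductSpace.toDual_symm_apply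

/-- Near the graph, `U` is the set `t - φ ∘ P < 0`. Differentiability of `φ` along `Γ` suffices for
the chain rule, since `P` takes values in `Γ`. -/
theorem IsTube.isOuterNormalAt_graph (hT : IsTube Ω δ P t)
    {U : Set (EuclideanSpace ℝ (Fin N))} (hU : IsOpen U) {φ : EuclideanSpace ℝ (Fin N) → ℝ}
    (hb : BijOn (graphMap Ω φ) (frontier Ω) (frontier U)) {s₁ : ℝ} (hs₁ : s₁ < δ)
    (hφ : ∀ x ∈ frontier Ω, |φ x| < s₁)
    (hin : ∀ x ∈ frontier Ω, x - s₁ • outerNormal Ω x ∈ U)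
    (hout : ∀ x ∈ frontier Ω, x + s₁ • outerNormal Ω x ∉ U)
    {x l : EuclideanSpace ℝ (Fin N)} (hx : x ∈ frontier Ω)
    (hl : HasFDerivWithinAt φ (innerSL ℝ l) (frontier Ω) x) :
    IsOuterNormalAt U (graphMap Ω φ x) (‖graphGradient P t (graphMap Ω φ x) l‖⁻¹ •
      graphGradient P t (graphMap Ω φ x) l) := by
  set y := graphMap Ω φ x with hy
  have hφδ := (hφ x hx).trans hs₁
  have hPy : P y = x := hT.proj_apply x hx _ hφδ
  have hty : t y = φ x := hT.dist_apply x hx _ hφδ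
  have hPd : HasFDerivAt P (fderiv ℝ P y) y :=
    ((hT.contDiffAt_proj x hx _ hφδ).differentiableAt (by norm_num)).hasFDerivAt
  have htd : HasFDerivAt t (fderiv ℝ t y) y :=
    ((hT.contDiffAt_dist x hx _ hφδ).differentiableAt (by norm_num)).hasFDerivAt
  have hev : ∀ᶠ z in 𝓝 y, P z ∈ frontier Ω ∧ |t z| < δ ∧ z = P z + t z • outerNormal Ω (P z) :=
    hT.eventually x hx _ hφδ
  have hF : HasFDerivAt (fun z => t z - φ (P z)) (innerSL ℝ (graphGradient P t y l)) y := by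
    rw [innerSL_graphGradient]
    exact htd.sub (HasFDerivWithinAt.comp_hasFDerivAt_of_eq y hl hPd (hev.mono fun z hz => hz.1)
      hPy.symm)
  refine IsOuterNormalAt.of_hasFDerivAt hF (by rw [hPy, hty, sub_self]) ?_ ?_
  -- The gradient is not zero: along the normal line `t` grows with slope one while `φ ∘ P` is
  -- constant.
  · intro h0
    rw [h0, map_zero] at hF
    have hline : HasDerivAt (fun s : ℝ => y + s • outerNormal Ω x) (outerNormal Ω x) 0 := by
      simpa using ((hasDerivAt_id (0 : ℝ)).smul_const (outerNormal Ω x)).const_add y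
    have h1 := HasFDerivAt.comp_hasDerivAt_of_eq (0 : ℝ) hF hline (by simp)
    have h2 : HasDerivAt (fun s : ℝ => s) 0 (0 : ℝ) := by
      refine (h1.congr_of_eventuallyEq (f₁ := fun s : ℝ => s) ?_)
      have : ∀ᶠ s : ℝ in 𝓝 0, |φ x + s| < δ := by
        have : ContinuousAt (fun s : ℝ => |φ x + s|) 0 := by fun_prop
        exact this.eventually (gt_mem_nhds (by simpa using hφδ))
      filter_upwards [this] with s hs
      have e : y + s • outerNormal Ω x = x + (φ x + s) • outerNormal Ω x := by
        rw [hy, graphMap]; module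
      simp only [Function.comp]
      rw [e, hT.proj_apply x hx _ hs, hT.dist_apply x hx _ hs]
      ring
    exact zero_ne_one (h2.unique (hasDerivAt_id 0))
  · have h1 : ∀ᶠ z in 𝓝 y, |t z| < s₁ :=
      htd.continuousAt.abs.eventually (gt_mem_nhds (by simpa only [hty] using hφ x hx))
    filter_upwards [hev, h1] with z hz hz1
    conv_lhs => rw [hz.2.2]
    rw [hT.add_smul_mem_iff hU hb hs₁ hφ hin hout hz.1 hz1, sub_neg]

/-- At `y = x` the gradient would be exactly `ν - l`, as `l` is tangential. What remains is the
change of `Dt` and `DP` between `x` and `y`. -/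
theorem IsTube.norm_graphGradient_sub_le (hT : IsTube Ω δ P t) {x y l : EuclideanSpace ℝ (Fin N)}
    (hx : x ∈ frontier Ω) (hl : ⟪l, outerNormal Ω x⟫_ℝ = 0) :
    ‖graphGradient P t y l - (outerNormal Ω x - l)‖ ≤
      ‖fderiv ℝ t y - fderiv ℝ t x‖ + ‖l‖ * ‖fderiv ℝ P y - fderiv ℝ P x‖ := by
  have e : innerSL ℝ (graphGradient P t y l - (outerNormal Ω x - l)) =
      (fderiv ℝ t y - fderiv ℝ t x) - (innerSL ℝ l).comp (fderiv ℝ P y - fderiv ℝ P x) := by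
    rw [map_sub, innerSL_graphGradient, (hT.hasFDerivAt_proj x hx).fderiv,
      (hT.hasFDerivAt_dist x hx).fderiv]
    ext v
    simp [hl]
    ring
  rw [← innerSL_apply_norm (𝕜 := ℝ), e]
  refine (norm_sub_le _ _).trans (add_le_add_right ?_ _)
  refine (ContinuousLinearMap.opNorm_comp_le _ _).trans ?_
  rw [innerSL_apply_norm]

theorem inner_tangentialGradient (ψ : EuclideanSpace ℝ (Fin N) → ℝ)
    (x : EuclideanSpace ℝ (Fin N)) : ⟪tangentialGradient Ω ψ x, outerNormal Ω x⟫_ℝ = 0 :=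
  Submodule.mem_orthogonal_singleton_iff_inner_left.1 (Submodule.starProjection_apply_mem _ _)

theorem starProjection_tangentPlane {x : EuclideanSpace ℝ (Fin N)} (hx : ‖outerNormal Ω x‖ = 1)
    (v : EuclideanSpace ℝ (Fin N)) :
    (tangentPlane Ω x).starProjection v = v - ⟪outerNormal Ω x, v⟫_ℝ • outerNormal Ω x := by
  rw [← Submodule.starProjection_unit_singleton ℝ hx]
  exact Submodule.starProjection_orthogonal_val (K := ℝ ∙ outerNormal Ω x) v

/-- At points of `Γ`, differentiability along `Γ` is differentiability of the extension that is
constant along normals, and the tangential gradient is the gradient of that extension. -/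
theorem IsTube.hasFDerivAt_comp_proj (hT : IsTube Ω δ P t) (hΩ : IsC2Domain Ω)
    {φ : EuclideanSpace ℝ (Fin N) → ℝ}
    {x : EuclideanSpace ℝ (Fin N)} (hx : x ∈ frontier Ω)
    (hφ : DifferentiableWithinAt ℝ φ (frontier Ω) x) :
    HasFDerivAt (φ ∘ P) (innerSL ℝ (tangentialGradient Ω φ x)) x := by
  have hPx : P x = x := by
    simpa using hT.proj_apply x hx 0 (by simpa using hT.pos)
  have hev : ∀ᶠ z in 𝓝 x, P z ∈ frontier Ω := by
    have := hT.eventually x hx 0 (by simpa using hT.pos)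
    rw [zero_smul, add_zero] at this
    exact this.mono fun z hz => hz.1
  refine (HasFDerivWithinAt.comp_hasFDerivAt_of_eq x hφ.hasFDerivWithinAt
    (hT.hasFDerivAt_proj x hx) hev hPx.symm).congr_fderiv ?_
  ext v
  rw [innerSL_apply_apply, tangentialGradient,
    (tangentPlane Ω x).inner_starProjection_left_eq_right,
    starProjection_tangentPlane (hΩ.norm_outerNormal hx), InnerProductSpace.toDual_symm_apply]
  rfl

theorem IsTube.hasFDerivWithinAt_of_comp_proj (hT : IsTube Ω δ P t)
    {φ : EuclideanSpace ℝ (Fin N) → ℝ}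
    {x : EuclideanSpace ℝ (Fin N)} (hx : x ∈ frontier Ω)
    {D : EuclideanSpace ℝ (Fin N) →L[ℝ] ℝ} (hφ : HasFDerivAt (φ ∘ P) D x) :
    HasFDerivWithinAt φ D (frontier Ω) x := by
  have hP : ∀ z ∈ frontier Ω, P z = z := fun z hz => by
    simpa using hT.proj_apply z hz 0 (by simpa using hT.pos)
  exact hφ.hasFDerivWithinAt.congr (fun z hz => by simp [hP z hz]) (by simp [hP x hx])

/-- Compactness of `Γ` makes the continuity of `Dt` and `DP` at its points uniform. The radius does
not depend on the graph, which is what permits steep perturbations. -/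
theorem IsTube.exists_fderiv_near (hT : IsTube Ω δ P t) (hΩ : IsC2Domain Ω) {θ : ℝ} (hθ : 0 < θ) :
    ∃ r > 0, ∀ x ∈ frontier Ω, ∀ y, dist y x < r →
      ‖fderiv ℝ t y - fderiv ℝ t x‖ < θ ∧ ‖fderiv ℝ P y - fderiv ℝ P x‖ < θ := by
  have key : ∀ {F : Type} [NormedAddCommGroup F] (f : EuclideanSpace ℝ (Fin N) → F),
      (∀ x ∈ frontier Ω, ContinuousAt f x) →
      ∃ r > 0, ∀ x ∈ frontier Ω, ∀ y, dist y x < r → ‖f y - f x‖ < θ := by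
    intro F _ f hf
    have := hΩ.isCompact_frontier.uniformContinuousAt_of_continuousAt f hf
      (Metric.dist_mem_uniformity hθ)
    obtain ⟨r, hr, h⟩ := Metric.mem_uniformity_dist.1 this
    refine ⟨r, hr, fun x hx y hy => ?_⟩
    have := h (a := x) (b := y) (by rwa [dist_comm]) hx
    rwa [← dist_eq_norm, dist_comm]
  have c : ∀ {F : Type} [NormedAddCommGroup F] [NormedSpace ℝ F]
      (f : EuclideanSpace ℝ (Fin N) → F) x, ContDiffAt ℝ 1 f x → ContinuousAt (fderiv ℝ f) x :=
    fun f x h => (h.fderiv_right (m := 0) (by norm_num)).continuousAt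
  obtain ⟨r1, h1, h1'⟩ := key (fderiv ℝ t) fun x hx => c _ _ (by
    simpa using hT.contDiffAt_dist x hx 0 (by simpa using hT.pos))
  obtain ⟨r2, h2, h2'⟩ := key (fderiv ℝ P) fun x hx => c _ _ (by
    simpa using hT.contDiffAt_proj x hx 0 (by simpa using hT.pos))
  exact ⟨min r1 r2, lt_min h1 h2, fun x hx y hy =>
    ⟨h1' x hx y (hy.trans_le (min_le_left _ _)), h2' x hx y (hy.trans_le (min_le_right _ _))⟩⟩

end GraphNormal

/-! ### Surface measure and Rademacher's theorem on `Γ` -/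

section Rademacher

variable {N : ℕ} {Ω : Set (EuclideanSpace ℝ (Fin N))}

theorem euclideanHausdorffMeasure_orthogonal_span_singleton {E : Type*} [NormedAddCommGroup E]
    [InnerProductSpace ℝ E] [FiniteDimensional ℝ E] [MeasurableSpace E] [BorelSpace E] {d : ℕ}
    (hd : Module.finrank ℝ E = d + 1) {n : E} (hn : ‖n‖ = 1) :
    (μHE[d] : Measure (ℝ ∙ n)ᗮ) = volume := by
  have : Fact (Module.finrank ℝ E = d + 1) := ⟨hd⟩
  have hr : Module.finrank ℝ (ℝ ∙ n)ᗮ = d :=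
    Submodule.finrank_orthogonal_span_singleton (by rintro rfl; simp at hn)
  have h : ∀ k, Module.finrank ℝ (ℝ ∙ n)ᗮ = k → (μHE[k] : Measure (ℝ ∙ n)ᗮ) = volume := by
    rintro k rfl
    exact InnerProductSpace.euclideanHausdorffMeasure_eq_volume
  exact h d hr

theorem finrank_euclideanSpace_eq_succ (hN : 1 ≤ N) :
    Module.finrank ℝ (EuclideanSpace ℝ (Fin N)) = N - 1 + 1 := by
  rw [finrank_euclideanSpace_fin]; omega

/-- Near each of its points, `∂Ω` projects to the tangent plane with a Lipschitz inverse. -/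
theorem IsC2Domain.exists_dist_le_projection (hΩ : IsC2Domain Ω) {x₀ : EuclideanSpace ℝ (Fin N)}
    (hx₀ : x₀ ∈ frontier Ω) : ∃ r > 0, ∀ x ∈ frontier Ω ∩ Metric.ball x₀ r,
      ∀ y ∈ frontier Ω ∩ Metric.ball x₀ r, dist x y ≤ (2 : NNReal) *
        dist ((ℝ ∙ outerNormal Ω x₀)ᗮ.orthogonalProjectionOnto x)
          ((ℝ ∙ outerNormal Ω x₀)ᗮ.orthogonalProjectionOnto y) := by
  obtain ⟨r, hr, h⟩ := hΩ.exists_flat hx₀ (θ := 1 / 2) (by norm_num)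
  refine ⟨r, hr, fun x hx y hy => ?_⟩
  have := norm_sub_le_norm_orthogonalProjection (hΩ.norm_outerNormal hx₀) (h x hx y hy)
  rw [map_sub] at this
  rw [dist_eq_norm, dist_eq_norm, NNReal.coe_ofNat]
  linarith

/-- Locally `Γ` is a Lipschitz image of a bounded subset of its tangent plane, and it is compact. -/
theorem IsC2Domain.isFiniteMeasure_surfaceMeasure (hN : 1 ≤ N) (hΩ : IsC2Domain Ω) :
    IsFiniteMeasure (surfaceMeasure (frontier Ω)) := by
  refine ⟨?_⟩
  rw [surfaceMeasure, Measure.restrict_apply_univ]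
  refine hΩ.isCompact_frontier.measure_lt_top_of_nhdsWithin fun x₀ hx₀ => ?_
  obtain ⟨r, hr, h⟩ := hΩ.exists_dist_le_projection hx₀
  refine ⟨frontier Ω ∩ Metric.ball x₀ r,
    inter_mem self_mem_nhdsWithin (mem_nhdsWithin_of_mem_nhds (Metric.ball_mem_nhds _ hr)), ?_⟩
  have h1 := euclideanHausdorffMeasure_image_le_of_dist_le (f := id) (N - 1) h
  rw [image_id, euclideanHausdorffMeasure_orthogonal_span_singleton
    (finrank_euclideanSpace_eq_succ hN) (hΩ.norm_outerNormal hx₀)] at h1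
  refine h1.trans_lt (ENNReal.mul_lt_top (by simp) ?_)
  refine Bornology.IsBounded.measure_lt_top ?_
  exact ((ℝ ∙ outerNormal Ω x₀)ᗮ.orthogonalProjectionOnto).lipschitz.isBounded_image
    (Metric.isBounded_ball.subset inter_subset_right)

/-- Rademacher's theorem on a `C²` hypersurface. -/
theorem IsC2Domain.ae_differentiableWithinAt (hN : 1 ≤ N) (hΩ : IsC2Domain Ω)
    {φ : EuclideanSpace ℝ (Fin N) → ℝ} {L : NNReal} (hφ : LipschitzOnWith L φ (frontier Ω)) :
    ∀ᵐ x ∂(surfaceMeasure (frontier Ω)), DifferentiableWithinAt ℝ φ (frontier Ω) x := by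
  rw [surfaceMeasure, ae_restrict_iff' isClosed_frontier.measurableSet, ae_iff]
  refine measure_null_of_locally_null _ fun x₀ hx₀ => ?_
  simp only [mem_ofPred_eq, Classical.not_imp] at hx₀
  have hx₀ := hx₀.1
  obtain ⟨r, hr, h⟩ := hΩ.exists_dist_le_projection hx₀
  set A := frontier Ω ∩ Metric.ball x₀ r
  set T := (ℝ ∙ outerNormal Ω x₀)ᗮ with hT
  set P : EuclideanSpace ℝ (Fin N) → T := fun x => T.orthogonalProjectionOnto x with hP
  have hinv : ∀ y ∈ P '' A, Function.invFunOn P A y ∈ A ∧ P (Function.invFunOn P A y) = y :=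
    fun y hy => ⟨Function.invFunOn_mem hy, Function.invFunOn_eq hy⟩
  have hg : LipschitzOnWith (L * 2) (φ ∘ Function.invFunOn P A) (P '' A) := by
    have : LipschitzOnWith 2 (Function.invFunOn P A) (P '' A) := by
      refine LipschitzOnWith.of_dist_le_mul fun y hy z hz => ?_
      have := h _ (hinv y hy).1 _ (hinv z hz).1
      change _ ≤ _ * dist (P _) (P _) at this
      rwa [(hinv y hy).2, (hinv z hz).2] at this
    exact hφ.comp this fun y hy => (hinv y hy).1.1
  -- Read in the tangent plane, `φ` is Lipschitz on the projected piece only; the extension makes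
  -- the classical Rademacher theorem on the whole plane applicable.
  obtain ⟨f, hf, hfg⟩ := hg.extend_real
  have hfP : ∀ x ∈ A, φ x = f (P x) := by
    intro x hx
    have hx' := mem_image_of_mem P hx
    rw [← hfg hx']
    have := h _ (hinv _ hx').1 x hx
    change _ ≤ _ * dist (P _) (P _) at this
    rw [(hinv _ hx').2, dist_self, mul_zero] at this
    simp only [Function.comp]
    rw [dist_le_zero.1 this]
  refine ⟨_, inter_mem self_mem_nhdsWithin
    (mem_nhdsWithin_of_mem_nhds (Metric.ball_mem_nhds x₀ hr)), ?_⟩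
  set u := {x | ¬(x ∈ frontier Ω → DifferentiableWithinAt ℝ φ (frontier Ω) x)} ∩ Metric.ball x₀ r
  have huA : u ⊆ A := by
    rintro x ⟨hx, hb⟩
    simp only [mem_ofPred_eq, Classical.not_imp] at hx
    exact ⟨hx.1, hb⟩
  have h1 := euclideanHausdorffMeasure_image_le_of_dist_le (f := id) (A := u) (N - 1)
    fun x hx y hy => h x (huA hx) y (huA hy)
  rw [image_id, euclideanHausdorffMeasure_orthogonal_span_singleton
    (finrank_euclideanSpace_eq_succ hN) (hΩ.norm_outerNormal hx₀)] at h1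
  -- Bad points project into the null set where `f` is not differentiable, and the Lipschitz inverse
  -- carries null sets back to `Γ`.
  have h2 : volume (P '' u) = 0 := by
    refine measure_mono_null ?_ (ae_iff.1 (hf.ae_differentiableAt (μ := volume)))
    rintro _ ⟨x, hx, rfl⟩ hd
    have hxA := huA hx
    simp only [u, mem_inter_iff, mem_ofPred_eq, Classical.not_imp] at hx
    refine hx.1.2 ?_
    have hd' : DifferentiableAt ℝ (fun x => f (P x)) x :=
      DifferentiableAt.comp x (f := P) hd T.orthogonalProjectionOnto.differentiableAt
    rw [← differentiableWithinAt_inter (Metric.isOpen_ball.mem_nhds hx.2)]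
    exact hd'.differentiableWithinAt.congr hfP (hfP x hxA)
  change _ ≤ _ * volume (P '' u) at h1
  rw [h2, mul_zero] at h1
  exact le_antisymm h1 zero_le

/-- Almost everywhere it equals the gradient of `φ ∘ P`, an ordinary derivative, whose measurability
is standard. -/
theorem IsTube.aemeasurable_tangentialGradient {δ : ℝ}
    {P : EuclideanSpace ℝ (Fin N) → EuclideanSpace ℝ (Fin N)}
    {t : EuclideanSpace ℝ (Fin N) → ℝ} (hT : IsTube Ω δ P t) (hN : 1 ≤ N) (hΩ : IsC2Domain Ω)
    {φ : EuclideanSpace ℝ (Fin N) → ℝ} {L : NNReal} (hφ : LipschitzOnWith L φ (frontier Ω)) :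
    AEMeasurable (tangentialGradient Ω φ) (surfaceMeasure (frontier Ω)) := by
  refine ⟨fun x => (InnerProductSpace.toDual ℝ (EuclideanSpace ℝ (Fin N))).symm
    (fderiv ℝ (φ ∘ P) x), ?_, ?_⟩
  · exact (LinearIsometryEquiv.continuous _).measurable.comp (measurable_fderiv ℝ _)
  · filter_upwards [hΩ.ae_differentiableWithinAt hN hφ,
      ae_restrict_mem isClosed_frontier.measurableSet] with x hx hxΓ
    rw [(hT.hasFDerivAt_comp_proj hΩ hxΓ hx).fderiv]
    refine ext_inner_right ℝ fun v => ?_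
    rw [InnerProductSpace.toDual_symm_apply, innerSL_apply_apply]

end Rademacher

/-! ### Surface elements as densities -/

section Density

variable {X : Type*} [MeasurableSpace X]

theorem ae_restrict_rnDeriv_le {κ σ : Measure X} [IsFiniteMeasure κ] [IsFiniteMeasure σ]
    (hκ : κ ≪ σ) {Q : Set X} (hQ : MeasurableSet Q) {c : ENNReal}
    (h : ∀ A ⊆ Q, MeasurableSet A → κ A ≤ c * σ A) :
    ∀ᵐ x ∂(σ.restrict Q), κ.rnDeriv σ x ≤ c := by
  refine ae_le_of_forall_setLIntegral_le_of_sigmaFinite (Measure.measurable_rnDeriv _ _)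
    fun A hA _ => ?_
  rw [Measure.restrict_restrict hA, Measure.setLIntegral_rnDeriv hκ, setLIntegral_const]
  exact h _ inter_subset_right (hA.inter hQ)

theorem le_ae_restrict_rnDeriv {κ σ : Measure X} [IsFiniteMeasure κ] [IsFiniteMeasure σ]
    (hκ : κ ≪ σ) {Q : Set X} (hQ : MeasurableSet Q) {c : ENNReal}
    (h : ∀ A ⊆ Q, MeasurableSet A → c * σ A ≤ κ A) :
    ∀ᵐ x ∂(σ.restrict Q), c ≤ κ.rnDeriv σ x := by
  refine ae_le_of_forall_setLIntegral_le_of_sigmaFinite measurable_const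
    fun A hA _ => ?_
  rw [Measure.restrict_restrict hA, Measure.setLIntegral_rnDeriv hκ, setLIntegral_const]
  exact h _ inter_subset_right (hA.inter hQ)

variable {N : ℕ} {Ψ : EuclideanSpace ℝ (Fin N) → EuclideanSpace ℝ (Fin N)}
  {S T : Set (EuclideanSpace ℝ (Fin N))} {L : NNReal}

theorem aemeasurable_invFunOn_surfaceMeasure (hS : IsCompact S) (hΨ : LipschitzOnWith L Ψ S)
    (hb : BijOn Ψ S T) : AEMeasurable (Function.invFunOn Ψ S) (surfaceMeasure T) := by
  have hTc : IsCompact T := hb.image_eq ▸ hS.image_of_continuousOn hΨ.continuousOn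
  have hmaps : MapsTo (Function.invFunOn Ψ S) T S := hb.surjOn.mapsTo_invFunOn
  have hright : ∀ y ∈ T, Ψ (Function.invFunOn Ψ S y) = y := hb.surjOn.rightInvOn_invFunOn
  have hleft : ∀ x ∈ S, Function.invFunOn Ψ S (Ψ x) = x := hb.injOn.leftInvOn_invFunOn
  refine ContinuousOn.aemeasurable ?_ hTc.measurableSet
  rw [continuousOn_iff_isClosed]
  intro C hC
  refine ⟨Ψ '' (S ∩ C), ((hS.inter_right hC).image_of_continuousOn
    (hΨ.continuousOn.mono inter_subset_left)).isClosed, ?_⟩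
  ext y
  constructor
  · rintro ⟨hy, hyT⟩
    exact ⟨⟨_, ⟨hmaps hyT, hy⟩, hright y hyT⟩, hyT⟩
  · rintro ⟨⟨x, ⟨hxS, hxC⟩, rfl⟩, hyT⟩
    exact ⟨by simpa [hleft x hxS] using hxC, hyT⟩

theorem map_invFunOn_surfaceMeasure_apply (hS : IsCompact S) (hΨ : LipschitzOnWith L Ψ S)
    (hb : BijOn Ψ S T) {A : Set (EuclideanSpace ℝ (Fin N))} (hA : MeasurableSet A) :
    (surfaceMeasure T).map (Function.invFunOn Ψ S) A =
      (μHE[N - 1] : Measure (EuclideanSpace ℝ (Fin N))) (Ψ '' (A ∩ S)) := by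
  have hTc : IsCompact T := hb.image_eq ▸ hS.image_of_continuousOn hΨ.continuousOn
  rw [Measure.map_apply_of_aemeasurable (aemeasurable_invFunOn_surfaceMeasure hS hΨ hb) hA,
    surfaceMeasure, Measure.restrict_apply' hTc.measurableSet]
  congr 1
  ext y
  constructor
  · rintro ⟨hy, hyT⟩
    exact ⟨_, ⟨hy, hb.surjOn.mapsTo_invFunOn hyT⟩, hb.surjOn.rightInvOn_invFunOn hyT⟩
  · rintro ⟨x, ⟨hxA, hxS⟩, rfl⟩
    refine ⟨?_, hb.mapsTo hxS⟩
    rw [mem_preimage, hb.injOn.leftInvOn_invFunOn hxS]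
    exact hxA

theorem map_invFunOn_surfaceMeasure_le (hS : IsCompact S) (hΨ : LipschitzOnWith L Ψ S)
    (hb : BijOn Ψ S T) {A : Set (EuclideanSpace ℝ (Fin N))} (hA : MeasurableSet A) :
    (surfaceMeasure T).map (Function.invFunOn Ψ S) A ≤
      (L : ENNReal) ^ (N - 1) * surfaceMeasure S A := by
  rw [map_invFunOn_surfaceMeasure_apply hS hΨ hb hA, surfaceMeasure, Measure.restrict_apply hA]
  have := euclideanHausdorffMeasure_image_le_of_dist_le (f := Ψ) (g := id) (A := A ∩ S) (K := L)
    (N - 1) fun x hx y hy => hΨ.dist_le_mul x hx.2 y hy.2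
  rwa [image_id] at this

/-- If `Ψ` is close to an affine tilt on an almost flat piece `Q` of `S`, then its surface element
on `Q` is close to the Jacobian of the tilt. -/
theorem surfaceElement_bounds_of_near_tiltMap (hN : 1 ≤ N) (hS : IsCompact S)
    [IsFiniteMeasure (surfaceMeasure S)] (hΨ : LipschitzOnWith L Ψ S) (hb : BijOn Ψ S T)
    {Q : Set (EuclideanSpace ℝ (Fin N))} (hQ : MeasurableSet Q) (hQS : Q ⊆ S)
    {n l : EuclideanSpace ℝ (Fin N)} (hn : ‖n‖ = 1) (hl : l ∈ (ℝ ∙ n)ᗮ) {η : ℝ} (hη : 0 ≤ η)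
    (hη' : η ≤ 1 / 8) (hflat : ∀ x ∈ Q, ∀ y ∈ Q, |⟪x - y, n⟫_ℝ| ≤ η * ‖x - y‖)
    (hnear : ∀ x ∈ Q, ∀ y ∈ Q, ‖Ψ x - Ψ y - tiltMap n l (x - y)‖ ≤ η * ‖x - y‖) :
    ∀ᵐ x ∂((surfaceMeasure S).restrict Q),
      surfaceElement Ψ S T x ≤ (1 + 8 * η) ^ (2 * (N - 1)) * √(1 + ‖l‖ ^ 2) ∧
      √(1 + ‖l‖ ^ 2) ≤ (1 + 8 * η) ^ (2 * (N - 1)) * surfaceElement Ψ S T x := by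
  set κ := (surfaceMeasure T).map (Function.invFunOn Ψ S) with hκ
  set σ := surfaceMeasure S with hσ
  have hle : ∀ A, MeasurableSet A → κ A ≤ (L : ENNReal) ^ (N - 1) * σ A := fun A hA =>
    map_invFunOn_surfaceMeasure_le hS hΨ hb hA
  have hac : κ ≪ σ := Measure.AbsolutelyContinuous.mk fun A hA h0 => by
    have := hle A hA
    rw [h0, mul_zero] at this
    exact le_antisymm this zero_le
  have hfin : IsFiniteMeasure κ := ⟨(hle univ MeasurableSet.univ).trans_lt
    (ENNReal.mul_lt_top (by simp) (measure_lt_top σ _))⟩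
  -- Both hypotheses pass to subsets of `Q`; an estimate on every measurable subset is an estimate
  -- of densities.
  have hbd : ∀ A ⊆ Q, MeasurableSet A →
      κ A ≤ ENNReal.ofReal ((1 + 8 * η) ^ (2 * (N - 1)) * √(1 + ‖l‖ ^ 2)) * σ A ∧
      ENNReal.ofReal √(1 + ‖l‖ ^ 2) * σ A ≤
        ENNReal.ofReal ((1 + 8 * η) ^ (2 * (N - 1))) * κ A := by
    intro A hAQ hA
    have hAS : A ∩ S = A := inter_eq_left.2 (hAQ.trans hQS)
    rw [hκ, map_invFunOn_surfaceMeasure_apply hS hΨ hb hA, hσ, surfaceMeasure,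
      Measure.restrict_apply hA, hAS]
    exact euclideanHausdorffMeasure_image_near_tiltMap (finrank_euclideanSpace_eq_succ hN) hn hl hη
      hη' (fun x hx y hy => hflat x (hAQ hx) y (hAQ hy))
      (fun x hx y hy => hnear x (hAQ hx) y (hAQ hy))
  have hK : 0 < (1 + 8 * η) ^ (2 * (N - 1)) := by positivity
  have h1 := ae_restrict_rnDeriv_le hac hQ fun A hAQ hA => (hbd A hAQ hA).1
  have h2 : ∀ᵐ x ∂(σ.restrict Q), ENNReal.ofReal (((1 + 8 * η) ^ (2 * (N - 1)))⁻¹ *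
      √(1 + ‖l‖ ^ 2)) ≤ κ.rnDeriv σ x := by
    refine le_ae_restrict_rnDeriv hac hQ fun A hAQ hA => ?_
    rw [ENNReal.ofReal_mul (by positivity), ENNReal.ofReal_inv_of_pos hK, mul_assoc]
    rw [ENNReal.inv_mul_le_iff (by simpa using hK) (by simp)]
    exact (hbd A hAQ hA).2
  filter_upwards [h1, h2, ae_restrict_of_ae (Measure.rnDeriv_lt_top κ σ)] with x hx1 hx2 hx3
  have e : surfaceElement Ψ S T x = (κ.rnDeriv σ x).toReal := rfl
  rw [e]
  constructor
  · exact ENNReal.toReal_le_of_le_ofReal (by positivity) hx1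
  · have := (ENNReal.ofReal_le_iff_le_toReal hx3.ne).1 hx2
    rwa [inv_mul_le_iff₀ hK] at this

end Density

/-! ### Surface element of a normal graph -/

section SurfaceElement

variable {N : ℕ} {Ω : Set (EuclideanSpace ℝ (Fin N))}

theorem lipschitzOnWith_graphMap (hΩ : IsC2Domain Ω) {φ : EuclideanSpace ℝ (Fin N) → ℝ}
    {L Lν : NNReal} (hφL : LipschitzOnWith L φ (frontier Ω))
    (hν : LipschitzOnWith Lν (outerNormal Ω) (frontier Ω)) {b : NNReal}
    (hφ : ∀ x ∈ frontier Ω, |φ x| ≤ b) :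
    LipschitzOnWith (1 + L + b * Lν) (graphMap Ω φ) (frontier Ω) := by
  refine LipschitzOnWith.of_dist_le_mul fun x hx y hy => ?_
  have e : graphMap Ω φ x - graphMap Ω φ y = (x - y) + (φ x - φ y) • outerNormal Ω x +
      φ y • (outerNormal Ω x - outerNormal Ω y) := by
    rw [graphMap, graphMap]; module
  have h1 := hφL.dist_le_mul x hx y hy
  have h2 := hν.dist_le_mul x hx y hy
  rw [Real.dist_eq] at h1
  rw [dist_eq_norm x y] at h1 h2 ⊢
  rw [dist_eq_norm] at h2 ⊢
  rw [e]
  refine (norm_add₃_le).trans ?_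
  rw [norm_smul, norm_smul, hΩ.norm_outerNormal hx, mul_one, Real.norm_eq_abs, Real.norm_eq_abs]
  have h3 : |φ y| * ‖outerNormal Ω x - outerNormal Ω y‖ ≤ b * (Lν * ‖x - y‖) := by
    gcongr
    exact hφ y hy
  push_cast
  linarith

theorem abs_sqrt_one_add_sq_sub_le (a b : ℝ) : |√(1 + a ^ 2) - √(1 + b ^ 2)| ≤ |a - b| := by
  have key : ∀ a b : ℝ, √(1 + a ^ 2) ≤ √(1 + b ^ 2) + |a - b| := by
    intro a b
    rw [Real.sqrt_le_iff]
    have h1 : |b| ≤ √(1 + b ^ 2) := Real.abs_le_sqrt (by linarith)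
    have h2 := Real.sq_sqrt (by positivity : 0 ≤ 1 + b ^ 2)
    have h3 : b * (a - b) ≤ |b| * |a - b| := by rw [← abs_mul]; exact le_abs_self _
    refine ⟨by positivity, ?_⟩
    nlinarith [sq_abs (a - b), abs_nonneg (a - b), mul_le_mul_of_nonneg_right h1 (abs_nonneg (a - b))]
  rw [abs_le]
  have h1 := key a b
  have h2 := key b a
  rw [abs_sub_comm] at h2
  constructor <;> linarith

/-- Pythagoras. It identifies the Jacobian of the tilt with the length of `D̂φ`. -/
theorem norm_pseudoDerivative (hΩ : IsC2Domain Ω) (φ : EuclideanSpace ℝ (Fin N) → ℝ)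
    {x : EuclideanSpace ℝ (Fin N)} (hx : x ∈ frontier Ω) :
    ‖pseudoDerivative Ω φ x‖ = √(1 + ‖tangentialGradient Ω φ x‖ ^ 2) := by
  have h := norm_sub_sq_real (outerNormal Ω x) (tangentialGradient Ω φ x)
  rw [real_inner_comm, inner_tangentialGradient, hΩ.norm_outerNormal hx] at h
  rw [pseudoDerivative, ← Real.sqrt_sq (norm_nonneg _), h]
  congr 1; ring

/-- Countably many pieces on which `φ` is almost affine cover almost all of `Γ`. Localised further
so that `Γ` is flat and `ν` almost constant, each is a case of
`surfaceElement_bounds_of_near_tiltMap`. The size of `φ` enters only through the rotation of `ν`,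
hence through `b * Lν`. -/
theorem IsTube.abs_surfaceElement_sub_le {δ : ℝ}
    {P : EuclideanSpace ℝ (Fin N) → EuclideanSpace ℝ (Fin N)}
    {t : EuclideanSpace ℝ (Fin N) → ℝ} (hT : IsTube Ω δ P t) (hN : 1 ≤ N) (hΩ : IsC2Domain Ω)
    {φ : EuclideanSpace ℝ (Fin N) → ℝ} {T : Set (EuclideanSpace ℝ (Fin N))}
    {L Lν : NNReal} (hφL : LipschitzOnWith L φ (frontier Ω))
    (hν : LipschitzOnWith Lν (outerNormal Ω) (frontier Ω))
    (hb : BijOn (graphMap Ω φ) (frontier Ω) T) {C : ℝ} (hC0 : 0 ≤ C) {η : NNReal} (hη : 0 < η)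
    (hη' : (5 + C) * η ≤ 1 / 8) {b : NNReal} (hφ : ∀ x ∈ frontier Ω, |φ x| ≤ b)
    (hbL : b * Lν ≤ η)
    (hC : ∀ᵐ x ∂(surfaceMeasure (frontier Ω)), ‖tangentialGradient Ω φ x‖ ≤ C) :
    ∀ᵐ x ∂(surfaceMeasure (frontier Ω)),
      |surfaceElement (graphMap Ω φ) (frontier Ω) T x - ‖pseudoDerivative Ω φ x‖| ≤
        ((1 + 8 * ((5 + C) * η)) ^ (2 * (N - 1)) - 1) * (1 + C) + 2 * η := by
  set Γ := frontier Ω with hΓ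
  set σ := surfaceMeasure Γ with hσ
  set ν := outerNormal Ω with hνd
  set γ := surfaceElement (graphMap Ω φ) Γ T with hγ
  have hΓm : MeasurableSet Γ := isClosed_frontier.measurableSet
  have hfin : IsFiniteMeasure σ := hΩ.isFiniteMeasure_surfaceMeasure hN
  set g : EuclideanSpace ℝ (Fin N) → EuclideanSpace ℝ (Fin N) := fun x =>
    (InnerProductSpace.toDual ℝ (EuclideanSpace ℝ (Fin N))).symm (fderiv ℝ (φ ∘ P) x) with hg
  have hgm : Measurable g :=
    (LinearIsometryEquiv.continuous _).measurable.comp (measurable_fderiv ℝ _)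
  have hgi : ∀ x, innerSL ℝ (g x) = fderiv ℝ (φ ∘ P) x := fun x => by
    ext v; rw [innerSL_apply_apply, hg, InnerProductSpace.toDual_symm_apply]
  -- The good set is expressed through `φ ∘ P`, for which differentiability and gradient are
  -- measurable.
  set s := Γ ∩ {x | DifferentiableAt ℝ (φ ∘ P) x} ∩ {x | ‖g x‖ ≤ C} with hs
  have hsm : MeasurableSet s :=
    (hΓm.inter (measurableSet_of_differentiableAt ℝ _)).inter
      (measurableSet_le hgm.norm measurable_const)
  have hgl : ∀ x ∈ Γ, DifferentiableWithinAt ℝ φ Γ x → g x = tangentialGradient Ω φ x := by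
    intro x hx hd
    refine ext_inner_right ℝ fun v => ?_
    rw [← innerSL_apply_apply (𝕜 := ℝ), hgi, (hT.hasFDerivAt_comp_proj hΩ hx hd).fderiv,
      innerSL_apply_apply]
  have hsd : ∀ x ∈ s, HasFDerivWithinAt φ (fderiv ℝ (φ ∘ P) x) Γ x := fun x hx =>
    hT.hasFDerivWithinAt_of_comp_proj hx.1.1 hx.1.2.hasFDerivAt
  have hsg : ∀ x ∈ s, g x = tangentialGradient Ω φ x := fun x hx =>
    hgl x hx.1.1 (hsd x hx).differentiableWithinAt
  have haes : ∀ᵐ x ∂σ, x ∈ s := by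
    filter_upwards [hΩ.ae_differentiableWithinAt hN hφL, hC, ae_restrict_mem hΓm] with x h1 h2 h3
    refine ⟨⟨h3, (hT.hasFDerivAt_comp_proj hΩ h3 h1).differentiableAt⟩, ?_⟩
    change ‖g x‖ ≤ C
    rwa [hgl x h3 h1]
  -- On `sk k` the gradient stays within `η` of the constant `D k`.
  set D := TopologicalSpace.denseSeq (EuclideanSpace ℝ (Fin N)) with hD
  set sk : ℕ → Set (EuclideanSpace ℝ (Fin N)) := fun k => s ∩ g ⁻¹' Metric.ball (D k) η with hsk
  have hskm : ∀ k, MeasurableSet (sk k) := fun k => hsm.inter (hgm Metric.isOpen_ball.measurableSet)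
  have hpart := fun k => exists_partition_approximatesLinearOn_of_hasFDerivWithinAt φ (sk k)
    (fun x => fderiv ℝ (φ ∘ P) x)
    (fun x hx => (hsd x hx.1).mono fun z hz => hz.1.1.1) (fun _ => η) (fun _ => hη.ne')
  choose tn A htd htm hcov happ hA using hpart
  have hmain : ∀ k m, ∀ᵐ x ∂σ, x ∈ sk k ∩ tn k m → |γ x - ‖pseudoDerivative Ω φ x‖| ≤
      ((1 + 8 * ((5 + C) * η)) ^ (2 * (N - 1)) - 1) * (1 + C) + 2 * η := by
    intro k m
    rw [ae_iff]
    -- It suffices to find a neighbourhood of each bad point in which the bad points form a null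
    -- set. The bad point itself serves as base point of the tilt.
    refine measure_null_of_locally_null _ fun x₀ hx₀ => ?_
    simp only [mem_ofPred_eq, Classical.not_imp] at hx₀
    have hx₀s := hx₀.1.1.1
    have hx₀Γ : x₀ ∈ Γ := hx₀s.1.1
    obtain ⟨r, hr, hflat⟩ := hΩ.exists_flat hx₀Γ (θ := η) (by exact_mod_cast hη)
    have hη0 : (0 : ℝ) < η := by exact_mod_cast hη
    set ρ := min r (η / (Lν + 1)) with hρ
    have hρ0 : 0 < ρ := lt_min hr (by positivity)
    set Q := sk k ∩ tn k m ∩ Metric.ball x₀ ρ with hQ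
    have hQm : MeasurableSet Q :=
      ((hskm k).inter (htm k m)).inter Metric.isOpen_ball.measurableSet
    have hQΓ : Q ⊆ Γ := fun x hx => hx.1.1.1.1.1
    have hl : g x₀ ∈ (ℝ ∙ ν x₀)ᗮ := by
      rw [Submodule.mem_orthogonal_singleton_iff_inner_left, hsg x₀ hx₀s]
      exact inner_tangentialGradient φ x₀
    have hAk : ‖A k m - innerSL ℝ (D k)‖ ≤ η := by
      obtain ⟨y, hy, hAy⟩ := hA k ⟨x₀, hx₀.1.1⟩ m
      rw [hAy, ← hgi, ← map_sub, innerSL_apply_norm, ← dist_eq_norm]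
      exact le_of_lt hy.2
    have hgD : ∀ x ∈ Q, ‖g x - D k‖ ≤ η := fun x hx => by
      rw [← dist_eq_norm]; exact le_of_lt hx.1.1.2
    have hx₀Q : x₀ ∈ Q := ⟨hx₀.1, Metric.mem_ball_self hρ0⟩
    -- One `η` each for linearisation on the piece, for `A k m` against `D k`, and for `D k` against
    -- `g x₀`.
    have hφn : ∀ x ∈ Q, ∀ y ∈ Q, |φ x - φ y - ⟪g x₀, x - y⟫_ℝ| ≤ 3 * η * ‖x - y‖ := by
      intro x hx y hy
      have h1 := happ k m x hx.1 y hy.1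
      have h2 := (A k m - innerSL ℝ (D k)).le_of_opNorm_le hAk (x - y)
      have h3 := abs_real_inner_le_norm (D k - g x₀) (x - y)
      have h4 := hgD x₀ hx₀Q
      rw [norm_sub_rev] at h4
      have h5 : ‖D k - g x₀‖ * ‖x - y‖ ≤ η * ‖x - y‖ := by gcongr
      have e : φ x - φ y - ⟪g x₀, x - y⟫_ℝ = (φ x - φ y - A k m (x - y)) +
          (A k m - innerSL ℝ (D k)) (x - y) + ⟪D k - g x₀, x - y⟫_ℝ := by
        rw [inner_sub_left, _root_.sub_apply, innerSL_apply_apply]; ring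
      rw [e]
      refine (abs_add_three _ _ _).trans ?_
      rw [Real.norm_eq_abs] at h1 h2
      linarith
    have hνn : ∀ x ∈ Q, ‖ν x - ν x₀‖ ≤ η := by
      intro x hx
      have h1 := hν.dist_le_mul x (hQΓ hx) x₀ hx₀Γ
      have h2 : dist x x₀ < η / (Lν + 1) := lt_of_lt_of_le hx.2 (min_le_right _ _)
      rw [lt_div_iff₀ (by positivity)] at h2
      rw [← dist_eq_norm]
      nlinarith [dist_nonneg (x := x) (y := x₀)]
    have hη5 : (η : ℝ) ≤ (5 + C) * η := by nlinarith
    have hest := surfaceElement_bounds_of_near_tiltMap hN hΩ.isCompact_frontier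
      (lipschitzOnWith_graphMap hΩ hφL hν hφ) hb hQm hQΓ (hΩ.norm_outerNormal hx₀Γ) hl
      (η := (5 + C) * η) (by positivity) hη'
      (fun x hx y hy => (hflat x ⟨hQΓ hx, Metric.ball_subset_ball (min_le_left _ _) hx.2⟩
        y ⟨hQΓ hy, Metric.ball_subset_ball (min_le_left _ _) hy.2⟩).trans (by gcongr))
      (by
        intro x hx y hy
        -- The three terms cost `3η`, `Cη` and `η` times `‖x - y‖`, within the allowance `(5 + C)η`.
        have e : graphMap Ω φ x - graphMap Ω φ y - tiltMap (ν x₀) (g x₀) (x - y) =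
            (φ x - φ y - ⟪g x₀, x - y⟫_ℝ) • ν x + ⟪g x₀, x - y⟫_ℝ • (ν x - ν x₀) +
            φ y • (ν x - ν y) := by
          rw [graphMap, graphMap, tiltMap_apply]; module
        rw [e]
        refine (norm_add₃_le).trans ?_
        rw [norm_smul, norm_smul, norm_smul, hΩ.norm_outerNormal (hQΓ hx), mul_one,
          Real.norm_eq_abs, Real.norm_eq_abs, Real.norm_eq_abs]
        have h1 := hφn x hx y hy
        have h2 : |⟪g x₀, x - y⟫_ℝ| * ‖ν x - ν x₀‖ ≤ (C * ‖x - y‖) * η := by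
          gcongr
          · exact (abs_real_inner_le_norm _ _).trans (by gcongr; exact hx₀s.2)
          · exact hνn x hx
        have h3 : |φ y| * ‖ν x - ν y‖ ≤ b * (Lν * ‖x - y‖) := by
          gcongr
          · exact hφ y (hQΓ hy)
          · have := hν.dist_le_mul x (hQΓ hx) y (hQΓ hy)
            rwa [dist_eq_norm, dist_eq_norm] at this
        have h4 : (b : ℝ) * (Lν * ‖x - y‖) ≤ η * ‖x - y‖ := by
          rw [← mul_assoc]; gcongr; exact_mod_cast hbL
        nlinarith [norm_nonneg (x - y), mul_nonneg hη0.le (norm_nonneg (x - y))])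
    refine ⟨_, inter_mem self_mem_nhdsWithin
      (mem_nhdsWithin_of_mem_nhds (Metric.ball_mem_nhds x₀ hρ0)), ?_⟩
    rw [ae_restrict_iff' hQm, ae_iff] at hest
    refine measure_mono_null ?_ hest
    rintro x ⟨hx, hxb⟩
    simp only [mem_ofPred_eq, Classical.not_imp] at hx ⊢
    have hxQ : x ∈ Q := ⟨hx.1, hxb⟩
    refine ⟨hxQ, fun hbd => hx.2 ?_⟩
    set K := (1 + 8 * ((5 + C) * (η : ℝ))) ^ (2 * (N - 1)) with hK
    have hK1 : 1 ≤ K := one_le_pow₀ (by nlinarith)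
    rw [norm_pseudoDerivative hΩ φ (hQΓ hxQ), ← hsg x hx.1.1.1]
    set J := √(1 + ‖g x₀‖ ^ 2) with hJ
    have hJC : J ≤ 1 + C := by
      rw [hJ, Real.sqrt_le_iff]
      have : ‖g x₀‖ ≤ C := hx₀s.2
      exact ⟨by positivity, by nlinarith [norm_nonneg (g x₀)]⟩
    have hJ0 : 0 ≤ J := Real.sqrt_nonneg _
    have hJ' : |J - √(1 + ‖g x‖ ^ 2)| ≤ 2 * η := by
      refine (abs_sqrt_one_add_sq_sub_le _ _).trans ((abs_norm_sub_norm_le _ _).trans ?_)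
      have h1 := hgD x₀ hx₀Q
      have h2 := hgD x hxQ
      rw [norm_sub_rev] at h2
      have := norm_sub_le_norm_sub_add_norm_sub (g x₀) (D k) (g x)
      linarith
    have hγJ : |γ x - J| ≤ (K - 1) * (1 + C) := by
      obtain ⟨h1, h2⟩ := hbd
      change γ x ≤ K * J at h1
      change J ≤ K * γ x at h2
      rw [abs_le]
      constructor
      -- If `γ x < J`, then `J - γ x ≤ (K - 1) γ x ≤ (K - 1) J`; otherwise the bound is trivial.
      · by_cases hle : J ≤ γ x
        · nlinarith
        · push Not at hle
          nlinarith
      · nlinarith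
    calc |γ x - √(1 + ‖g x‖ ^ 2)| ≤ |γ x - J| + |J - √(1 + ‖g x‖ ^ 2)| := abs_sub_le _ _ _
      _ ≤ _ := add_le_add hγJ hJ'
  filter_upwards [haes, ae_all_iff.2 fun k => ae_all_iff.2 (hmain k)] with x hx hx'
  obtain ⟨k, hk⟩ := (TopologicalSpace.denseRange_denseSeq
    (EuclideanSpace ℝ (Fin N))).exists_dist_lt (g x) (ε := η) (by exact_mod_cast hη)
  have hxk : x ∈ sk k := ⟨hx, hk⟩
  obtain ⟨m, hm⟩ := mem_iUnion.1 (hcov k hxk)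
  exact hx' k m ⟨hxk, hm⟩

end SurfaceElement

/-! ### Asymptotics of `γ_ε ν̃_ε` -/

section Asymptotics

variable {N : ℕ} {Ω : Set (EuclideanSpace ℝ (Fin N))}
  {Ωε : ℝ → Set (EuclideanSpace ℝ (Fin N))} {φ : ℝ → EuclideanSpace ℝ (Fin N) → ℝ} {ε₀ : ℝ}

theorem IsRugosePerturbation.eventually_abs_le (h : IsRugosePerturbation Ω Ωε φ ε₀) {c : ℝ}
    (hc : 0 < c) : ∀ᶠ ε in 𝓝[>] (0 : ℝ), ∀ x ∈ frontier Ω, |φ ε x| ≤ c := by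
  obtain ⟨C, hC⟩ := h.bound
  have h1 : ∀ᶠ ε in 𝓝[>] (0 : ℝ), C * ε < c := by
    have : Tendsto (fun ε : ℝ => C * ε) (𝓝[>] 0) (𝓝 0) := by
      have : ContinuousAt (fun ε : ℝ => C * ε) 0 := by fun_prop
      simpa [ContinuousAt] using this.tendsto.mono_left nhdsWithin_le_nhds
    exact this.eventually (gt_mem_nhds hc)
  filter_upwards [hC, h1] with ε h1 h2 x hx
  exact (h1 x hx).trans h2.le

/-- The parallel surfaces at distance `s₁` are compact subsets of `Ω` and of its exterior, so the
approximation conditions apply to them. -/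
theorem IsRugosePerturbation.eventually_sides (h : IsRugosePerturbation Ω Ωε φ ε₀)
    (hΩ : IsC2Domain Ω) {δ : ℝ} {P : EuclideanSpace ℝ (Fin N) → EuclideanSpace ℝ (Fin N)}
    {t : EuclideanSpace ℝ (Fin N) → ℝ} (hT : IsTube Ω δ P t) {s₁ : ℝ} (h0 : 0 < s₁)
    (h1 : s₁ < δ) : ∀ᶠ ε in 𝓝[>] (0 : ℝ),
      (∀ x ∈ frontier Ω, x - s₁ • outerNormal Ω x ∈ Ωε ε) ∧
      ∀ x ∈ frontier Ω, x + s₁ • outerNormal Ω x ∉ Ωε ε := by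
  obtain ⟨L, hL⟩ := hΩ.exists_lipschitzOnWith_outerNormal
  have hc := hL.continuousOn
  have e1 := h.inner_approx _ (hΩ.isCompact_frontier.image_of_continuousOn
    (f := fun x => x - s₁ • outerNormal Ω x) (by fun_prop))
    (by rintro _ ⟨x, hx, rfl⟩; exact hT.inside x hx s₁ h0 h1)
  have e2 := h.outer_approx _ (hΩ.isCompact_frontier.image_of_continuousOn
    (f := fun x => x + s₁ • outerNormal Ω x) (by fun_prop))
    (by rintro _ ⟨x, hx, rfl⟩; exact hT.outside x hx s₁ h0 h1)
  filter_upwards [e1, e2] with ε h1 h2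
  exact ⟨fun x hx => h1 ⟨x, hx, rfl⟩, fun x hx => disjoint_left.1 h2 ⟨x, hx, rfl⟩⟩

theorem IsTube.aestronglyMeasurable_graphGradient {δ : ℝ}
    {P : EuclideanSpace ℝ (Fin N) → EuclideanSpace ℝ (Fin N)}
    {t : EuclideanSpace ℝ (Fin N) → ℝ} (hT : IsTube Ω δ P t) (hN : 1 ≤ N) (hΩ : IsC2Domain Ω)
    {φ : EuclideanSpace ℝ (Fin N) → ℝ} {L : NNReal} (hφL : LipschitzOnWith L φ (frontier Ω))
    (hφ : ∀ x ∈ frontier Ω, |φ x| < δ) :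
    AEStronglyMeasurable
      (fun x => graphGradient P t (graphMap Ω φ x) (tangentialGradient Ω φ x))
      (surfaceMeasure (frontier Ω)) := by
  have hΓm : MeasurableSet (frontier Ω) := isClosed_frontier.measurableSet
  obtain ⟨Lν, hν⟩ := hΩ.exists_lipschitzOnWith_outerNormal
  have hΨ : ContinuousOn (graphMap Ω φ) (frontier Ω) := by
    have h1 := hφL.continuousOn
    have h2 := hν.continuousOn
    unfold graphMap
    fun_prop
  have c : ∀ {F : Type} [NormedAddCommGroup F] [NormedSpace ℝ F]
      (f : EuclideanSpace ℝ (Fin N) → F) x, ContDiffAt ℝ 1 f x → ContinuousAt (fderiv ℝ f) x :=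
    fun f x h => (h.fderiv_right (m := 0) (by norm_num)).continuousAt
  have h1 : AEStronglyMeasurable (fun x => fderiv ℝ t (graphMap Ω φ x))
      (surfaceMeasure (frontier Ω)) :=
    ContinuousOn.aestronglyMeasurable (fun x hx => ContinuousAt.comp_continuousWithinAt
      (c _ _ (hT.contDiffAt_dist x hx _ (hφ x hx))) (hΨ x hx)) hΓm
  have h2 : AEStronglyMeasurable (fun x => fderiv ℝ P (graphMap Ω φ x))
      (surfaceMeasure (frontier Ω)) :=
    ContinuousOn.aestronglyMeasurable (fun x hx => ContinuousAt.comp_continuousWithinAt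
      (c _ _ (hT.contDiffAt_proj x hx _ (hφ x hx))) (hΨ x hx)) hΓm
  have h3 := (hT.aemeasurable_tangentialGradient hN hΩ hφL).aestronglyMeasurable
  have hc : Continuous (fun q : (EuclideanSpace ℝ (Fin N) →L[ℝ] ℝ) ×
      (EuclideanSpace ℝ (Fin N) →L[ℝ] EuclideanSpace ℝ (Fin N)) × EuclideanSpace ℝ (Fin N) =>
      (InnerProductSpace.toDual ℝ (EuclideanSpace ℝ (Fin N))).symm
        (q.1 - (innerSL ℝ q.2.2).comp q.2.1)) := by
    refine (LinearIsometryEquiv.continuous _).comp (continuous_fst.sub ?_)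
    exact ((innerSL ℝ).continuous.comp (continuous_snd.comp continuous_snd)).clm_comp
      (continuous_fst.comp continuous_snd)
  have h4 := hc.comp_aestronglyMeasurable (h1.prodMk (h2.prodMk h3))
  refine h4.congr (Eventually.of_forall fun x => ?_)
  simp only [graphGradient]

/-- For a rugose perturbation, the normal vector `γ_ε ν_ε` is asymptotically `D̂ φ_ε`. -/
theorem IsRugosePerturbation.exists_asymptotics (h : IsRugosePerturbation Ω Ωε φ ε₀)
    (hε₀ : 0 < ε₀) (hN : 1 ≤ N) (hΩ : IsC2Domain Ω) :
    ∃ C : ℝ, (∀ᶠ ε in 𝓝[>] (0 : ℝ),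
        AEStronglyMeasurable (pseudoDerivative Ω (φ ε)) (surfaceMeasure (frontier Ω)) ∧
        ∀ᵐ x ∂(surfaceMeasure (frontier Ω)), ‖pseudoDerivative Ω (φ ε) x‖ ≤ C) ∧
      ∀ θ > 0, ∀ᶠ ε in 𝓝[>] (0 : ℝ),
        AEStronglyMeasurable (fun x =>
          surfaceElement (graphMap Ω (φ ε)) (frontier Ω) (frontier (Ωε ε)) x •
            outerNormal (Ωε ε) (graphMap Ω (φ ε) x)) (surfaceMeasure (frontier Ω)) ∧
        ∀ᵐ x ∂(surfaceMeasure (frontier Ω)),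
          ‖outerNormal (Ωε ε) (graphMap Ω (φ ε) x)‖ = 1 ∧
          ‖surfaceElement (graphMap Ω (φ ε)) (frontier Ω) (frontier (Ωε ε)) x •
            outerNormal (Ωε ε) (graphMap Ω (φ ε) x) - pseudoDerivative Ω (φ ε) x‖ ≤ θ := by
  obtain ⟨C', hC'⟩ := h.bound_deriv
  set C := max C' 0 with hCdef
  have hC0 : 0 ≤ C := le_max_right _ _
  have hC : ∀ᶠ ε in 𝓝[>] (0 : ℝ), ∀ᵐ x ∂(surfaceMeasure (frontier Ω)),
      ‖tangentialGradient Ω (φ ε) x‖ ≤ C :=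
    hC'.mono fun ε hε => hε.mono fun x hx => hx.trans (le_max_left _ _)
  have hΓm : MeasurableSet (frontier Ω) := isClosed_frontier.measurableSet
  obtain ⟨δ, P, t, hT⟩ := hΩ.exists_isTube
  obtain ⟨Lν, hν⟩ := hΩ.exists_lipschitzOnWith_outerNormal
  have hε : ∀ᶠ ε in 𝓝[>] (0 : ℝ), ε ∈ Ioo 0 ε₀ := Ioo_mem_nhdsGT hε₀
  have hνm : AEStronglyMeasurable (outerNormal Ω) (surfaceMeasure (frontier Ω)) :=
    hν.continuousOn.aestronglyMeasurable hΓm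
  refine ⟨1 + C, ?_, fun θ hθ => ?_⟩
  · filter_upwards [hε, hC] with ε hε hC
    obtain ⟨L, hL⟩ := h.lipschitz ε hε
    refine ⟨hνm.sub (hT.aemeasurable_tangentialGradient hN hΩ hL).aestronglyMeasurable, ?_⟩
    filter_upwards [hC, ae_restrict_mem hΓm] with x hx hxΓ
    refine (norm_sub_le _ _).trans ?_
    rw [hΩ.norm_outerNormal hxΓ]
    linarith
  -- The gradient error is at most `1 + C` times this tolerance, that is, `θ / 3`.
  · obtain ⟨r, hr, hnear⟩ := hT.exists_fderiv_near hΩ (θ := θ / (3 * (1 + C))) (by positivity)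
    obtain ⟨η, hη, hη1, hη2⟩ : ∃ η : NNReal, 0 < η ∧ (5 + C) * η ≤ 1 / 8 ∧
        ((1 + 8 * ((5 + C) * (η : ℝ))) ^ (2 * (N - 1)) - 1) * (1 + C) + 2 * η ≤ θ / 3 := by
      have t1 : Tendsto (fun η : ℝ => (5 + C) * η) (𝓝[>] 0) (𝓝 0) := by
        have : ContinuousAt (fun η : ℝ => (5 + C) * η) 0 := by fun_prop
        simpa [ContinuousAt] using this.tendsto.mono_left nhdsWithin_le_nhds
      have t2 : Tendsto (fun η : ℝ => ((1 + 8 * ((5 + C) * η)) ^ (2 * (N - 1)) - 1) * (1 + C) +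
          2 * η) (𝓝[>] 0) (𝓝 0) := by
        have : ContinuousAt (fun η : ℝ => ((1 + 8 * ((5 + C) * η)) ^ (2 * (N - 1)) - 1) *
          (1 + C) + 2 * η) 0 := by fun_prop
        simpa [ContinuousAt] using this.tendsto.mono_left nhdsWithin_le_nhds
      obtain ⟨η, h1, h2, h3⟩ := ((t1.eventually (gt_mem_nhds (by norm_num : (0 : ℝ) < 1 / 8))).and
        ((t2.eventually (gt_mem_nhds (by positivity : 0 < θ / 3))).and
          self_mem_nhdsWithin)).exists
      exact ⟨⟨η, le_of_lt h3⟩, h3, h1.le, h2.le⟩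
    have hη0 : (0 : ℝ) < η := by exact_mod_cast hη
    have hδ := hT.pos
    -- The bound on `|φ ε|`: below `δ / 2` the graph stays in the tube, below `r` the derivatives of
    -- `P` and `t` are close to those on `Γ`, and the last condition controls the rotation of `ν`.
    obtain ⟨b, hb0, hb1, hb2, hb3⟩ : ∃ b : NNReal, 0 < b ∧ (b : ℝ) < δ / 2 ∧ (b : ℝ) < r ∧
        b * Lν ≤ η := by
      have hm : 0 < min (min (δ / 4) (r / 2)) ((η : ℝ) / (Lν + 1)) :=
        lt_min (lt_min (by positivity) (by positivity)) (by positivity)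
      refine ⟨⟨_, hm.le⟩, hm, ?_, ?_, ?_⟩
      · exact ((min_le_left _ _).trans (min_le_left _ _)).trans_lt (by linarith)
      · exact ((min_le_left _ _).trans (min_le_right _ _)).trans_lt (by linarith)
      · rw [← NNReal.coe_le_coe]
        have h1 : min (min (δ / 4) (r / 2)) ((η : ℝ) / (Lν + 1)) * (Lν + 1) ≤ η := by
          rw [← le_div_iff₀ (by positivity)]
          exact min_le_right _ _
        change min (min (δ / 4) (r / 2)) ((η : ℝ) / (Lν + 1)) * Lν ≤ η
        nlinarith
    filter_upwards [hε, hC, h.eventually_abs_le (c := b) (by exact_mod_cast hb0),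
      h.eventually_sides hΩ hT (half_pos hδ) (half_lt_self hδ)] with ε hε hC hφb hside
    obtain ⟨L, hL⟩ := h.lipschitz ε hε
    have hφs : ∀ x ∈ frontier Ω, |φ ε x| < δ / 2 := fun x hx => (hφb x hx).trans_lt hb1
    set n : EuclideanSpace ℝ (Fin N) → EuclideanSpace ℝ (Fin N) := fun x =>
      graphGradient P t (graphMap Ω (φ ε) x) (tangentialGradient Ω (φ ε) x) with hn
    have hnm := hT.aestronglyMeasurable_graphGradient hN hΩ hL fun x hx =>
      (hφs x hx).trans (half_lt_self hδ)
    have hnormal : ∀ᵐ x ∂(surfaceMeasure (frontier Ω)),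
        IsOuterNormalAt (Ωε ε) (graphMap Ω (φ ε) x) (‖n x‖⁻¹ • n x) := by
      filter_upwards [hΩ.ae_differentiableWithinAt hN hL, ae_restrict_mem hΓm] with x hd hx
      exact hT.isOuterNormalAt_graph (h.isOpen ε hε) (h.bijOn ε hε) (half_lt_self hδ) hφs hside.1
        hside.2 hx (hT.hasFDerivWithinAt_of_comp_proj hx (hT.hasFDerivAt_comp_proj hΩ hx hd))
    have hγ := hT.abs_surfaceElement_sub_le hN hΩ hL hν (h.bijOn ε hε) hC0 hη hη1 hφb hb3 hC
    refine ⟨?_, ?_⟩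
    · have hγm : AEStronglyMeasurable
          (surfaceElement (graphMap Ω (φ ε)) (frontier Ω) (frontier (Ωε ε)))
          (surfaceMeasure (frontier Ω)) :=
        (Measure.measurable_rnDeriv _ _).ennreal_toReal.aestronglyMeasurable
      have h1 : AEStronglyMeasurable (fun x => ‖n x‖⁻¹ • n x) (surfaceMeasure (frontier Ω)) :=
        (hnm.norm.aemeasurable.inv.aestronglyMeasurable).smul hnm
      refine hγm.smul (h1.congr ?_)
      filter_upwards [hnormal] with x hx
      exact hx.outerNormal_eq.symm
    · filter_upwards [hnormal, hγ, hC, ae_restrict_mem hΓm] with x h1 h2 h3 hx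
      have hdist : dist (graphMap Ω (φ ε) x) x < r := by
        rw [dist_eq_norm, graphMap, add_sub_cancel_left, norm_smul, hΩ.norm_outerNormal hx, mul_one]
        exact (hφb x hx).trans_lt hb2
      obtain ⟨e1, e2⟩ := hnear x hx _ hdist
      have h4 : ‖n x - pseudoDerivative Ω (φ ε) x‖ ≤ θ / 3 := by
        refine (hT.norm_graphGradient_sub_le hx (inner_tangentialGradient _ x)).trans ?_
        have : ‖tangentialGradient Ω (φ ε) x‖ *
            ‖fderiv ℝ P (graphMap Ω (φ ε) x) - fderiv ℝ P x‖ ≤ C * (θ / (3 * (1 + C))) := by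
          gcongr
        calc _ ≤ θ / (3 * (1 + C)) + C * (θ / (3 * (1 + C))) := add_le_add e1.le this
          _ = θ / 3 := by field_simp
      rw [h1.outerNormal_eq]
      refine ⟨h1.1, ?_⟩
      set γ := surfaceElement (graphMap Ω (φ ε)) (frontier Ω) (frontier (Ωε ε)) x
      set v := pseudoDerivative Ω (φ ε) x
      have hn0 : ‖n x‖ ≠ 0 := by
        intro h0
        have := h1.1
        rw [h0, inv_zero, zero_smul, norm_zero] at this
        exact zero_ne_one this
      -- Three errors of size `θ / 3`: surface element against `‖v‖`, `‖v‖` against `‖n x‖`, and the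
      -- vector `n x` against `v`.
      have e : γ • ‖n x‖⁻¹ • n x - v =
          (γ - ‖v‖) • ‖n x‖⁻¹ • n x + (‖v‖ - ‖n x‖) • ‖n x‖⁻¹ • n x + (n x - v) := by
        rw [sub_smul, sub_smul, smul_inv_smul₀ hn0]
        abel
      rw [e]
      refine (norm_add₃_le).trans ?_
      rw [norm_smul, norm_smul (‖v‖ - ‖n x‖), h1.1, mul_one, mul_one, Real.norm_eq_abs,
        Real.norm_eq_abs]
      have h5 := abs_norm_sub_norm_le v (n x)
      rw [norm_sub_rev] at h5
      linarith

end Asymptotics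

/-! ### Support of the Young measure -/

section YoungMeasure

variable {N : ℕ}

/-- The continuous function `v ↦ max 0 (min 1 (R + 1 - ‖v‖)) * H v`, which equals `H` on the ball of
radius `R` and has compact support. -/
def cutoffMul (R : ℝ) (H : C(EuclideanSpace ℝ (Fin N), ℝ)) : C₀(EuclideanSpace ℝ (Fin N), ℝ) where
  toFun v := max 0 (min 1 (R + 1 - ‖v‖)) * H v
  continuous_toFun := by fun_prop
  zero_at_infty' := by
    refine HasCompactSupport.is_zero_at_infty ?_
    refine HasCompactSupport.mul_right ?_
    refine HasCompactSupport.of_support_subset_isCompact (isCompact_closedBall 0 (R + 1)) ?_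
    intro v hv
    rw [mem_closedBall_zero_iff]
    by_contra hlt
    rw [not_le] at hlt
    refine hv (max_eq_left ?_)
    exact (min_le_right _ _).trans (by linarith)

theorem cutoffMul_apply (R : ℝ) (H : C(EuclideanSpace ℝ (Fin N), ℝ))
    (v : EuclideanSpace ℝ (Fin N)) :
    cutoffMul R H v = max 0 (min 1 (R + 1 - ‖v‖)) * H v := rfl

theorem cutoffMul_of_norm_le {R : ℝ} (H : C(EuclideanSpace ℝ (Fin N), ℝ))
    {v : EuclideanSpace ℝ (Fin N)} (hv : ‖v‖ ≤ R) : cutoffMul R H v = H v := by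
  rw [cutoffMul_apply, min_eq_left (by linarith), max_eq_right zero_le_one, one_mul]

theorem norm_zeroAtInfty_apply_le (F : C₀(EuclideanSpace ℝ (Fin N), ℝ))
    (v : EuclideanSpace ℝ (Fin N)) : ‖F v‖ ≤ ‖F‖ := by
  rw [← ZeroAtInftyContinuousMap.norm_toBCF_eq_norm]
  exact F.toBCF.norm_coe_le_norm v

variable {σ : Measure (EuclideanSpace ℝ (Fin N))}
  {f : ℝ → EuclideanSpace ℝ (Fin N) → EuclideanSpace ℝ (Fin N)}
  {μ : EuclideanSpace ℝ (Fin N) → Measure (EuclideanSpace ℝ (Fin N))}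

/-- Almost everywhere `μ` agrees with a measurable kernel, for which this is standard. -/
theorem GeneratesYoungMeasure.aestronglyMeasurable_integral (hμ : GeneratesYoungMeasure σ f μ)
    {W : Type*} [NormedAddCommGroup W] [NormedSpace ℝ W] {H : EuclideanSpace ℝ (Fin N) → W}
    (hH : StronglyMeasurable H) : AEStronglyMeasurable (fun x => ∫ v, H v ∂(μ x)) σ := by
  let κ : ProbabilityTheory.Kernel (EuclideanSpace ℝ (Fin N)) (EuclideanSpace ℝ (Fin N)) :=
    ⟨hμ.aemeasurable.mk μ, hμ.aemeasurable.measurable_mk⟩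
  refine ⟨fun x => ∫ v, H v ∂(κ x), hH.integral_kernel, ?_⟩
  filter_upwards [hμ.aemeasurable.ae_eq_mk] with x hx
  rw [hx]; rfl

theorem norm_integral_le_of_mass_le_one {X : Type*} [MeasurableSpace X] {m : Measure X}
    (hm : m univ ≤ 1) {W : Type*} [NormedAddCommGroup W]
    [NormedSpace ℝ W] {H : X → W} {M : ℝ} (hM0 : 0 ≤ M)
    (hM : ∀ᵐ v ∂m, ‖H v‖ ≤ M) : ‖∫ v, H v ∂m‖ ≤ M := by
  have : IsFiniteMeasure m := ⟨hm.trans_lt ENNReal.one_lt_top⟩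
  refine (norm_integral_le_of_norm_le_const hM).trans (mul_le_of_le_one_right hM0 ?_)
  exact ENNReal.toReal_le_of_le_ofReal zero_le_one (by simpa using hm)

/-- A non-negative finite sum of products that vanishes along the generating sequence vanishes
almost everywhere for the Young measure. -/
theorem GeneratesYoungMeasure.ae_ae_eq_zero [IsFiniteMeasure σ] (hμ : GeneratesYoungMeasure σ f μ)
    (hf : ∀ᶠ ε in 𝓝[>] (0 : ℝ), AEStronglyMeasurable (f ε) σ) {ι : Type*} [Fintype ι]
    {g : ι → EuclideanSpace ℝ (Fin N) → ℝ} (hg : ∀ k, Integrable (g k) σ)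
    (F : ι → C₀(EuclideanSpace ℝ (Fin N), ℝ)) (h0 : ∀ x v, 0 ≤ ∑ k, g k x * F k v)
    (hz : ∀ᶠ ε in 𝓝[>] (0 : ℝ), ∀ᵐ x ∂σ, ∑ k, g k x * F k (f ε x) = 0) :
    ∀ᵐ x ∂σ, ∀ᵐ v ∂(μ x), ∑ k, g k x * F k v = 0 := by
  -- Only products of a function of `x` and one of `v` may be tested, so the limit is taken term by
  -- term.
  have hlim : Tendsto (fun ε => ∑ k, ∫ x, g k x * F k (f ε x) ∂σ) (𝓝[>] (0 : ℝ))
      (𝓝 (∑ k, ∫ x, g k x * ∫ v, F k v ∂(μ x) ∂σ)) :=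
    tendsto_finsetSum _ fun k _ => hμ.tendsto (F k) (g k) (hg k)
  have hev : ∀ᶠ ε in 𝓝[>] (0 : ℝ), ∑ k, ∫ x, g k x * F k (f ε x) ∂σ = 0 := by
    filter_upwards [hf, hz] with ε hε hzε
    rw [← integral_finsetSum]
    · exact integral_eq_zero_of_ae hzε
    · intro k _
      exact (hg k).mul_bdd (c := ‖F k‖) ((F k).continuous.comp_aestronglyMeasurable hε)
        (Eventually.of_forall fun x => norm_zeroAtInfty_apply_le _ _)
  have hlim0 := tendsto_nhds_unique hlim ((tendsto_congr' hev).2 tendsto_const_nhds)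
  have hint : ∀ k, Integrable (fun x => g k x * ∫ v, F k v ∂(μ x)) σ := fun k =>
    (hg k).mul_bdd (c := ‖F k‖)
      (hμ.aestronglyMeasurable_integral (F k).continuous.stronglyMeasurable)
      (hμ.mass_le_one.mono fun x hx => norm_integral_le_of_mass_le_one hx (norm_nonneg _)
        (Eventually.of_forall fun v => norm_zeroAtInfty_apply_le _ _))
  rw [← integral_finsetSum _ fun k _ => hint k] at hlim0
  have hin : ∀ᵐ x ∂σ, (∀ k, Integrable (fun v => g k x * F k v) (μ x)) ∧
      ∑ k, g k x * ∫ v, F k v ∂(μ x) = ∫ v, ∑ k, g k x * F k v ∂(μ x) := by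
    filter_upwards [hμ.mass_le_one] with x hx
    have : IsFiniteMeasure (μ x) := ⟨hx.trans_lt ENNReal.one_lt_top⟩
    have hi : ∀ k, Integrable (fun v => g k x * F k v) (μ x) := fun k =>
      (Integrable.of_bound (F k).continuous.aestronglyMeasurable ‖F k‖
        (Eventually.of_forall fun v => norm_zeroAtInfty_apply_le _ _)).const_mul _
    refine ⟨hi, ?_⟩
    rw [integral_finsetSum _ fun k _ => hi k]
    exact Finset.sum_congr rfl fun k _ => (integral_const_mul _ _).symm
  have hnn : 0 ≤ᵐ[σ] fun x => ∑ k, g k x * ∫ v, F k v ∂(μ x) := by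
    filter_upwards [hin] with x hx
    rw [hx.2]
    exact integral_nonneg (h0 x)
  have hzero := (integral_eq_zero_iff_of_nonneg_ae hnn
    (integrable_finsetSum _ fun k _ => hint k)).1 hlim0
  filter_upwards [hin, hzero] with x hx hx0
  rw [hx.2] at hx0
  exact (integral_eq_zero_iff_of_nonneg (h0 x) (integrable_finsetSum _ fun k _ => hx.1 k)).1 hx0

/-- The test function is the positive part of `‖v‖ - R`, cut off at radius `j`; the integers `j`
exhaust the space. -/
theorem GeneratesYoungMeasure.ae_ae_norm_le [IsFiniteMeasure σ] (hμ : GeneratesYoungMeasure σ f μ)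
    (hf : ∀ᶠ ε in 𝓝[>] (0 : ℝ), AEStronglyMeasurable (f ε) σ) {R : ℝ}
    (hR : ∀ᶠ ε in 𝓝[>] (0 : ℝ), ∀ᵐ x ∂σ, ‖f ε x‖ ≤ R) :
    ∀ᵐ x ∂σ, ∀ᵐ v ∂(μ x), ‖v‖ ≤ R := by
  have key : ∀ j : ℕ, ∀ᵐ x ∂σ, ∀ᵐ v ∂(μ x), ‖v‖ ≤ j → ‖v‖ ≤ R := by
    intro j
    set H : C(EuclideanSpace ℝ (Fin N), ℝ) := ⟨fun v => max 0 (‖v‖ - R), by fun_prop⟩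
    have := hμ.ae_ae_eq_zero hf (ι := Unit) (g := fun _ _ => 1) (fun _ => integrable_const _)
      (fun _ => cutoffMul j H) (fun x v => by
        simp only [Finset.univ_unique, Finset.sum_const, Finset.card_singleton, one_smul, one_mul,
          cutoffMul_apply]
        exact mul_nonneg (le_max_left _ _) (le_max_left _ _))
      (by
        filter_upwards [hR] with ε hε
        filter_upwards [hε] with x hx
        have : H (f ε x) = 0 := max_eq_left (by linarith)
        simp [cutoffMul_apply, this])
    filter_upwards [this] with x hx
    filter_upwards [hx] with v hv hvj
    simp only [Finset.univ_unique, Finset.sum_const, Finset.card_singleton, one_smul, one_mul] at hv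
    rw [cutoffMul_of_norm_le H hvj] at hv
    have h1 : ‖v‖ - R ≤ H v := le_max_right _ _
    linarith
  filter_upwards [ae_all_iff.2 key] with x hx
  filter_upwards [ae_all_iff.2 hx] with v hv
  obtain ⟨j, hj⟩ := exists_nat_ge ‖v‖
  exact hv j hj

/-- The test function is `(⟪v, n x⟫ - 1)²`, cut off. It depends on `x`, but as a polynomial in the
coordinates of `v` and of `n x` it is a finite sum of products. -/
theorem GeneratesYoungMeasure.ae_ae_inner_eq_one [IsFiniteMeasure σ]
    (hμ : GeneratesYoungMeasure σ f μ)
    (hf : ∀ᶠ ε in 𝓝[>] (0 : ℝ), AEStronglyMeasurable (f ε) σ)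
    {n : EuclideanSpace ℝ (Fin N) → EuclideanSpace ℝ (Fin N)} (hn : AEStronglyMeasurable n σ)
    (hn1 : ∀ᵐ x ∂σ, ‖n x‖ ≤ 1)
    (h1 : ∀ᶠ ε in 𝓝[>] (0 : ℝ), ∀ᵐ x ∂σ, ⟪f ε x, n x⟫_ℝ = 1) :
    ∀ᵐ x ∂σ, ∀ᵐ v ∂(μ x), ⟪v, n x⟫_ℝ = 1 := by
  -- The index `none` carries the constant `-1`, the index `some i` the `i`-th coordinate.
  set c : Option (Fin N) → EuclideanSpace ℝ (Fin N) → ℝ := fun k x => k.elim (-1) fun i => n x i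
  set b : Option (Fin N) → C(EuclideanSpace ℝ (Fin N), ℝ) := fun k =>
    k.elim 1 fun i => ⟨fun v => v i, by fun_prop⟩
  have hcb : ∀ x v, ∑ k, c k x * b k v = ⟪v, n x⟫_ℝ - 1 := by
    intro x v
    rw [Fintype.sum_option, PiLp.inner_apply]
    simp [c, b]
    ring
  have hcm : ∀ k, AEStronglyMeasurable (c k) σ := by
    rintro (_ | i)
    · exact aestronglyMeasurable_const
    · exact (by fun_prop : Continuous fun v : EuclideanSpace ℝ (Fin N) =>
        v i).comp_aestronglyMeasurable hn
  have hc1 : ∀ k, ∀ᵐ x ∂σ, ‖c k x‖ ≤ 1 := by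
    rintro (_ | i)
    · simp [c]
    · filter_upwards [hn1] with x hx
      exact (PiLp.norm_apply_le (n x) i).trans hx
  have hci : ∀ k, Integrable (c k) σ := fun k => Integrable.of_bound (hcm k) 1 (hc1 k)
  have hsq : ∀ (j : ℕ) x v, ∑ q : Option (Fin N) × Option (Fin N),
      (c q.1 x * c q.2 x) * cutoffMul j (b q.1 * b q.2) v =
        max 0 (min 1 ((j : ℝ) + 1 - ‖v‖)) * (⟪v, n x⟫_ℝ - 1) ^ 2 := by
    intro j x v
    rw [← hcb, sq, Finset.sum_mul_sum, Fintype.sum_prod_type, Finset.mul_sum]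
    refine Finset.sum_congr rfl fun k _ => ?_
    rw [Finset.mul_sum]
    refine Finset.sum_congr rfl fun l _ => ?_
    rw [cutoffMul_apply, ContinuousMap.mul_apply]
    ring
  have key : ∀ j : ℕ, ∀ᵐ x ∂σ, ∀ᵐ v ∂(μ x), ‖v‖ ≤ j → ⟪v, n x⟫_ℝ = 1 := by
    intro j
    have := hμ.ae_ae_eq_zero hf (ι := Option (Fin N) × Option (Fin N))
      (g := fun q x => c q.1 x * c q.2 x)
      (fun q => (hci q.1).mul_bdd (hcm q.2) (hc1 q.2))
      (fun q => cutoffMul j (b q.1 * b q.2)) (fun x v => by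
        rw [hsq]
        exact mul_nonneg (le_max_left _ _) (sq_nonneg _))
      (by
        filter_upwards [h1] with ε hε
        filter_upwards [hε] with x hx
        rw [hsq, hx]
        simp)
    filter_upwards [this] with x hx
    filter_upwards [hx] with v hv hvj
    rw [hsq, min_eq_left (by linarith), max_eq_right zero_le_one, one_mul] at hv
    have := pow_eq_zero_iff (two_ne_zero) |>.1 hv
    linarith
  filter_upwards [ae_all_iff.2 key] with x hx
  filter_upwards [ae_all_iff.2 hx] with v hv
  obtain ⟨j, hj⟩ := exists_nat_ge ‖v‖
  exact hv j hj

end YoungMeasure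

/-! ### Weak-* convergence of homogeneous functions -/

section WeakStar

variable {N : ℕ} {σ : Measure (EuclideanSpace ℝ (Fin N))}
  {f v : ℝ → EuclideanSpace ℝ (Fin N) → EuclideanSpace ℝ (Fin N)}
  {μ : EuclideanSpace ℝ (Fin N) → Measure (EuclideanSpace ℝ (Fin N))}

/-- In a finite-dimensional space, integrals converge if they do so after applying continuous linear
functionals. -/
theorem tendsto_integral_of_forall_dual {X ι : Type*} [MeasurableSpace X] {σ : Measure X}
    {W : Type*} [NormedAddCommGroup W] [NormedSpace ℝ W] [FiniteDimensional ℝ W] {l : Filter ι}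
    {F : ι → X → W} {F₀ : X → W} (hF : ∀ᶠ i in l, Integrable (F i) σ) (hF₀ : Integrable F₀ σ)
    (h : ∀ β : W →L[ℝ] ℝ, Tendsto (fun i => ∫ x, β (F i x) ∂σ) l (𝓝 (∫ x, β (F₀ x) ∂σ))) :
    Tendsto (fun i => ∫ x, F i x ∂σ) l (𝓝 (∫ x, F₀ x ∂σ)) := by
  have : CompleteSpace W := FiniteDimensional.complete ℝ W
  set e := (Module.finBasis ℝ W).equivFunL with he
  have h1 : Tendsto (fun i => e (∫ x, F i x ∂σ)) l (𝓝 (e (∫ x, F₀ x ∂σ))) := by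
    rw [tendsto_pi_nhds]
    intro k
    set β : W →L[ℝ] ℝ := (ContinuousLinearMap.proj (R := ℝ) (φ := fun _ => ℝ) k).comp
      (e : W →L[ℝ] (Fin (Module.finrank ℝ W) → ℝ)) with hβ
    have h2 := h β
    rw [β.integral_comp_comm hF₀] at h2
    refine h2.congr' ?_
    filter_upwards [hF] with i hi
    rw [β.integral_comp_comm hi]
    rfl
  have h3 := (e.symm.continuous.tendsto _).comp h1
  simpa [Function.comp_def] using h3

/-- Cutting `H` off outside the ball of radius `R` changes neither side, because both the fields and
the measures `μ x` live in that ball. Hence decay of `H` is not needed. -/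
theorem GeneratesYoungMeasure.tendsto_integral_smul [IsFiniteMeasure σ]
    (hμ : GeneratesYoungMeasure σ f μ)
    (hf : ∀ᶠ ε in 𝓝[>] (0 : ℝ), AEStronglyMeasurable (f ε) σ) {R : ℝ}
    (hR : ∀ᶠ ε in 𝓝[>] (0 : ℝ), ∀ᵐ x ∂σ, ‖f ε x‖ ≤ R)
    {W : Type*} [NormedAddCommGroup W] [NormedSpace ℝ W] [FiniteDimensional ℝ W]
    {H : EuclideanSpace ℝ (Fin N) → W} (hH : Continuous H) {M : ℝ} (hM0 : 0 ≤ M)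
    (hM : ∀ v, ‖v‖ ≤ R → ‖H v‖ ≤ M) {g : EuclideanSpace ℝ (Fin N) → ℝ} (hg : Integrable g σ) :
    Tendsto (fun ε => ∫ x, g x • H (f ε x) ∂σ) (𝓝[>] (0 : ℝ))
      (𝓝 (∫ x, g x • ∫ v, H v ∂(μ x) ∂σ)) := by
  have : CompleteSpace W := FiniteDimensional.complete ℝ W
  have hsupp := hμ.ae_ae_norm_le hf hR
  refine tendsto_integral_of_forall_dual ?_ ?_ fun β => ?_
  · filter_upwards [hf, hR] with ε hε hRε
    exact hg.smul_bdd M (hH.comp_aestronglyMeasurable hε) (hRε.mono fun x hx => hM _ hx)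
  · refine hg.smul_bdd M (hμ.aestronglyMeasurable_integral hH.stronglyMeasurable) ?_
    filter_upwards [hμ.mass_le_one, hsupp] with x hx hxs
    exact norm_integral_le_of_mass_le_one hx hM0 (hxs.mono fun v hv => hM v hv)
  · set F := cutoffMul R ⟨fun v => β (H v), by fun_prop⟩ with hF
    have hFv : ∀ v, ‖v‖ ≤ R → F v = β (H v) := fun v hv => cutoffMul_of_norm_le _ hv
    have h1 := hμ.tendsto F g hg
    have e : ∫ x, g x * ∫ v, F v ∂(μ x) ∂σ = ∫ x, β (g x • ∫ v, H v ∂(μ x)) ∂σ := by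
      refine integral_congr_ae ?_
      filter_upwards [hμ.mass_le_one, hsupp] with x hx hxs
      have : IsFiniteMeasure (μ x) := ⟨hx.trans_lt ENNReal.one_lt_top⟩
      rw [map_smul, smul_eq_mul, ← β.integral_comp_comm (Integrable.of_bound
        hH.aestronglyMeasurable M (hxs.mono fun v hv => hM v hv))]
      congr 1
      exact integral_congr_ae (hxs.mono fun v hv => hFv v hv)
    rw [e] at h1
    refine h1.congr' ?_
    filter_upwards [hR] with ε hε
    refine integral_congr_ae ?_
    filter_upwards [hε] with x hx
    rw [hFv _ hx, map_smul, smul_eq_mul]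

/-- Weak-* convergence of continuous functions of fields that are uniformly close to a field
generating a Young measure. -/
theorem GeneratesYoungMeasure.tendstoWeakStarLinfty [IsFiniteMeasure σ]
    (hμ : GeneratesYoungMeasure σ f μ)
    (hf : ∀ᶠ ε in 𝓝[>] (0 : ℝ), AEStronglyMeasurable (f ε) σ) {R : ℝ}
    (hR : ∀ᶠ ε in 𝓝[>] (0 : ℝ), ∀ᵐ x ∂σ, ‖f ε x‖ ≤ R)
    (hv : ∀ᶠ ε in 𝓝[>] (0 : ℝ), AEStronglyMeasurable (v ε) σ)
    (hvf : ∀ θ > 0, ∀ᶠ ε in 𝓝[>] (0 : ℝ), ∀ᵐ x ∂σ, ‖v ε x - f ε x‖ ≤ θ)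
    {W : Type*} [NormedAddCommGroup W] [NormedSpace ℝ W] [FiniteDimensional ℝ W]
    {H : EuclideanSpace ℝ (Fin N) → W} (hH : Continuous H) :
    TendstoWeakStarLinfty σ (fun ε x => H (v ε x)) (fun x => ∫ v, H v ∂(μ x)) := by
  -- The larger radius leaves room for `v ε`, which is eventually within distance one of `f ε`.
  have hK : IsCompact (Metric.closedBall (0 : EuclideanSpace ℝ (Fin N)) (R + 1)) :=
    isCompact_closedBall _ _
  obtain ⟨M', hM'⟩ := hK.exists_bound_of_continuousOn hH.continuousOn
  set M := max M' 0
  have hM0 : 0 ≤ M := le_max_right _ _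
  have hM : ∀ v, ‖v‖ ≤ R + 1 → ‖H v‖ ≤ M := fun v hv =>
    (hM' v (mem_closedBall_zero_iff.2 hv)).trans (le_max_left _ _)
  have hsupp := hμ.ae_ae_norm_le hf hR
  have hv1 : ∀ᶠ ε in 𝓝[>] (0 : ℝ), ∀ᵐ x ∂σ, ‖v ε x‖ ≤ R + 1 := by
    filter_upwards [hvf 1 one_pos, hR] with ε h1 h2
    filter_upwards [h1, h2] with x h1 h2
    have := norm_le_norm_add_norm_sub' (v ε x) (f ε x)
    linarith
  refine ⟨?_, ?_, fun g hg => ?_⟩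
  · filter_upwards [hv, hv1] with ε hε hε1
    exact memLp_top_of_bound (hH.comp_aestronglyMeasurable hε) M (hε1.mono fun x hx => hM _ hx)
  · refine memLp_top_of_bound (hμ.aestronglyMeasurable_integral hH.stronglyMeasurable) M ?_
    filter_upwards [hμ.mass_le_one, hsupp] with x hx hxs
    exact norm_integral_le_of_mass_le_one hx hM0 (hxs.mono fun v hv => hM v (by linarith))
  · have h1 := hμ.tendsto_integral_smul hf hR hH hM0 (fun v hv => hM v (by linarith)) hg
    -- Uniform closeness of the fields survives the nonlinear `H` through its uniform continuity on
    -- the ball.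
    have h2 : Tendsto (fun ε => ∫ x, g x • H (v ε x) ∂σ - ∫ x, g x • H (f ε x) ∂σ)
        (𝓝[>] (0 : ℝ)) (𝓝 0) := by
      rw [Metric.tendsto_nhds]
      intro θ hθ
      set I := ∫ x, ‖g x‖ ∂σ with hI
      have hI0 : 0 ≤ I := integral_nonneg fun x => norm_nonneg _
      have huc := hK.uniformContinuousOn_of_continuous hH.continuousOn
      obtain ⟨δ, hδ, hδ'⟩ := Metric.uniformContinuousOn_iff.1 huc (θ / (I + 1)) (by positivity)
      filter_upwards [hf, hv, hR, hv1, hvf (δ / 2) (by positivity)] with ε h1 h2 h3 h4 h5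
      have i1 : Integrable (fun x => g x • H (v ε x)) σ :=
        hg.smul_bdd M (hH.comp_aestronglyMeasurable h2) (h4.mono fun x hx => hM _ hx)
      have i2 : Integrable (fun x => g x • H (f ε x)) σ :=
        hg.smul_bdd M (hH.comp_aestronglyMeasurable h1)
          (h3.mono fun x hx => hM _ (by linarith))
      rw [← integral_sub i1 i2, dist_zero_right]
      have h6 : ‖∫ x, (g x • H (v ε x) - g x • H (f ε x)) ∂σ‖ ≤
          ∫ x, ‖g x‖ * (θ / (I + 1)) ∂σ := by
        refine norm_integral_le_of_norm_le (hg.norm.mul_const _) ?_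
        filter_upwards [h3, h4, h5] with x h3 h4 h5
        rw [← smul_sub, norm_smul]
        gcongr
        rw [← dist_eq_norm]
        refine (hδ' _ (mem_closedBall_zero_iff.2 h4) _ (mem_closedBall_zero_iff.2 (by linarith))
          ?_).le
        rw [dist_eq_norm]
        linarith
      rw [integral_mul_const] at h6
      refine h6.trans_lt ?_
      rw [← hI, mul_div_assoc', div_lt_iff₀ (by positivity)]
      nlinarith
    have h3 := h2.add h1
    simpa using h3

theorem TendstoWeakStarLinfty.congr {X W : Type*} [MeasurableSpace X] [NormedAddCommGroup W]
    [NormedSpace ℝ W] {σ : Measure X} {f f' : ℝ → X → W} {f₀ f₀' : X → W}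
    (h : TendstoWeakStarLinfty σ f f₀) (hf : ∀ᶠ ε in 𝓝[>] (0 : ℝ), f ε =ᵐ[σ] f' ε)
    (hf₀ : f₀ =ᵐ[σ] f₀') : TendstoWeakStarLinfty σ f' f₀' := by
  obtain ⟨h1, h2, h3⟩ := h
  refine ⟨?_, (memLp_congr_ae hf₀).1 h2, fun g hg => ?_⟩
  · filter_upwards [h1, hf] with ε h1 hf
    exact (memLp_congr_ae hf).1 h1
  · have e : ∫ x, g x • f₀' x ∂σ = ∫ x, g x • f₀ x ∂σ :=
      integral_congr_ae (hf₀.mono fun x hx => by simp only [hx])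
    rw [e]
    refine (h3 g hg).congr' ?_
    filter_upwards [hf] with ε hf
    exact integral_congr_ae (hf.mono fun x hx => by simp only [hx])

/-- Weak-* convergence in finite dimensions may be tested with integrable families of linear
functionals. -/
theorem TendstoWeakStarLinfty.tendsto_integral_dual {X W : Type*} [MeasurableSpace X]
    [NormedAddCommGroup W] [NormedSpace ℝ W] [FiniteDimensional ℝ W] {σ : Measure X}
    {f : ℝ → X → W} {f₀ : X → W} (h : TendstoWeakStarLinfty σ f f₀) (G : X → W →ₗ[ℝ] ℝ)
    (hG : ∀ A, Integrable (fun x => G x A) σ) :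
    (∀ᶠ ε in 𝓝[>] (0 : ℝ), Integrable (fun x => G x (f ε x)) σ) ∧
    Integrable (fun x => G x (f₀ x)) σ ∧
    Tendsto (fun ε => ∫ x, G x (f ε x) ∂σ) (𝓝[>] (0 : ℝ)) (𝓝 (∫ x, G x (f₀ x) ∂σ)) := by
  have : CompleteSpace W := FiniteDimensional.complete ℝ W
  set b := Module.finBasis ℝ W with hb
  set β : Fin (Module.finrank ℝ W) → W →L[ℝ] ℝ := fun k =>
    (ContinuousLinearMap.proj (R := ℝ) (φ := fun _ => ℝ) k).comp
      (b.equivFunL : W →L[ℝ] (Fin (Module.finrank ℝ W) → ℝ)) with hβ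
  -- Expansion of `A` in a basis: the functional becomes finitely many scalar weights `G x (b k)`,
  -- each a legitimate test function.
  have hexp : ∀ x A, G x A = ∑ k, β k (G x (b k) • A) := by
    intro x A
    conv_lhs => rw [← b.sum_equivFun A]
    rw [map_sum]
    refine Finset.sum_congr rfl fun k _ => ?_
    rw [map_smul, map_smul, smul_eq_mul, smul_eq_mul, mul_comm]
    rfl
  have hint : ∀ u : X → W, MemLp u ⊤ σ → ∀ k, Integrable (fun x => G x (b k) • u x) σ :=
    fun u hu k => Integrable.smul_of_top_left (hG (b k)) hu
  have hval : ∀ u : X → W, MemLp u ⊤ σ →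
      ∫ x, G x (u x) ∂σ = ∑ k, β k (∫ x, G x (b k) • u x ∂σ) := by
    intro u hu
    simp_rw [hexp _ (u _)]
    rw [integral_finsetSum _ fun k _ => (β k).integrable_comp (hint u hu k)]
    exact Finset.sum_congr rfl fun k _ => (β k).integral_comp_comm (hint u hu k)
  have hI : ∀ u : X → W, MemLp u ⊤ σ → Integrable (fun x => G x (u x)) σ := by
    intro u hu
    simp_rw [hexp _ (u _)]
    exact integrable_finsetSum _ fun k _ => (β k).integrable_comp (hint u hu k)
  refine ⟨h.1.mono fun ε hε => hI _ hε, hI _ h.2.1, ?_⟩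
  rw [hval _ h.2.1]
  have h1 : Tendsto (fun ε => ∑ k, β k (∫ x, G x (b k) • f ε x ∂σ)) (𝓝[>] (0 : ℝ))
      (𝓝 (∑ k, β k (∫ x, G x (b k) • f₀ x ∂σ))) :=
    tendsto_finsetSum _ fun k _ => ((β k).continuous.tendsto _).comp (h.2.2 _ (hG (b k)))
  refine h1.congr' ?_
  filter_upwards [h.1] with ε hε
  exact (hval _ hε).symm

/-- The positively homogeneous extension of a continuous function on the sphere is continuous. -/
theorem continuous_norm_smul_comp_normalize {E W : Type*} [NormedAddCommGroup E]
    [NormedSpace ℝ E] [FiniteDimensional ℝ E] [NormedAddCommGroup W] [NormedSpace ℝ W] {b : E → W}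
    (hb : ContinuousOn b (Metric.sphere 0 1)) :
    Continuous fun v : E => ‖v‖ • b (‖v‖⁻¹ • v) := by
  have : ProperSpace E := FiniteDimensional.proper ℝ E
  have hmem : ∀ v : E, v ≠ 0 → ‖v‖⁻¹ • v ∈ Metric.sphere (0 : E) 1 := fun v hv => by
    rw [mem_sphere_zero_iff_norm, norm_smul, norm_inv, norm_norm,
      inv_mul_cancel₀ (norm_ne_zero_iff.2 hv)]
  rw [continuous_iff_continuousAt]
  intro v
  by_cases hv : v = 0
  -- At the origin boundedness of `b` on the sphere suffices, thanks to the factor `‖v‖`.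
  · subst hv
    obtain ⟨M, hM⟩ := (isCompact_sphere (0 : E) 1).exists_bound_of_continuousOn hb
    have h1 : Tendsto (fun v : E => ‖v‖ * M) (𝓝 0) (𝓝 0) := by
      have : Continuous fun v : E => ‖v‖ * M := by fun_prop
      simpa using this.tendsto 0
    simp only [ContinuousAt, norm_zero, zero_smul]
    refine squeeze_zero_norm (fun v => ?_) h1
    by_cases hv : v = 0
    · simp [hv]
    · rw [norm_smul, norm_norm]
      gcongr
      exact hM _ (hmem v hv)
  · have hc : ContinuousOn (fun v : E => b (‖v‖⁻¹ • v)) {0}ᶜ := by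
      refine hb.comp (f := fun v : E => ‖v‖⁻¹ • v) (fun v hv => ?_) fun v hv => hmem v hv
      exact ((continuousAt_id.norm.inv₀ (norm_ne_zero_iff.2 hv)).smul
        continuousAt_id).continuousWithinAt
    exact continuousAt_id.norm.smul (hc.continuousAt (isOpen_compl_singleton.mem_nhds hv))

end WeakStar

/-! ### Homogenised polynomial energies -/

section Homogenisation

theorem finiteDimensional_continuousMultilinearMap {V : Type*} [NormedAddCommGroup V]
    [NormedSpace ℝ V] [FiniteDimensional ℝ V] (i : ℕ) :
    FiniteDimensional ℝ (ContinuousMultilinearMap ℝ (fun _ : Fin i => V) ℝ) :=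
  Module.Finite.of_injective
    (ContinuousMultilinearMap.toMultilinearMapLinear (R' := ℝ) (A := ℝ)
      (M₁ := fun _ : Fin i => V) (M₂ := ℝ))
    ContinuousMultilinearMap.toMultilinearMap_injective

variable {N : ℕ} {Ω : Set (EuclideanSpace ℝ (Fin N))}
  {μ : EuclideanSpace ℝ (Fin N) → Measure (EuclideanSpace ℝ (Fin N))}

theorem sub_mem_tangentPlane_iff {x v : EuclideanSpace ℝ (Fin N)} (hx : ‖outerNormal Ω x‖ = 1) :
    v - outerNormal Ω x ∈ tangentPlane Ω x ↔ ⟪v, outerNormal Ω x⟫_ℝ = 1 := by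
  rw [tangentPlane, Submodule.mem_orthogonal_singleton_iff_inner_left, inner_sub_left,
    real_inner_self_eq_norm_sq, hx, one_pow, sub_eq_zero]

theorem homogenisedValue_eq_integral {W : Type*} [NormedAddCommGroup W] [NormedSpace ℝ W]
    {x : EuclideanSpace ℝ (Fin N)} (hx : ‖outerNormal Ω x‖ = 1)
    (hsupp : ∀ᵐ v ∂(μ x), ⟪v, outerNormal Ω x⟫_ℝ = 1) (b : EuclideanSpace ℝ (Fin N) → W) :
    homogenisedValue Ω μ b x = ∫ v, ‖v‖ • b (‖v‖⁻¹ • v) ∂(μ x) := by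
  rw [homogenisedValue, Measure.restrict_eq_self_of_ae_mem]
  filter_upwards [hsupp] with v hv
  exact (sub_mem_tangentPlane_iff hx).2 hv

/-- The homogenised energy of a polynomial energy is the polynomial of the homogenised
coefficients. -/
theorem homogenisedEnergy_eq_sum {V : Type*} [NormedAddCommGroup V] [NormedSpace ℝ V]
    [FiniteDimensional ℝ V] {x : EuclideanSpace ℝ (Fin N)} (hx : ‖outerNormal Ω x‖ = 1)
    [IsFiniteMeasure (μ x)] (hsupp : ∀ᵐ v ∂(μ x), ⟪v, outerNormal Ω x⟫_ℝ = 1) {R : ℝ}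
    (hR : ∀ᵐ v ∂(μ x), ‖v‖ ≤ R) {m : ℕ}
    (a : (i : ℕ) → EuclideanSpace ℝ (Fin N) → ContinuousMultilinearMap ℝ (fun _ : Fin i => V) ℝ)
    (ha : ∀ i ≤ m, ContinuousOn (a i) (Metric.sphere 0 1))
    (w : EuclideanSpace ℝ (Fin N) → EuclideanSpace ℝ (Fin N) → V → ℝ)
    (hw : ∀ n ∈ Metric.sphere (0 : EuclideanSpace ℝ (Fin N)) 1, ∀ u : V,
      w x n u = ∑ i ∈ Finset.range (m + 1), a i n (fun _ => u)) (u : V) :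
    homogenisedEnergy Ω μ w x u =
      ∑ i ∈ Finset.range (m + 1), homogenisedValue Ω μ (a i) x (fun _ => u) := by
  rw [homogenisedEnergy, homogenisedValue_eq_integral hx hsupp]
  have hint : ∀ i ∈ Finset.range (m + 1),
      Integrable (fun v => ‖v‖ • a i (‖v‖⁻¹ • v)) (μ x) := by
    intro i hi
    have := finiteDimensional_continuousMultilinearMap (V := V) i
    have hc := continuous_norm_smul_comp_normalize (ha i (by simpa [Nat.lt_succ_iff] using hi))
    obtain ⟨M, hM⟩ := (isCompact_closedBall (0 : EuclideanSpace ℝ (Fin N)) R)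
      |>.exists_bound_of_continuousOn hc.continuousOn
    exact Integrable.of_bound hc.aestronglyMeasurable M
      (hR.mono fun v hv => hM v (mem_closedBall_zero_iff.2 hv))
  have h1 : ∫ v, ‖v‖ • w x (‖v‖⁻¹ • v) u ∂(μ x) =
      ∫ v, ∑ i ∈ Finset.range (m + 1), (‖v‖ • a i (‖v‖⁻¹ • v)) (fun _ => u) ∂(μ x) := by
    refine integral_congr_ae ?_
    filter_upwards [hsupp] with v hv
    -- The plane `⟪v, ν⟫ = 1` avoids the origin, so `v / ‖v‖` is a true unit vector and the formula
    -- for `w` applies.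
    have hv0 : v ≠ 0 := by
      rintro rfl
      rw [inner_zero_left] at hv
      exact zero_ne_one hv
    have hmem : ‖v‖⁻¹ • v ∈ Metric.sphere (0 : EuclideanSpace ℝ (Fin N)) 1 := by
      rw [mem_sphere_zero_iff_norm, norm_smul, norm_inv, norm_norm,
        inv_mul_cancel₀ (norm_ne_zero_iff.2 hv0)]
    rw [hw _ hmem, Finset.smul_sum]
    rfl
  rw [h1]
  -- Evaluation at `u` is a continuous linear functional, so it commutes with the integral.
  have happ : ∀ i (A : ContinuousMultilinearMap ℝ (fun _ : Fin i => V) ℝ), A (fun _ => u) =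
      ContinuousMultilinearMap.apply ℝ (fun _ : Fin i => V) ℝ (fun _ => u) A := fun i A => rfl
  simp_rw [happ]
  rw [integral_finsetSum _ fun i hi => ContinuousLinearMap.integrable_comp _ (hint i hi)]
  refine Finset.sum_congr rfl fun i hi => ?_
  have := finiteDimensional_continuousMultilinearMap (V := V) i
  have : CompleteSpace (ContinuousMultilinearMap ℝ (fun _ : Fin i => V) ℝ) :=
    FiniteDimensional.complete ℝ _
  rw [ContinuousLinearMap.integral_comp_comm _ (hint i hi), homogenisedValue_eq_integral hx hsupp]

theorem integrable_norm_pow_of_memLp {X V : Type*} [MeasurableSpace X] {σ : Measure X}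
    [IsFiniteMeasure σ] [NormedAddCommGroup V] {u : X → V} {q : ℝ} {i : ℕ} (hi : (i : ℝ) ≤ q)
    (hu : MemLp u (ENNReal.ofReal q) σ) : Integrable (fun x => ‖u x‖ ^ i) σ := by
  have h : MemLp u (i : ENNReal) σ := hu.mono_exponent (by
    rw [← ENNReal.ofReal_natCast]
    exact ENNReal.ofReal_le_ofReal hi)
  exact h.integrable_norm_pow'

theorem integrable_continuousMultilinearMap_apply {X V : Type*} [MeasurableSpace X]
    {σ : Measure X} [IsFiniteMeasure σ] [NormedAddCommGroup V] [NormedSpace ℝ V] {u : X → V}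
    {q : ℝ} {i : ℕ} (hi : (i : ℝ) ≤ q) (hu : MemLp u (ENNReal.ofReal q) σ)
    (A : ContinuousMultilinearMap ℝ (fun _ : Fin i => V) ℝ) :
    Integrable (fun x => A (fun _ => u x)) σ := by
  refine ((integrable_norm_pow_of_memLp hi hu).const_mul ‖A‖).mono' ?_ ?_
  · have hc : Continuous fun v : V => A (fun _ => v) := A.cont.comp (by fun_prop)
    exact hc.comp_aestronglyMeasurable hu.1
  · refine Eventually.of_forall fun x => ?_
    have := A.le_opNorm (fun _ => u x)
    simpa using this

end Homogenisation

end

/-! ### The main theorem -/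

theorem mainTheorem3 {N : ℕ} (hN : 1 ≤ N)
    {V : Type*} [NormedAddCommGroup V] [NormedSpace ℝ V] [FiniteDimensional ℝ V]
    {Ω : Set (EuclideanSpace ℝ (Fin N))} (hΩ : IsC2Domain Ω)
    {Ωε : ℝ → Set (EuclideanSpace ℝ (Fin N))} {φ : ℝ → EuclideanSpace ℝ (Fin N) → ℝ}
    {ε₀ : ℝ} (hε₀ : 0 < ε₀) (hΩε : IsRugosePerturbation Ω Ωε φ ε₀)
    {μ : EuclideanSpace ℝ (Fin N) → Measure (EuclideanSpace ℝ (Fin N))}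
    (hμ : GeneratesYoungMeasure (surfaceMeasure (frontier Ω))
      (fun ε => pseudoDerivative Ω (φ ε)) μ)
    {p q : ℝ} (hp : 1 < p) (hq : 1 < q)
    (hpq : p < (N : ℝ) → q < ((N : ℝ) - 1) * p / ((N : ℝ) - p))
    {m : ℕ} (hm : (m : ℝ) < q)
    (a : (i : ℕ) → EuclideanSpace ℝ (Fin N) → ContinuousMultilinearMap ℝ (fun _ : Fin i => V) ℝ)
    (ha : ∀ i ≤ m, ContinuousOn (a i) (Metric.sphere 0 1))
    (w : EuclideanSpace ℝ (Fin N) → EuclideanSpace ℝ (Fin N) → V → ℝ)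
    (hw : ∀ x ∈ frontier Ω, ∀ n ∈ Metric.sphere (0 : EuclideanSpace ℝ (Fin N)) 1, ∀ u : V,
      w x n u = ∑ i ∈ Finset.range (m + 1), a i n (fun _ => u)) :
    -- the coefficients converge
    (∀ i ≤ m, TendstoWeakStarLinfty (surfaceMeasure (frontier Ω))
      (fun ε x => surfaceElement (graphMap Ω (φ ε)) (frontier Ω) (frontier (Ωε ε)) x •
        a i (outerNormal (Ωε ε) (graphMap Ω (φ ε) x)))
      (homogenisedValue Ω μ (a i))) ∧
    -- the homogenised energy is the polynomial whose coefficients are the limits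
    (∀ᵐ x ∂(surfaceMeasure (frontier Ω)), ∀ u : V,
      homogenisedEnergy Ω μ w x u =
        ∑ i ∈ Finset.range (m + 1), homogenisedValue Ω μ (a i) x (fun _ => u)) ∧
    -- the homogenised energy is the limit of the surface energies
    (∀ u : EuclideanSpace ℝ (Fin N) → V,
      MemLp u (ENNReal.ofReal q) (surfaceMeasure (frontier Ω)) →
      (∀ᶠ ε in 𝓝[>] (0 : ℝ), Integrable
        (fun x => w x (outerNormal (Ωε ε) (graphMap Ω (φ ε) x)) (u x) *
          surfaceElement (graphMap Ω (φ ε)) (frontier Ω) (frontier (Ωε ε)) x)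
        (surfaceMeasure (frontier Ω))) ∧
      Integrable (fun x => homogenisedEnergy Ω μ w x (u x)) (surfaceMeasure (frontier Ω)) ∧
      Tendsto (fun ε => ∫ x, w x (outerNormal (Ωε ε) (graphMap Ω (φ ε) x)) (u x) *
          surfaceElement (graphMap Ω (φ ε)) (frontier Ω) (frontier (Ωε ε)) x
          ∂(surfaceMeasure (frontier Ω))) (𝓝[>] (0 : ℝ))
        (𝓝 (∫ x, homogenisedEnergy Ω μ w x (u x) ∂(surfaceMeasure (frontier Ω))))) := by
  set Γ := frontier Ω with hΓ
  set σ := surfaceMeasure Γ with hσ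
  have hΓm : MeasurableSet Γ := isClosed_frontier.measurableSet
  have hfin : IsFiniteMeasure σ := hΩ.isFiniteMeasure_surfaceMeasure hN
  obtain ⟨Lν, hν⟩ := hΩ.exists_lipschitzOnWith_outerNormal
  have hνm : AEStronglyMeasurable (outerNormal Ω) σ :=
    hν.continuousOn.aestronglyMeasurable hΓm
  have hν1 : ∀ᵐ x ∂σ, ‖outerNormal Ω x‖ = 1 :=
    (ae_restrict_mem hΓm).mono fun x hx => hΩ.norm_outerNormal hx
  obtain ⟨R, hR, hasym⟩ := hΩε.exists_asymptotics hε₀ hN hΩ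
  have hf := hR.mono fun ε h => h.1
  have hfR := hR.mono fun ε h => h.2
  have hball := hμ.ae_ae_norm_le hf hfR
  -- `D̂φ` is `ν` minus a tangential vector, so its inner product with `ν` is one for every `ε`.
  have hplane : ∀ᵐ x ∂σ, ∀ᵐ v ∂(μ x), ⟪v, outerNormal Ω x⟫_ℝ = 1 := by
    refine hμ.ae_ae_inner_eq_one hf hνm (hν1.mono fun x hx => hx.le)
      (Eventually.of_forall fun ε => ?_)
    filter_upwards [hν1] with x hx
    rw [pseudoDerivative, inner_sub_left, inner_tangentialGradient, real_inner_self_eq_norm_sq, hx]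
    norm_num
  have hunit : ∀ᶠ ε in 𝓝[>] (0 : ℝ), ∀ᵐ x ∂σ,
      ‖outerNormal (Ωε ε) (graphMap Ω (φ ε) x)‖ = 1 :=
    (hasym 1 one_pos).mono fun ε h => h.2.mono fun x hx => hx.1
  have part1 : ∀ i ≤ m, TendstoWeakStarLinfty σ
      (fun ε x => surfaceElement (graphMap Ω (φ ε)) Γ (frontier (Ωε ε)) x •
        a i (outerNormal (Ωε ε) (graphMap Ω (φ ε) x)))
      (homogenisedValue Ω μ (a i)) := by
    intro i hi
    have := finiteDimensional_continuousMultilinearMap (V := V) i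
    have h1 := hμ.tendstoWeakStarLinfty hf hfR ((hasym 1 one_pos).mono fun ε h => h.1)
      (fun θ hθ => (hasym θ hθ).mono fun ε h => h.2.mono fun x hx => hx.2)
      (continuous_norm_smul_comp_normalize (ha i hi))
    refine h1.congr ?_ ?_
    · filter_upwards [hunit] with ε hε
      filter_upwards [hε] with x hx
      set γ := surfaceElement (graphMap Ω (φ ε)) Γ (frontier (Ωε ε)) x with hγ
      -- Non-negativity of `γ` makes the homogeneous extension at `γ ν̃` equal to `γ a_i(ν̃)`; both
      -- sides vanish when `γ = 0`.
      have hγ0 : 0 ≤ γ := ENNReal.toReal_nonneg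
      rw [norm_smul, hx, mul_one, Real.norm_of_nonneg hγ0]
      by_cases h0 : γ = 0
      · rw [h0, zero_smul, zero_smul]
      · rw [inv_smul_smul₀ h0]
    · filter_upwards [hν1, hplane] with x hx hxs
      exact (homogenisedValue_eq_integral hx hxs (a i)).symm
  have part2 : ∀ᵐ x ∂σ, ∀ u : V, homogenisedEnergy Ω μ w x u =
      ∑ i ∈ Finset.range (m + 1), homogenisedValue Ω μ (a i) x (fun _ => u) := by
    filter_upwards [hν1, hplane, hball, hμ.mass_le_one, ae_restrict_mem hΓm] with x h1 h2 h3 h4 h5 u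
    have : IsFiniteMeasure (μ x) := ⟨h4.trans_lt ENNReal.one_lt_top⟩
    exact homogenisedEnergy_eq_sum h1 h2 h3 a ha w (hw x h5) u
  refine ⟨part1, part2, fun u hu => ?_⟩
  -- The coefficients are tested with the functional `A ↦ A[u(x), …, u(x)]`, integrable in `x` since
  -- `i ≤ q` and `σ` is finite.
  have key := fun i (hi : i ≤ m) => by
    have := finiteDimensional_continuousMultilinearMap (V := V) i
    exact (part1 i hi).tendsto_integral_dual
      (fun x => (ContinuousMultilinearMap.apply ℝ (fun _ : Fin i => V) ℝ (fun _ => u x)).toLinearMap)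
      (fun A => integrable_continuousMultilinearMap_apply
        ((Nat.cast_le.2 hi).trans hm.le) hu A)
  have hrange : ∀ i ∈ Finset.range (m + 1), i ≤ m := fun i hi => by
    simpa [Nat.lt_succ_iff] using hi
  have e0 : (fun x => homogenisedEnergy Ω μ w x (u x)) =ᵐ[σ] fun x =>
      ∑ i ∈ Finset.range (m + 1), homogenisedValue Ω μ (a i) x (fun _ => u x) :=
    part2.mono fun x hx => hx (u x)
  have e1 : ∀ᶠ ε in 𝓝[>] (0 : ℝ), (fun x => w x (outerNormal (Ωε ε) (graphMap Ω (φ ε) x)) (u x) *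
      surfaceElement (graphMap Ω (φ ε)) Γ (frontier (Ωε ε)) x) =ᵐ[σ] fun x =>
      ∑ i ∈ Finset.range (m + 1), (surfaceElement (graphMap Ω (φ ε)) Γ (frontier (Ωε ε)) x •
        a i (outerNormal (Ωε ε) (graphMap Ω (φ ε) x))) (fun _ => u x) := by
    filter_upwards [hunit] with ε hε
    filter_upwards [hε, ae_restrict_mem hΓm] with x hx hxΓ
    rw [hw x hxΓ _ (mem_sphere_zero_iff_norm.2 hx), mul_comm, Finset.mul_sum]
    rfl
  have e2 : ∀ᶠ ε in 𝓝[>] (0 : ℝ), ∀ i ∈ Finset.range (m + 1), Integrable (fun x =>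
      (surfaceElement (graphMap Ω (φ ε)) Γ (frontier (Ωε ε)) x •
        a i (outerNormal (Ωε ε) (graphMap Ω (φ ε) x))) (fun _ => u x)) σ :=
    (Finset.eventually_all _).2 fun i hi => (key i (hrange i hi)).1
  have e3 : ∀ i ∈ Finset.range (m + 1), Integrable (fun x =>
      homogenisedValue Ω μ (a i) x (fun _ => u x)) σ := fun i hi => (key i (hrange i hi)).2.1
  refine ⟨?_, ?_, ?_⟩
  · filter_upwards [e1, e2] with ε h1 h2
    exact (integrable_finsetSum _ h2).congr h1.symm
  · exact (integrable_finsetSum _ e3).congr e0.symm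
  · rw [integral_congr_ae e0, integral_finsetSum _ e3]
    refine Tendsto.congr' ?_ (tendsto_finsetSum _ fun i hi => (key i (hrange i hi)).2.2)
    filter_upwards [e1, e2] with ε h1 h2
    rw [integral_congr_ae h1, integral_finsetSum _ h2]
    rfl
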